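/- Let $L$ be a first-order language containing the language of rings, let $\mathbb K$ be an $L$-structure expanding a field of characteristic $0$, let $T$ be the complete $L$-theory of $\mathbb K$, and let $F=\operatorname{dcl}(\emptyset)\subseteq\mathbb K$. Assume that $\mathbb K$ is algebraically bounded over $F$: for every $L$-formula $\varphi(\bar x,y)$ there are finitely many polynomials $p_1,\dots,p_m\in F[\bar x,y]$ such that, for every tuple $\bar a$ in $\mathbb K$ with $\varphi(\bar a,\mathbb K)$ finite, $\varphi(\bar a,\mathbb K)$ is contained in the zero set of some $p_i(\bar a,y)$ which is not the zero polynomial. Let $k\in\mathbb N$ and let $\eta_1,\dots,\eta_k$ be derivations on $F$. Let $L^{\bar\delta}$ be the expansion of $L$ by unary function symbols $\delta_1,\dots,\delta_k$, and let $T^{\bar\delta,nc}$ be the expansion of $T$ saying that each $\delta_i$ is a derivation extending $\eta_i$ (no commutation is required). For $M\models T$, a set $X\subseteq M^I$ ($I$ finite) definable with parameters $\bar b$ is called large if $\dim X=|I|$, where $\dim X=\max \operatorname{rk}(\bar a/\bar b)$, with $\bar a$ ranging over the points of $X$ in elementary extensions of $M$ and $\operatorname{rk}$ the rank for model-theoretic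 algebraic closure ($\dim\emptyset=-\infty$). Let $\Gamma$ be the free monoid generated by $\delta_1,\dots,\delta_k$, acting on $M$ by composition, with the partial order $\beta\preceq\alpha\beta$. For $V\subseteq\Gamma$ put $c^{V}=(\gamma c)_{\gamma\in V}$. Consider the following axiom schemes for $(M,\bar\delta)\models T^{\bar\delta,nc}$. * (nc-Deep) For every finite $\preceq$-initial $V\subset\Gamma$, with set $P$ of $\preceq$-maximal elements and $G=V\setminus P$, and every $Z\subseteq M^{V}$ which is $L$-definable with parameters in $M$: if the projection $\Pi_{G}(Z)\subseteq M^{G}$ is large, then there is $c\in M$ with $c^{V}\in Z$. * (nc-Wide) For every $n$ and every $W\subseteq M^{n}\times M^{k\times n}$ which is $L$-definable with parameters in $M$: if the projection $\Pi_n(W)\subseteq M^n$ is large, then there is $\bar c\in M^n$ with $(\bar c,\delta_1\bar c,\dots,\delta_k\bar c)\in W$. Then: 0. Both schemes are first-order: there are $L^{\bar\delta}$-theories $T^{\bar\delta,nc}_{deep}$ and $T^{\bar\delta,nc}_{wide}$, obtained from $T^{\bar\delta,nc}$ by adding, for each $L$-formula $\varphi(\bar y,\cdot)$ defining the sets $Z$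 (respectively $W$) as the parameters $\bar y$ vary, the corresponding sentence, in which largeness of the projection is expressed by an $L$-formula in $\bar y$; and their models are exactly the models of $T^{\bar\delta,nc}$ satisfying (nc-Deep), respectively (nc-Wide). 1. $T^{\bar\delta,nc}_{deep}$ and $T^{\bar\delta,nc}_{wide}$ are consistent and equivalent to each other. Write $T^{\bar\delta,nc}_g$ for this theory, given by either axiomatization. 2. If $T$ is model complete, then $T^{\bar\delta,nc}_g$ is the model completion of $T^{\bar\delta,nc}$: every model of $T^{\bar\delta,nc}_g$ is a model of $T^{\bar\delta,nc}$; every model of $T^{\bar\delta,nc}$ embeds in a model of $T^{\bar\delta,nc}_g$; and any two models of $T^{\bar\delta,nc}_g$ containing a common substructure $A\models T^{\bar\delta,nc}$ are elementarily equivalent over $A$. Thus $T^{\bar\delta,nc}_{deep}$ and $T^{\bar\delta,nc}_{wide}$ both axiomatize the model completion. 3. If $T$ eliminates quantifiers, then $T^{\bar\delta,nc}_g$ eliminates quantifiers. 4. (With no further assumption on $T$.) For every $L^{\bar\delta}$-formula $\alpha(x_1,\dots,x_n)$ there is an $L$-formula $\beta$ in variables $x_{j,\gamma}$ $(1\le j\le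 n,\ \gamma\in\Gamma)$, only finitely many of which occur in $\beta$, such that $$T^{\bar\delta,nc}_g\models\forall\bar x\,\bigl(\alpha(\bar x)\leftrightarrow\beta(\bar x^{\Gamma})\bigr),$$ where $\bar x^{\Gamma}$ substitutes $\gamma x_j$ for $x_{j,\gamma}$. -/

import Mathlib

open FirstOrder FirstOrder.Language

universe u v w w'

namespace NCDer

section Geometry

/-! ### Algebraic closure, rank and dimension in a first-order structure -/

/-- The model-theoretic definable closure of `A`: the elements `c` such that `{c}` is definable
with parameters from `A`. -/
def dcl (L : FirstOrder.Language.{u, v}) {M : Type w} [L.Structure M] (A : Set M) : Set M :=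
  {c | A.Definable₁ L {c}}

/-- The model-theoretic algebraic closure of `A`: the union of all finite subsets of `M` which
are definable with parameters from `A`. -/
def acl (L : FirstOrder.Language.{u, v}) {M : Type w} [L.Structure M] (A : Set M) : Set M :=
  {c | ∃ s : Set M, A.Definable₁ L s ∧ s.Finite ∧ c ∈ s}

/-- `S` is independent over `B` with respect to algebraic closure. -/
def AclIndep (L : FirstOrder.Language.{u, v}) {M : Type w} [L.Structure M] (S B : Set M) : Prop :=
  ∀ x ∈ S, x ∉ acl L (B ∪ (S \ {x}))

/-- The rank of `V` over `B`: the maximal size of a subset of `V` independent over `B`. -/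
noncomputable def rk (L : FirstOrder.Language.{u, v}) {M : Type w} [L.Structure M] (V B : Set M) : ℕ∞ :=
  ⨆ S : {S : Set M // S ⊆ V ∧ AclIndep L S B}, S.1.encard

/-- The subset of `M ^ ι` defined by the formula `φ` with parameters `b`. -/
def defSet {L : FirstOrder.Language.{u, v}} {M : Type w} [L.Structure M] {m : ℕ} {ι : Type*}
    (φ : L.Formula (Fin m ⊕ ι)) (b : Fin m → M) : Set (ι → M) :=
  {x | φ.Realize (Sum.elim b x)}

/-- The dimension of a subset `X` of `M ^ ι` definable with parameters: the supremum of the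
ranks `rk (a / b)`, where `X` is defined by a formula with parameters `b`, and `a` ranges over
the points of the interpretation of `X` in the elementary extensions of `M`.
The dimension of the empty set is `⊥`. -/
noncomputable def dim (L : FirstOrder.Language.{u, v}) {M : Type w} [L.Structure M] {ι : Type*}
    (X : Set (ι → M)) : WithBot ℕ∞ :=
  sSup {r | ∃ (m : ℕ) (φ : L.Formula (Fin m ⊕ ι)) (b : Fin m → M), X = defSet φ b ∧
    ∃ (N : Type (max u v w)) (_ : L.Structure N) (f : M ↪ₑ[L] N) (a : ι → N),
      a ∈ defSet φ (f ∘ b) ∧ r = (rk L (Set.range a) (Set.range (f ∘ b)) : WithBot ℕ∞)}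

/-- A subset of `M ^ ι` is large if its dimension is the number of coordinates. -/
def IsLarge (L : FirstOrder.Language.{u, v}) {M : Type w} [L.Structure M] {ι : Type*}
    (X : Set (ι → M)) : Prop :=
  dim L X = ((ENat.card ι : ℕ∞) : WithBot ℕ∞)

end Geometry

section AlgebraicallyBounded

/-- An `L`-formula without parameters defines the element `a`. -/
def DefinesElem {L : FirstOrder.Language.{u, v}} {M : Type w} [L.Structure M]
    (φ : L.Formula (Fin 1)) (a : M) : Prop :=
  ∀ x : M, φ.Realize (fun _ => x) ↔ x = a

theorem mem_dcl_empty_iff {L : FirstOrder.Language.{u, v}} {M : Type w} [L.Structure M] {a : M} :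
    a ∈ dcl L (∅ : Set M) ↔ ∃ φ : L.Formula (Fin 1), DefinesElem φ a := by
  unfold dcl DefinesElem Set.Definable₁
  rw [Set.mem_ofPred_eq, Set.empty_definable_iff]
  refine exists_congr fun φ => ?_
  constructor
  · intro h x
    have := Set.ext_iff.1 h (fun _ => x)
    simpa using this.symm
  · intro h
    ext x
    have hx : x = fun _ => x 0 := by
      funext i
      rw [Subsingleton.elim i 0]
    have h2 := h (x 0)
    rw [← hx] at h2
    simpa using h2.symm

theorem funMap_mem_dcl_empty {L : FirstOrder.Language.{u, v}} {M : Type w} [L.Structure M] {n : ℕ}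
    (f : L.Functions n) (x : Fin n → M) (hx : ∀ i, x i ∈ dcl L (∅ : Set M)) :
    Structure.funMap f x ∈ dcl L (∅ : Set M) := by
  simp only [mem_dcl_empty_iff] at hx ⊢
  choose φ hφ using hx
  refine ⟨Formula.iExs (Fin n) ((Formula.iInf fun i => (φ i).relabel fun _ => Sum.inr i) ⊓
    Term.equal (Term.var (Sum.inl 0)) (Term.func f fun i => Term.var (Sum.inr i))), ?_⟩
  intro y
  simp only [Formula.realize_iExs, Formula.realize_inf, Formula.realize_iInf,
    Formula.realize_relabel, Formula.realize_equal, Term.realize_var, Term.realize_func,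
    Sum.elim_inl, Sum.elim_inr, Function.comp_def]
  constructor
  · rintro ⟨z, hz, rfl⟩
    congr 1
    funext i
    exact (hφ i _).1 (hz i)
  · rintro rfl
    exact ⟨x, fun i => (hφ i _).2 rfl, rfl⟩

/-- The definable closure of the empty set, as a subring of a structure expanding a field. -/
def dclRing {L : FirstOrder.Language.{u, v}} (ι : FirstOrder.Language.ring →ᴸ L) (K : Type w) [Field K]
    [Ring.CompatibleRing K] [L.Structure K] [ι.IsExpansionOn K] : Subring K where
  carrier := dcl L (∅ : Set K)
  mul_mem' {a b} ha hb := by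
    have h := funMap_mem_dcl_empty (ι.onFunction Ring.mulFunc) ![a, b]
      (by intro i; fin_cases i <;> assumption)
    rw [LHom.map_onFunction] at h
    simpa using h
  one_mem' := by
    have h := funMap_mem_dcl_empty (M := K) (ι.onFunction Ring.oneFunc) ![] (fun i => i.elim0)
    rw [LHom.map_onFunction] at h
    simpa using h
  add_mem' {a b} ha hb := by
    have h := funMap_mem_dcl_empty (ι.onFunction Ring.addFunc) ![a, b]
      (by intro i; fin_cases i <;> assumption)
    rw [LHom.map_onFunction] at h
    simpa using h
  zero_mem' := by
    have h := funMap_mem_dcl_empty (M := K) (ι.onFunction Ring.zeroFunc) ![] (fun i => i.elim0)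
    rw [LHom.map_onFunction] at h
    simpa using h
  neg_mem' {a} ha := by
    have h := funMap_mem_dcl_empty (ι.onFunction Ring.negFunc) ![a]
      (by intro i; fin_cases i; assumption)
    rw [LHom.map_onFunction] at h
    simpa using h

/-- `K` is algebraically bounded over its subring `F`: for every formula `φ(x₁, …, xₙ, y)` there
are finitely many polynomials `p ∈ F[x₁, …, xₙ][y]` such that, whenever `φ(a, K)` is finite,
it is contained in the zero set of some nonzero `p(a, y)`. -/
def AlgebraicallyBoundedOver (L : FirstOrder.Language.{u, v}) {K : Type w} [Field K] [L.Structure K]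
    (F : Subring K) : Prop :=
  ∀ (n : ℕ) (φ : L.Formula (Fin n ⊕ Fin 1)),
    ∃ P : Finset (Polynomial (MvPolynomial (Fin n) F)), ∀ a : Fin n → K,
      {b : K | φ.Realize (Sum.elim a fun _ => b)}.Finite →
        ∃ p ∈ P, p.map (MvPolynomial.eval₂Hom F.subtype a) ≠ 0 ∧
          ∀ b : K, φ.Realize (Sum.elim a fun _ => b) →
            (p.map (MvPolynomial.eval₂Hom F.subtype a)).eval b = 0

end AlgebraicallyBounded

section Theories

/-! ### Model completeness, model completions, quantifier elimination -/

/-- Every embedding between models of `T` is elementary. -/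
def IsModelComplete {L : FirstOrder.Language.{u, v}} (T : L.Theory) : Prop :=
  ∀ (A B : Theory.ModelType.{u, v, w} T) (f : A ↪[L] B) (n : ℕ) (φ : L.Formula (Fin n))
    (a : Fin n → A), φ.Realize (f ∘ a) ↔ φ.Realize a

/-- `U'` is a model completion of `U`. -/
structure IsModelCompletion {L : FirstOrder.Language.{u, v}} (U U' : L.Theory) : Prop where
  model_of_model : ∀ A : Theory.ModelType.{u, v, w} U', A ⊨ U
  exists_embedding : ∀ A : Theory.ModelType.{u, v, w} U,
    ∃ B : Theory.ModelType.{u, v, w} U', Nonempty (A ↪[L] B)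
  elementarily_equivalent : ∀ (A : Theory.ModelType.{u, v, w} U)
    (B C : Theory.ModelType.{u, v, w} U') (f : A ↪[L] B) (g : A ↪[L] C)
    (n : ℕ) (φ : L.Formula (Fin n)) (a : Fin n → A), φ.Realize (f ∘ a) ↔ φ.Realize (g ∘ a)

/-- `T` eliminates quantifiers. -/
def HasQE {L : FirstOrder.Language.{u, v}} (T : L.Theory) : Prop :=
  ∀ (n : ℕ) (φ : L.Formula (Fin n)), ∃ ψ : L.Formula (Fin n),
    BoundedFormula.IsQF ψ ∧ T.Iff φ ψ

/-- Two theories are equivalent: each one proves the other. -/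
def TheoryEquiv {L : FirstOrder.Language.{u, v}} (T T' : L.Theory) : Prop :=
  (∀ σ ∈ T', T ⊨ᵇ σ) ∧ (∀ σ ∈ T, T' ⊨ᵇ σ)

/-- The universal closure of a formula. -/
noncomputable def univClosure {L : FirstOrder.Language.{u, v}} {β : Type} [Finite β] (φ : L.Formula β) :
    L.Sentence :=
  Formula.iAlls β (φ.relabel (Sum.inr : β → Empty ⊕ β))

end Theories

section Words

/-! ### The free monoid of derivation words -/

/-- The value at `x` of the composition `D i₁ ∘ ⋯ ∘ D iᵣ`, where `γ` is the word `i₁ ⋯ iᵣ`. -/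
def wordAct {k : ℕ} {X : Type*} (D : Fin k → X → X) (γ : FreeMonoid (Fin k)) (x : X) : X :=
  γ.toList.foldr D x

/-- The partial order `β ≼ α β` on words. -/
def WordLE {k : ℕ} (β γ : FreeMonoid (Fin k)) : Prop := ∃ α, γ = α * β

/-- `V` is an initial set of words with respect to `≼`. -/
def IsInitial {k : ℕ} (V : Set (FreeMonoid (Fin k))) : Prop :=
  ∀ β γ, γ ∈ V → WordLE β γ → β ∈ V

/-- The set of `≼`-maximal elements of `V`. -/
def maxWords {k : ℕ} (V : Set (FreeMonoid (Fin k))) : Set (FreeMonoid (Fin k)) :=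
  {γ | γ ∈ V ∧ ∀ μ ∈ V, WordLE γ μ → μ = γ}

/-- The projection `M ^ V → M ^ F`, where `F` is the set of non-maximal elements of `V`. -/
def projF {k : ℕ} {M : Type*} (V : Set (FreeMonoid (Fin k))) (x : V → M) :
    (V \ maxWords V : Set (FreeMonoid (Fin k))) → M :=
  fun γ => x ⟨γ.1, γ.2.1⟩

/-- The projection `M ^ n × M ^ (k × n) → M ^ n`. -/
def projN {k n : ℕ} {M : Type*} (x : Fin n ⊕ Fin k × Fin n → M) : Fin n → M :=
  fun j => x (Sum.inl j)

end Words

section Schemes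

/-! ### The two axiom schemes, in an `L`-structure with unary maps `D₁, …, Dₖ` -/

/-- The scheme nc-Deep: for every finite `≼`-initial set of words `V` and every subset `Z` of
`M ^ V` definable with parameters, if the projection of `Z` onto the non-maximal coordinates is
large, then there is `c ∈ M` with `(γ c)_{γ ∈ V} ∈ Z`. -/
def NCDeep (L : FirstOrder.Language.{u, v}) {M : Type w} [L.Structure M] {k : ℕ}
    (D : Fin k → M → M) : Prop :=
  ∀ V : Set (FreeMonoid (Fin k)), V.Finite → IsInitial V →
    ∀ Z : Set (V → M), (Set.univ : Set M).Definable L Z →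
      IsLarge L (projF V '' Z) → ∃ c : M, (fun γ : V => wordAct D γ.1 c) ∈ Z

/-- The scheme nc-Wide: for every `n` and every subset `W` of `M ^ n × M ^ (k × n)` definable
with parameters, if the projection of `W` onto `M ^ n` is large, then there is a tuple
`c ∈ M ^ n` with `(c, D₁ c, …, Dₖ c) ∈ W`. -/
def NCWide (L : FirstOrder.Language.{u, v}) {M : Type w} [L.Structure M] {k : ℕ}
    (D : Fin k → M → M) : Prop :=
  ∀ (n : ℕ) (W : Set (Fin n ⊕ Fin k × Fin n → M)), (Set.univ : Set M).Definable L W →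
    IsLarge L (projN '' W) → ∃ c : Fin n → M, Sum.elim c (fun p => D p.1 (c p.2)) ∈ W

end Schemes

section DerivationLanguage

/-! ### The language with `k` new unary function symbols -/

/-- The symbols `δ₁, …, δₖ`. -/
inductive DerFunc (k : ℕ) : ℕ → Type
  | der : Fin k → DerFunc k 1

/-- The language with `k` unary function symbols only. -/
def derLang (k : ℕ) : FirstOrder.Language.{0, 0} := ⟨DerFunc k, fun _ => Empty⟩

/-- The expansion of `L` by `k` new unary function symbols. -/
abbrev ncLang (L : FirstOrder.Language.{u, v}) (k : ℕ) : FirstOrder.Language.{u, v} := L.sum (derLang k)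

/-- The `i`-th new function symbol. -/
def derFunc (L : FirstOrder.Language.{u, v}) {k : ℕ} (i : Fin k) : (ncLang L k).Functions 1 :=
  Sum.inr (DerFunc.der i)

/-- The interpretation of the new function symbols in a structure. -/
def derMap (L : FirstOrder.Language.{u, v}) {k : ℕ} (M : Type w) [(ncLang L k).Structure M]
    (i : Fin k) (x : M) : M :=
  Structure.funMap (derFunc L i) ![x]

/-- The term `δᵢ t`. -/
def derTerm {L : FirstOrder.Language.{u, v}} {k : ℕ} {α : Type w'} (i : Fin k)
    (t : (ncLang L k).Term α) : (ncLang L k).Term α :=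
  (derFunc L i).apply₁ t

/-- An `L`-formula, seen as a formula of the expanded language. -/
def toNC {L : FirstOrder.Language.{u, v}} (k : ℕ) {α : Type w'} (φ : L.Formula α) :
    (ncLang L k).Formula α :=
  (LHom.sumInl : L →ᴸ ncLang L k).onFormula φ

end DerivationLanguage

section DerivationTheories

variable {L : FirstOrder.Language.{u, v}} (ι : FirstOrder.Language.ring →ᴸ L)

/-- The sum of two terms. -/
def addT {k : ℕ} {α : Type w'} (s t : (ncLang L k).Term α) : (ncLang L k).Term α :=
  ((LHom.sumInl : L →ᴸ ncLang L k).onFunction (ι.onFunction Ring.addFunc)).apply₂ s t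

/-- The product of two terms. -/
def mulT {k : ℕ} {α : Type w'} (s t : (ncLang L k).Term α) : (ncLang L k).Term α :=
  ((LHom.sumInl : L →ᴸ ncLang L k).onFunction (ι.onFunction Ring.mulFunc)).apply₂ s t

/-- `∀ x y, δᵢ (x + y) = δᵢ x + δᵢ y`. -/
noncomputable def derAddAxiom {k : ℕ} (i : Fin k) : (ncLang L k).Sentence :=
  let x : (ncLang L k).Term (Fin 2) := Term.var 0
  let y : (ncLang L k).Term (Fin 2) := Term.var 1
  univClosure (Term.equal (derTerm i (addT ι x y)) (addT ι (derTerm i x) (derTerm i y)))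

/-- `∀ x y, δᵢ (x y) = x δᵢ y + y δᵢ x`. -/
noncomputable def derMulAxiom {k : ℕ} (i : Fin k) : (ncLang L k).Sentence :=
  let x : (ncLang L k).Term (Fin 2) := Term.var 0
  let y : (ncLang L k).Term (Fin 2) := Term.var 1
  univClosure (Term.equal (derTerm i (mulT ι x y))
    (addT ι (mulT ι x (derTerm i y)) (mulT ι y (derTerm i x))))

/-- `∀ x y, φ(x) ∧ ψ(y) → δᵢ x = y`. -/
noncomputable def derExtAxiom {k : ℕ} (i : Fin k) (φ ψ : L.Formula (Fin 1)) :
    (ncLang L k).Sentence :=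
  univClosure
    (((toNC k φ).relabel (fun _ => (0 : Fin 2)) ⊓ (toNC k ψ).relabel (fun _ => (1 : Fin 2))).imp
      (Term.equal (derTerm i (Term.var 0)) (Term.var 1)))

variable (K : Type w) [Field K] [Ring.CompatibleRing K] [L.Structure K] [ι.IsExpansionOn K]

/-- The expansion of the theory of `K` by axioms saying that each `δᵢ` is a derivation which
extends the derivation `ηᵢ` of `F = dcl(∅)`. The latter is expressed by the sentences
`∀ x y, φ(x) ∧ ψ(y) → δᵢ x = y`, for `φ` and `ψ` formulas defining respectively an element `a`
of `F` and the element `ηᵢ a`. -/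
def ncTheory {k : ℕ} (η : Fin k → Derivation ℤ (dclRing ι K) (dclRing ι K)) :
    (ncLang L k).Theory :=
  (LHom.sumInl : L →ᴸ ncLang L k).onTheory (L.completeTheory K) ∪
    Set.range (derAddAxiom ι) ∪ Set.range (derMulAxiom ι) ∪
    {σ | ∃ (i : Fin k) (a : dclRing ι K) (φ ψ : L.Formula (Fin 1)),
      DefinesElem φ (a : K) ∧ DefinesElem ψ (η i a : K) ∧ σ = derExtAxiom i φ ψ}

/-- The formula `lam(y)` expresses, in every model `M` of the theory of `K`, that the projection
under `p` of the set defined by `φ(y, M)` is large. -/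
def ExpressesLarge (L : FirstOrder.Language.{u, v}) (K : Type w) [L.Structure K] {m : ℕ} {β β' : Type}
    (p : ∀ M : Type (max u v w), (β → M) → (β' → M))
    (φ : L.Formula (Fin m ⊕ β)) (lam : L.Formula (Fin m)) : Prop :=
  ∀ (M : Theory.ModelType.{u, v, max u v w} (L.completeTheory K)) (b : Fin m → M),
    lam.Realize b ↔ IsLarge L (p M '' defSet φ b)

/-- The sentence `∀ y, lam(y) → ∃ c, φ(y, (γ c)_{γ ∈ V})`. -/
noncomputable def deepAxiom {k m : ℕ} (V : Set (FreeMonoid (Fin k))) (φ : L.Formula (Fin m ⊕ V))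
    (lam : L.Formula (Fin m)) : (ncLang L k).Sentence :=
  univClosure ((toNC k lam).imp (Formula.iExs (Fin 1)
    (BoundedFormula.subst (toNC k φ) (Sum.elim (fun j => Term.var (Sum.inl j))
      (fun γ => wordAct derTerm γ.1 (Term.var (Sum.inr 0)))))))

/-- The sentence `∀ y, lam(y) → ∃ c₁ … cₙ, φ(y, c, δ₁ c, …, δₖ c)`. -/
noncomputable def wideAxiom {k m n : ℕ} (φ : L.Formula (Fin m ⊕ (Fin n ⊕ Fin k × Fin n)))
    (lam : L.Formula (Fin m)) : (ncLang L k).Sentence :=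
  univClosure ((toNC k lam).imp (Formula.iExs (Fin n)
    (BoundedFormula.subst (toNC k φ) (Sum.elim (fun j => Term.var (Sum.inl j))
      (Sum.elim (fun j => Term.var (Sum.inr j))
        (fun p => derTerm p.1 (Term.var (Sum.inr p.2))))))))

/-- The theory axiomatized by the scheme nc-Deep: the sentences saying, for every finite initial
`V` and every formula `φ(y, x_V)`, that if the projection of `φ(y, M)` is large, then `φ(y, M)`
contains some `(γ c)_{γ ∈ V}`. -/
def ncDeepTheory {k : ℕ} (η : Fin k → Derivation ℤ (dclRing ι K) (dclRing ι K)) :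
    (ncLang L k).Theory :=
  ncTheory ι K η ∪
    {σ | ∃ (V : Set (FreeMonoid (Fin k))) (m : ℕ) (φ : L.Formula (Fin m ⊕ V))
      (lam : L.Formula (Fin m)), V.Finite ∧ IsInitial V ∧
        ExpressesLarge L K (fun _ => projF V) φ lam ∧ σ = deepAxiom V φ lam}

/-- The theory axiomatized by the scheme nc-Wide: the sentences saying, for every `n` and every
formula `φ(y, x)`, that if the projection of `φ(y, M)` onto `M ^ n` is large, then `φ(y, M)`
contains some `(c, δ₁ c, …, δₖ c)`. -/
def ncWideTheory {k : ℕ} (η : Fin k → Derivation ℤ (dclRing ι K) (dclRing ι K)) :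
    (ncLang L k).Theory :=
  ncTheory ι K η ∪
    {σ | ∃ (n m : ℕ) (φ : L.Formula (Fin m ⊕ (Fin n ⊕ Fin k × Fin n)))
      (lam : L.Formula (Fin m)),
        ExpressesLarge L K (fun _ => projN) φ lam ∧ σ = wideAxiom φ lam}

/-- For an `L`-formula `β` in the variables `x_{j,γ}`, the formula `β(x ^ Γ)` of the expanded
language, obtained by substituting the term `γ x_j` for `x_{j,γ}`. -/
def atJets {k n : ℕ} (β : L.Formula (Fin n × FreeMonoid (Fin k))) :
    (ncLang L k).Formula (Fin n) :=
  BoundedFormula.subst (toNC k β) (fun p => wordAct derTerm p.2 (Term.var p.1))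

end DerivationTheories

end NCDer

/-!
The whole argument rests on a translation of largeness. Algebraic boundedness, extended from one to
several variables (`exists_bounds`), says that in a definable family the sets which are not Zariski
dense lie in the zero sets of finitely many polynomials over `F`, uniformly in all models of the
theory of `K`. Hence model-theoretic algebraic closure is field-theoretic algebraic closure over
`F`, a definable set is large if and only if no nonzero polynomial vanishes on it
(`isLarge_iff_isZariskiDense`), and this property is expressed by a formula in the parameters
(`exists_denseFormula`). So both schemes are first-order.

*Consistency.* In characteristic zero a derivation extends to any extension field, with arbitrary
values on elements which are algebraically independent over the smaller field
(`exists_derivation_extension`). Given a model with derivations, all the problems of nc-Wide over it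
can be solved in a single elementary extension by tuples whose first blocks are algebraically
independent over the model, as the projections are dense; the derivations are then prescribed on
these blocks (`exists_wide_step`). The union of a chain of such extensions satisfies nc-Wide
(`DerModel.exists_wide`). Moreover nc-Wide implies nc-Deep directly, by treating the non-maximal
derivatives of an element as the entries of a tuple (`ncDeep_of_ncWide`).

*Reduction of formulas.* Two facts are used. First, models with derivations which contain tuples
closed under the derivations and of the same type in the language `L` can be amalgamated over these
tuples (`DerModel.exists_amalgam`). Secondly, a model of nc-Deep is existentially closed with
respect to one element: if the derivatives of an element `d` of an extension, elementary for `L`,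
satisfy an `L`-formula over the model, then so do the derivatives of an element of the model
(`DerModel.Hom.exists_of_ncDeep`). For the latter, the words are enumerated compatibly with left
multiplication. The derivatives of `d` which are not algebraic over the earlier ones are
algebraically independent, and once a derivative is a simple root of a polynomial in the earlier
ones, its own derivatives are rational functions of the earlier ones. So the problem concerns an
initial set of words whose non-maximal elements give algebraically independent derivatives, as
nc-Deep requires. Together the two facts show that the `L`-type of the derivatives of a tuple
determines, in models of nc-Deep, which existential formulas in one variable it satisfies; by
compactness (`exists_iff_of_preserved`) and induction on formulas, each formula is equivalent to an
`L`-formula in the derivatives (`exists_iff_jets`).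

*Consequences.* An `L`-elementary extension of models of nc-Deep which respects the derivations is
therefore elementary. Embedding a model of nc-Deep in a model of nc-Wide yields nc-Wide
(`model_ncWideTheory_of_ncDeepTheory`). If the theory of `K` is model complete or eliminates
quantifiers, the `L`-formulas in the derivatives are preserved by embeddings or can be taken
quantifier-free, which gives the model completion and quantifier elimination.
-/

universe x y

namespace NCDer

/-! ### Extending derivations of fields of characteristic zero -/

/-- The lifting property of formally smooth algebras, in terms of ring homomorphisms. -/
theorem exists_ringHom_lift {P N B : Type*} [CommRing P] [CommRing N] [CommRing B] [Algebra P N]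
    [Algebra.FormallySmooth P N] (h : P →+* B) (π : B →+* N) (hπ : Function.Surjective π)
    (hnil : IsNilpotent (RingHom.ker π)) (hcomp : π.comp h = algebraMap P N) :
    ∃ g : N →+* B, π.comp g = RingHom.id N ∧ g.comp (algebraMap P N) = h := by
  let _ : Algebra P B := h.toAlgebra
  let π' : B →ₐ[P] N := { π with commutes' := fun r => DFunLike.congr_fun hcomp r }
  let g := Algebra.FormallySmooth.liftOfSurjective (AlgHom.id P N) π' hπ hnil
  refine ⟨g.toRingHom, ?_, ?_⟩
  · ext x
    exact Algebra.FormallySmooth.liftOfSurjective_apply (AlgHom.id P N) π' hπ hnil x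
  · ext x
    exact g.commutes x

/-- A derivation from a domain `R` to a field `N` of characteristic zero containing `R` extends
to `N`, with prescribed values on a family which is algebraically independent over `R`: the
extension to a transcendence basis is free, and the rest of `N` is separably algebraic. -/
theorem exists_derivation_extension {R N σ : Type*} [CommRing R] [IsDomain R] [Field N]
    [CharZero N] [Algebra R N] {a : σ → N} (ha : AlgebraicIndependent R a)
    (D : Derivation ℤ R N) (b : σ → N) :
    ∃ D' : Derivation ℤ N N, (∀ r, D' (algebraMap R N r) = D r) ∧ ∀ s, D' (a s) = b s := by
  classical
  obtain ⟨B, haB, hB⟩ := exists_isTranscendenceBasis_superset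
    ((algebraicIndependent_subtype_range ha.injective).2 ha)
  have hinj : Function.Injective a := ha.injective
  let P := Algebra.adjoin R (Set.range ((↑) : B → N))
  let val : B → N := fun x => if h : ∃ s, a s = x then b h.choose else 0
  have hval : ∀ (s : σ) (hs : a s ∈ B), val ⟨a s, hs⟩ = b s := by
    intro s hs
    have h : ∃ s', a s' = a s := ⟨s, rfl⟩
    simp only [val, dif_pos h]
    rw [hinj h.choose_spec]
  -- a derivation with values in `N` is a ring homomorphism to the dual numbers over `N`
  let c : R →+* TrivSqZeroExt N N :=
    { toFun := fun r => TrivSqZeroExt.inl (algebraMap R N r) + TrivSqZeroExt.inr (D r)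
      map_one' := by ext <;> simp
      map_zero' := by ext <;> simp
      map_mul' := by
        intro x y
        refine TrivSqZeroExt.ext (by simp) ?_
        simp only [map_mul, Derivation.leibniz, TrivSqZeroExt.snd_add, TrivSqZeroExt.snd_inl,
          TrivSqZeroExt.snd_inr, TrivSqZeroExt.snd_mul, TrivSqZeroExt.fst_add,
          TrivSqZeroExt.fst_inl, TrivSqZeroExt.fst_inr, Algebra.smul_def,
          Algebra.algebraMap_self_apply,
          MulOpposite.smul_eq_mul_unop, MulOpposite.unop_op]
        ring
      map_add' := by intro x y; ext <;> simp }
  let h0 : MvPolynomial B R →+* TrivSqZeroExt N N :=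
    MvPolynomial.eval₂Hom c fun x => TrivSqZeroExt.inl (x : N) + TrivSqZeroExt.inr (val x)
  let h : P →+* TrivSqZeroExt N N := h0.comp hB.1.aevalEquiv.symm.toRingEquiv.toRingHom
  let π : TrivSqZeroExt N N →+* N := (TrivSqZeroExt.fstHom N N N).toRingHom
  have hπ : ∀ x, π x = x.fst := fun _ => rfl
  have hh0 : ∀ p, π (h0 p) = MvPolynomial.aeval ((↑) : B → N) p := by
    intro p
    induction p using MvPolynomial.induction_on with
    | C r => simp [h0, c, hπ]
    | add p q hp hq => simp only [map_add, hp, hq]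
    | mul_X p i hp => rw [map_mul, map_mul, hp, map_mul]; simp [h0, hπ]
  have hcomp : π.comp h = algebraMap P N := by
    ext x
    obtain ⟨p, rfl⟩ := hB.1.aevalEquiv.surjective x
    simp only [RingHom.comp_apply, h]
    simp only [RingEquiv.toRingHom_eq_coe, RingHom.coe_coe,
      AlgEquiv.coe_ringEquiv, AlgEquiv.symm_apply_apply, hh0]
    exact (hB.1.algebraMap_aevalEquiv p).symm
  -- `N` is formally smooth over `P`, being a separable extension of its field of fractions
  have : Algebra.IsAlgebraic P N := hB.isAlgebraic
  have : FaithfulSMul P N := (faithfulSMul_iff_algebraMap_injective P N).2 Subtype.val_injective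
  let _ : Algebra (FractionRing P) N := FractionRing.liftAlgebra P N
  have : IsScalarTower P (FractionRing P) N := FractionRing.isScalarTower_liftAlgebra P N
  have : Algebra.IsAlgebraic (FractionRing P) N :=
    (IsFractionRing.comap_isAlgebraic_iff (A := P) (K := FractionRing P)).1 inferInstance
  have : CharZero (FractionRing P) :=
    charZero_of_injective_algebraMap (FaithfulSMul.algebraMap_injective P (FractionRing P))
  have : Algebra.FormallyEtale (FractionRing P) N := Algebra.FormallyEtale.of_isSeparable _ N
  have : Algebra.FormallySmooth P (FractionRing P) := .of_isLocalization (nonZeroDivisors _)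
  have : Algebra.FormallySmooth P N := .comp P (FractionRing P) N
  obtain ⟨g, hg1, hg2⟩ := exists_ringHom_lift (N := N) h π
    (fun x => ⟨TrivSqZeroExt.inl x, rfl⟩)
    ⟨2, by
      rw [pow_two, Ideal.zero_eq_bot, eq_bot_iff, Ideal.mul_le]
      intro x hx y hy
      have hx' : x.fst = 0 := hx
      have hy' : y.fst = 0 := hy
      rw [Ideal.mem_bot]
      ext <;> simp [hx', hy']⟩ hcomp
  have hfst : ∀ x, (g x).fst = x := fun x => DFunLike.congr_fun hg1 x
  have hsnd : ∀ p, g (MvPolynomial.aeval ((↑) : B → N) p) = h0 p := by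
    intro p
    have := DFunLike.congr_fun hg2 (hB.1.aevalEquiv p)
    simp only [RingHom.comp_apply, h] at this
    simp only [RingEquiv.toRingHom_eq_coe, RingHom.coe_coe,
      AlgEquiv.coe_ringEquiv, AlgEquiv.symm_apply_apply] at this
    rw [← this]
    exact congrArg g (hB.1.algebraMap_aevalEquiv p).symm
  let d : N →+ N := { toFun := fun x => (g x).snd, map_zero' := by simp, map_add' := by simp }
  refine ⟨Derivation.mk' d.toIntLinearMap ?_, ?_, ?_⟩
  · intro x y
    simp [d, hfst, mul_comm y]
  · intro r
    have := hsnd (MvPolynomial.C r)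
    simp only [MvPolynomial.algHom_C] at this
    simp [d, this, h0, c]
  · intro s
    have hs : a s ∈ B := haB ⟨s, rfl⟩
    have := hsnd (MvPolynomial.X ⟨a s, hs⟩)
    simp only [MvPolynomial.aeval_X] at this
    simp [d, this, h0, hval]

/-- In characteristic zero, a derivation vanishing on a subfield vanishes on every element which
is algebraic over it. -/
theorem derivation_eq_zero_of_isAlgebraic {E N M : Type*} [Field E] [CharZero E] [Field N]
    [Algebra E N] [AddCommGroup M] [Module N M] [Module E M] [IsScalarTower E N M]
    (D : Derivation E N M) {x : N} (hx : IsAlgebraic E x) : D x = 0 := by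
  have h := D.map_aeval (minpoly E x) x
  rw [minpoly.aeval, map_zero] at h
  have hs := (minpoly.irreducible hx.isIntegral).separable
  have hne := hs.aeval_derivative_ne_zero (minpoly.aeval E x)
  exact (smul_eq_zero.1 h.symm).resolve_left hne

end NCDer

namespace NCDer

/-! ### Formulas: finite supports, projections and compactness -/

section Formulas

variable {L : FirstOrder.Language.{u, v}}

open Classical in
/-- The finite set of free variables of a formula. -/
noncomputable def supp {β : Type*} (φ : L.Formula β) : Finset β := BoundedFormula.freeVarFinset φ

open Classical in
/-- A formula, seen as a formula in its own free variables. -/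
noncomputable def core {β : Type*} (φ : L.Formula β) : L.Formula (supp φ) :=
  BoundedFormula.restrictFreeVar φ id

theorem realize_core {β : Type*} (φ : L.Formula β) {M : Type*} [L.Structure M] {b : β → M}
    {c : supp φ → M} (h : ∀ i, c i = b i) : (core φ).Realize c ↔ φ.Realize b := by
  classical
  exact BoundedFormula.realize_restrictFreeVar b h

theorem realize_congr {β : Type*} {φ : L.Formula β} {M : Type*} [L.Structure M] {b b' : β → M}
    (h : ∀ i ∈ supp φ, b i = b' i) : φ.Realize b ↔ φ.Realize b' := by
  rw [← realize_core φ (c := fun i => b i) fun _ => rfl,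
    ← realize_core φ (b := b') (c := fun i => b i) fun i => h i i.2]

variable {A Γ σ : Type*} [Finite σ]

/-- The variables of `Γ` which occur in a formula. -/
def varsR (ψ : L.Formula (A ⊕ Γ)) : Set Γ := {γ | Sum.inr γ ∈ supp ψ}

theorem finite_varsR (ψ : L.Formula (A ⊕ Γ)) : (varsR ψ).Finite :=
  (supp ψ).finite_toSet.preimage Sum.inr_injective.injOn

instance (ψ : L.Formula (A ⊕ Γ)) : Finite (varsR ψ) := finite_varsR ψ

/-- The formula `∃ z, z ∘ j = x ∧ ψ(b, z)` in the variables `(b, x)`; the tuple `z` may be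
infinite. -/
noncomputable def exProj (j : σ → Γ) (ψ : L.Formula (A ⊕ Γ)) : L.Formula (A ⊕ σ) :=
  Formula.iExs (varsR ψ)
    ((Formula.iInf fun p : {p : σ × varsR ψ // j p.1 = p.2} =>
        Term.equal (Term.var (Sum.inr p.1.2)) (Term.var (Sum.inl (Sum.inr p.1.1)))) ⊓
      (core ψ).relabel fun i => match i with
        | ⟨Sum.inl a, _⟩ => Sum.inl (Sum.inl a)
        | ⟨Sum.inr γ, h⟩ => Sum.inr ⟨γ, h⟩)

theorem realize_exProj {j : σ → Γ} (hj : Function.Injective j) (ψ : L.Formula (A ⊕ Γ))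
    {M : Type*} [L.Structure M] [Nonempty M] {b : A → M} {x : σ → M} :
    (exProj j ψ).Realize (Sum.elim b x) ↔ ∃ z : Γ → M, z ∘ j = x ∧ ψ.Realize (Sum.elim b z) := by
  classical
  simp only [exProj, Formula.realize_iExs, Formula.realize_inf, Formula.realize_iInf,
    Formula.realize_relabel, Formula.realize_equal, Term.realize_var, Sum.elim_inl, Sum.elim_inr]
  constructor
  · rintro ⟨w, h1, h2⟩
    let z : Γ → M := fun γ => if h : ∃ s, j s = γ then x h.choose
      else if h : γ ∈ varsR ψ then w ⟨γ, h⟩ else Classical.arbitrary M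
    have hz : z ∘ j = x := by
      funext s
      have h : ∃ s', j s' = j s := ⟨s, rfl⟩
      simp only [z, Function.comp_apply, dif_pos h]
      rw [hj h.choose_spec]
    refine ⟨z, hz, (realize_core ψ ?_).1 h2⟩
    rintro ⟨a | γ, hi⟩
    · rfl
    · simp only [Function.comp_apply, Sum.elim_inr]
      by_cases h : ∃ s, j s = γ
      · obtain ⟨s, rfl⟩ := h
        rw [h1 ⟨(s, ⟨j s, hi⟩), rfl⟩]
        exact (congrFun hz s).symm
      · have hi' : γ ∈ varsR ψ := hi
        simp only [z, dif_neg h, dif_pos hi']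
  · rintro ⟨z, rfl, h⟩
    refine ⟨fun γ => z γ, fun p => congrArg z p.2.symm, (realize_core ψ ?_).2 h⟩
    rintro ⟨a | γ, hi⟩ <;> rfl

/-- For an empty tuple `j`, the formula `exProj j ψ` is the existential closure of `ψ` in the
variables `Γ`. -/
theorem realize_exProj_empty (ψ : L.Formula (A ⊕ Γ)) {M : Type*} [L.Structure M] [Nonempty M]
    {b : A → M} {x : Empty → M} :
    (exProj Empty.elim ψ).Realize (Sum.elim b x) ↔ ∃ z : Γ → M, ψ.Realize (Sum.elim b z) := by
  rw [realize_exProj fun a => a.elim]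
  exact exists_congr fun z => and_iff_right (Subsingleton.elim _ _)

end Formulas

section Compactness

variable {L : FirstOrder.Language.{u, v}}

/-- Compactness for a set of formulas in arbitrarily many variables, by means of an ultraproduct
indexed by its finite subsets. -/
theorem exists_realize_of_finitely {T : L.Theory} {β : Type x} (Γ : Set (L.Formula β))
    (h : ∀ Γ₀ : Finset (L.Formula β), (Γ₀ : Set (L.Formula β)) ⊆ Γ →
      ∃ (M : Theory.ModelType.{u, v, max u v w x} T) (b : β → M), ∀ φ ∈ Γ₀, φ.Realize b) :
    ∃ (M : Theory.ModelType.{u, v, max u v w x} T) (b : β → M), ∀ φ ∈ Γ, φ.Realize b := by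
  classical
  let I := {Γ₀ : Finset (L.Formula β) // (Γ₀ : Set (L.Formula β)) ⊆ Γ}
  have : Nonempty I := ⟨⟨∅, by simp⟩⟩
  have hdir : IsDirectedOrder I := ⟨fun a b => ⟨⟨a.1 ∪ b.1, by
    rw [Finset.coe_union]; exact Set.union_subset a.2 b.2⟩,
    Finset.subset_union_left, Finset.subset_union_right⟩⟩
  choose M b hb using fun i : I => h i.1 i.2
  let U : Ultrafilter I := Ultrafilter.of Filter.atTop
  have hU : ∀ s ∈ (Filter.atTop : Filter I), s ∈ U := fun s hs => Ultrafilter.of_le _ hs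
  let N := (U : Filter I).Product fun i => (M i : Type (max u v w x))
  have hT : N ⊨ T := ⟨fun φ hφ => Ultraproduct.sentence_realize φ |>.2
    (Filter.Eventually.of_forall fun i => Theory.realize_sentence_of_mem T hφ)⟩
  refine ⟨⟨N⟩, fun i => Quotient.mk' (s := (U : Filter I).productSetoid _) fun a => b a i,
    fun φ hφ => ?_⟩
  refine (Ultraproduct.realize_formula_cast φ (u := U) fun i a => b a i).2 ?_
  refine hU _ (Filter.mem_atTop_sets.2 ⟨⟨{φ}, by simpa using hφ⟩, fun i hi => hb i φ ?_⟩)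
  exact hi (Finset.mem_singleton_self φ)

/-- Compactness over a structure `M`: a finitely satisfiable set of formulas with parameters in
`M` is satisfied in an elementary extension. -/
theorem exists_elementary_realize {M : Type (max u v w)} [L.Structure M] [Nonempty M]
    {α : Type (max u v w)} (Γ : Set (L.Formula (M ⊕ α)))
    (h : ∀ Γ₀ : Finset (L.Formula (M ⊕ α)), (Γ₀ : Set (L.Formula (M ⊕ α))) ⊆ Γ →
      ∃ a : α → M, ∀ φ ∈ Γ₀, φ.Realize (Sum.elim id a)) :
    ∃ (N : Type (max u v w)) (_ : L.Structure N) (_ : Nonempty N) (f : M ↪ₑ[L] N) (a : α → N),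
      ∀ φ ∈ Γ, φ.Realize (Sum.elim f a) := by
  classical
  -- the elementary diagram of `M`
  let Δ : Set (L.Formula (M ⊕ α)) :=
    (fun θ : L.Formula M => θ.relabel (Sum.inl : M → M ⊕ α)) '' {θ | θ.Realize id}
  obtain ⟨N, b, hb⟩ := exists_realize_of_finitely.{u, v, w, max u v w} (T := (∅ : L.Theory))
    (Γ ∪ Δ) (by
      intro Γ₀ hΓ₀
      obtain ⟨a, ha⟩ := h (Γ₀.filter (· ∈ Γ)) (by
        intro φ hφ
        exact (Finset.mem_filter.1 hφ).2)
      refine ⟨Theory.ModelType.of ∅ M, Sum.elim id a, fun φ hφ => ?_⟩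
      rcases hΓ₀ hφ with hφ' | ⟨θ, hθ, rfl⟩
      · exact ha φ (Finset.mem_filter.2 ⟨hφ, hφ'⟩)
      · exact Formula.realize_relabel.2 hθ)
  have key : ∀ θ : L.Formula M, θ.Realize (b ∘ Sum.inl) ↔ θ.Realize id := by
    intro θ
    have h1 : ∀ θ : L.Formula M, θ.Realize id → θ.Realize (b ∘ Sum.inl) := fun θ hθ =>
      Formula.realize_relabel.1 (hb _ (Or.inr ⟨θ, hθ, rfl⟩))
    refine ⟨fun h2 => ?_, h1 θ⟩
    by_contra h3
    exact Formula.realize_not.1 (h1 (∼θ) (Formula.realize_not.2 h3)) h2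
  refine ⟨N, inferInstance, inferInstance, ⟨b ∘ Sum.inl, fun n φ x => ?_⟩, b ∘ Sum.inr, ?_⟩
  · have := key (φ.relabel x)
    rw [Formula.realize_relabel, Formula.realize_relabel] at this
    exact this
  · intro φ hφ
    have := hb φ (Or.inl hφ)
    rwa [← Sum.elim_comp_inl_inr b] at this

end Compactness

end NCDer

namespace NCDer

/-! ### Models of the theory of `K` -/

section Models

variable {L : FirstOrder.Language.{u, v}} (ι : FirstOrder.Language.ring →ᴸ L)

section PolyTerm

variable {R σ : Type*} [CommRing R]

theorem lift_C_X_surjective :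
    Function.Surjective (FreeCommRing.lift (Sum.elim MvPolynomial.C MvPolynomial.X) :
      FreeCommRing (R ⊕ σ) →+* MvPolynomial σ R) := by
  intro p
  induction p using MvPolynomial.induction_on with
  | C r => exact ⟨FreeCommRing.of (Sum.inl r), by simp⟩
  | add p q hp hq =>
    obtain ⟨P, rfl⟩ := hp
    obtain ⟨Q, rfl⟩ := hq
    exact ⟨P + Q, map_add _ _ _⟩
  | mul_X p i hp =>
    obtain ⟨P, rfl⟩ := hp
    exact ⟨P * FreeCommRing.of (Sum.inr i), by simp⟩

/-- A polynomial over `R` as a term, with variables for its coefficients. -/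
noncomputable def polyTerm (p : MvPolynomial σ R) : L.Term (R ⊕ σ) :=
  ι.onTerm (Ring.termOfFreeCommRing (lift_C_X_surjective p).choose)

theorem realize_polyTerm (p : MvPolynomial σ R) {M : Type*} [Field M] [Ring.CompatibleRing M]
    [L.Structure M] [ι.IsExpansionOn M] (f : R →+* M) (z : σ → M) :
    (polyTerm ι p).realize (Sum.elim f z) = MvPolynomial.eval₂ f z p := by
  have h := (lift_C_X_surjective p).choose_spec
  rw [polyTerm, LHom.realize_onTerm, Ring.realize_termOfFreeCommRing]
  conv_rhs => rw [← h]
  rw [← MvPolynomial.coe_eval₂Hom, ← RingHom.comp_apply]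
  congr 1
  ext i
  rcases i with i | i <;> simp

/-- The formula `p = 0`. -/
noncomputable def polyZero (p : MvPolynomial σ R) : L.Formula (R ⊕ σ) :=
  Term.equal (polyTerm ι p) (polyTerm ι (0 : MvPolynomial σ R))

theorem realize_polyZero (p : MvPolynomial σ R) {M : Type*} [Field M] [Ring.CompatibleRing M]
    [L.Structure M] [ι.IsExpansionOn M] (f : R →+* M) (z : σ → M) :
    (polyZero ι p).Realize (Sum.elim f z) ↔ MvPolynomial.eval₂ f z p = 0 := by
  rw [polyZero, Formula.realize_equal, realize_polyTerm, realize_polyTerm, MvPolynomial.eval₂_zero]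

end PolyTerm

section EmbRingHom

variable {M N : Type*} [Field M] [Ring.CompatibleRing M] [L.Structure M] [ι.IsExpansionOn M]
  [Field N] [Ring.CompatibleRing N] [L.Structure N] [ι.IsExpansionOn N]

/-- A map preserving all formulas is a ring homomorphism. -/
def ringHomOfFormulas {R : Type*} [CommRing R] (g : R →+* M) (e : R → N)
    (h : ∀ ψ : L.Formula R, ψ.Realize g → ψ.Realize e) : R →+* N :=
  have add : ∀ a b, e (a + b) = e a + e b := fun a b => by
    have h' := h (Term.equal (Term.var (a + b)) ((ι.onFunction Ring.addFunc).apply₂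
      (Term.var a) (Term.var b)))
    rw [Formula.realize_equal, Formula.realize_equal] at h'
    simp only [Term.realize_var, Term.realize_functions_apply₂, LHom.map_onFunction] at h'
    simpa using h' (by simp)
  have mul : ∀ a b, e (a * b) = e a * e b := fun a b => by
    have h' := h (Term.equal (Term.var (a * b)) ((ι.onFunction Ring.mulFunc).apply₂
      (Term.var a) (Term.var b)))
    rw [Formula.realize_equal, Formula.realize_equal] at h'
    simp only [Term.realize_var, Term.realize_functions_apply₂, LHom.map_onFunction] at h'
    simpa using h' (by simp)
  have one : e 1 = 1 := by
    have h' := h (Term.equal (Term.var 1) (Constants.term (ι.onFunction Ring.oneFunc)))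
    rw [Formula.realize_equal, Formula.realize_equal] at h'
    simp only [Term.realize_var, Term.realize_constants, constantMap, LHom.map_onFunction] at h'
    simpa using h' (by simp)
  { toFun := e
    map_one' := one
    map_mul' := mul
    map_zero' := by simpa using add 0 0
    map_add' := add }

/-- An elementary embedding, as a ring homomorphism. -/
def embHom (f : M ↪ₑ[L] N) : M →+* N :=
  ringHomOfFormulas ι (RingHom.id M) f fun ψ h => (f.map_formula ψ id).2 h

@[simp] theorem embHom_apply (f : M ↪ₑ[L] N) (a : M) : embHom ι f a = f a := rfl

end EmbRingHom

variable (K : Type w) [Field K] [Ring.CompatibleRing K] [L.Structure K] [ι.IsExpansionOn K]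

/-- Every model of the theory of `K` is a field for the operations interpreted by means of `ι`. -/
theorem exists_field_of_model (M : Type x) [L.Structure M] [M ⊨ L.completeTheory K] :
    ∃ (_ : Field M) (_ : Ring.CompatibleRing M), ι.IsExpansionOn M := by
  let _ : Language.ring.Structure M := ι.reduct M
  have hι : ι.IsExpansionOn M := ι.isExpansionOn_reduct M
  have hM : M ⊨ FirstOrder.Language.Theory.field := ⟨fun σ hσ => by
    have hK : K ⊨ ι.onSentence σ :=
      (ι.realize_onSentence K σ).2 (Theory.realize_sentence_of_mem Theory.field hσ)
    have := (realize_iff_of_model_completeTheory K M (ι.onSentence σ)).2 hK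
    exact (ι.realize_onSentence M σ).1 this⟩
  exact ⟨Field.fieldOfModelField M, Field.compatibleRingOfModelField M, hι⟩

variable {K}

/-- A formula which defines the element `a` of `dcl(∅)`. -/
noncomputable def dclFormula (a : dclRing ι K) : L.Formula (Fin 1) :=
  (mem_dcl_empty_iff.1 a.2).choose

theorem dclFormula_spec (a : dclRing ι K) : DefinesElem (dclFormula ι a) (a : K) :=
  (mem_dcl_empty_iff.1 a.2).choose_spec

theorem realize_iAlls_sentence {β : Type*} [Finite β] (ψ : L.Formula β) (P : Type x)
    [L.Structure P] : P ⊨ (Formula.iAlls β (ψ.relabel (Sum.inr : β → Empty ⊕ β)) : L.Sentence) ↔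
      ∀ b : β → P, ψ.Realize b := by
  rw [Sentence.Realize, Formula.realize_iAlls]
  refine forall_congr' fun b => ?_
  rw [Formula.realize_relabel]
  rfl

theorem realize_iff_of_complete (K : Type w) [L.Structure K] (M : Type x) [L.Structure M]
    [M ⊨ L.completeTheory K] {β : Type*} [Finite β] (ψ : L.Formula β) :
    (∀ b : β → M, ψ.Realize b) ↔ ∀ b : β → K, ψ.Realize b := by
  rw [← realize_iAlls_sentence ψ M, ← realize_iAlls_sentence ψ K]
  exact realize_iff_of_model_completeTheory K M _

theorem exists_iff_of_complete (K : Type w) [L.Structure K] (M : Type x) [L.Structure M]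
    [M ⊨ L.completeTheory K] {β : Type*} [Finite β] (ψ : L.Formula β) :
    (∃ b : β → M, ψ.Realize b) ↔ ∃ b : β → K, ψ.Realize b := by
  have := realize_iff_of_complete K M (∼ψ)
  simp only [Formula.realize_not] at this
  simpa using not_congr this

/-- The element of a model of the theory of `K` defined by the formula which defines `a` in
`K`. There is exactly one, by `dclMap_unique`. -/
noncomputable def dclMap (M : Type x) [L.Structure M] [Nonempty M] (a : dclRing ι K) : M :=
  Classical.epsilon fun c => (dclFormula ι a).Realize fun _ => c

theorem eq_const_fin_one {P : Type*} (b : Fin 1 → P) : b = fun _ => b 0 := by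
  funext i
  rw [Subsingleton.elim i 0]

theorem dclMap_unique_of_definesElem {M : Type x} [L.Structure M] [Nonempty M]
    [M ⊨ L.completeTheory K] {φ : L.Formula (Fin 1)} {a : dclRing ι K}
    (hφ : DefinesElem φ (a : K)) (c : M) :
    φ.Realize (fun _ => c) ↔ c = dclMap ι M a := by
  have h1 : ∃ c : M, (dclFormula ι a).Realize fun _ => c := by
    obtain ⟨b, hb⟩ := (exists_iff_of_complete K M (dclFormula ι a)).2
      ⟨fun _ => a, (dclFormula_spec ι a a).2 rfl⟩
    exact ⟨b 0, by rwa [← eq_const_fin_one b]⟩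
  have h2 := Classical.epsilon_spec h1
  have h3 : ∀ b : Fin 2 → M, φ.Realize (fun _ => b 0) →
      (dclFormula ι a).Realize (fun _ => b 1) → b 0 = b 1 := by
    have := (realize_iff_of_complete K M (((φ.relabel fun _ => (0 : Fin 2)).imp
      (((dclFormula ι a).relabel fun _ => (1 : Fin 2)).imp
        (Term.equal (Term.var 0) (Term.var 1)))))).2 ?_
    · intro b
      have := this b
      simp only [Formula.realize_imp, Formula.realize_relabel, Formula.realize_equal,
        Term.realize_var] at this
      exact this
    · intro b
      simp only [Formula.realize_imp, Formula.realize_relabel, Formula.realize_equal,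
        Term.realize_var]
      intro h4 h5
      rw [(hφ _).1 h4, (dclFormula_spec ι a _).1 h5]
  have h4 : φ.Realize fun _ => dclMap ι M a := by
    have := (realize_iff_of_complete K M ((dclFormula ι a).imp φ)).2 (fun b => by
      rw [Formula.realize_imp, eq_const_fin_one b, hφ, dclFormula_spec ι a]
      exact id) fun _ => dclMap ι M a
    exact Formula.realize_imp.1 this h2
  exact ⟨fun h => h3 ![c, dclMap ι M a] h h2, fun h => h ▸ h4⟩

theorem dclMap_unique {M : Type x} [L.Structure M] [Nonempty M] [M ⊨ L.completeTheory K]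
    (a : dclRing ι K) (c : M) :
    (dclFormula ι a).Realize (fun _ => c) ↔ c = dclMap ι M a :=
  dclMap_unique_of_definesElem ι (dclFormula_spec ι a) c

theorem dclMap_self (a : dclRing ι K) : dclMap ι K a = a :=
  ((dclMap_unique ι a (a : K)).1 ((dclFormula_spec ι a _).2 rfl)).symm

section ElimF

variable {α : Type*}

/-- The formula without parameters equivalent to `ψ`: each parameter from `dcl(∅)` is replaced by
a quantified variable, subject to the formula which defines it. -/
noncomputable def elimF (ψ : L.Formula (dclRing ι K ⊕ α)) : L.Formula α :=
  (exProj Empty.elim (ψ.relabel Sum.swap ⊓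
    Formula.iInf fun a : varsR (ψ.relabel Sum.swap) =>
      (dclFormula ι a.1).relabel fun _ => Sum.inr a.1)).relabel (Sum.elim id Empty.elim)

theorem realize_elimF (ψ : L.Formula (dclRing ι K ⊕ α)) {M : Type x} [L.Structure M] [Nonempty M]
    [M ⊨ L.completeTheory K] {b : α → M} :
    (elimF ι ψ).Realize b ↔ ψ.Realize (Sum.elim (dclMap ι M) b) := by
  have h0 : b ∘ Sum.elim id Empty.elim = Sum.elim b (Empty.elim : Empty → M) := by
    funext i; rcases i with i | i
    · rfl
    · exact i.elim
  rw [elimF, Formula.realize_relabel, h0, realize_exProj_empty]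
  have key : (ψ.relabel Sum.swap).Realize (Sum.elim b (dclMap ι M)) ↔
      ψ.Realize (Sum.elim (dclMap ι M) b) := by
    rw [Formula.realize_relabel]
    congr!
    funext i; rcases i with i | i <;> rfl
  rw [← key]
  simp only [Formula.realize_inf, Formula.realize_iInf]
  constructor
  · rintro ⟨z, h1, h2⟩
    refine (realize_congr ?_).1 h1
    rintro (i | i) hi
    · rfl
    · have := h2 ⟨i, hi⟩
      rw [Formula.realize_relabel] at this
      exact (dclMap_unique ι i _).1 this
  · intro h
    exact ⟨dclMap ι M, h, fun a => Formula.realize_relabel.2 ((dclMap_unique ι a.1 _).2 rfl)⟩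

theorem forall_realize_dclMap [Finite α] (ψ : L.Formula (dclRing ι K ⊕ α)) (M : Type x)
    [L.Structure M] [Nonempty M] [M ⊨ L.completeTheory K]
    (h : ∀ b : α → K, ψ.Realize (Sum.elim (fun a : dclRing ι K => (a : K)) b)) (b : α → M) :
    ψ.Realize (Sum.elim (dclMap ι M) b) := by
  rw [← realize_elimF]
  refine (realize_iff_of_complete K M _).2 (fun b => ?_) b
  rw [realize_elimF]
  have : (dclMap ι K : dclRing ι K → K) = fun a : dclRing ι K => (a : K) := funext (dclMap_self ι)
  rw [this]
  exact h b

end ElimF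

theorem map_dclMap {M : Type x} {N : Type y} [L.Structure M] [Nonempty M] [M ⊨ L.completeTheory K]
    [L.Structure N] [Nonempty N] [N ⊨ L.completeTheory K]
    (f : M ↪ₑ[L] N) (a : dclRing ι K) : f (dclMap ι M a) = dclMap ι N a := by
  rw [← dclMap_unique]
  exact (f.map_formula (dclFormula ι a) fun _ => dclMap ι M a).2 ((dclMap_unique ι a _).2 rfl)

section DclHom

variable (M : Type x) [Field M] [Ring.CompatibleRing M] [L.Structure M] [ι.IsExpansionOn M]
  [M ⊨ L.completeTheory K]

/-- The embedding of `dcl(∅) ⊆ K` into a model of the theory of `K`. -/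
noncomputable def dclHom : dclRing ι K →+* M :=
  ringHomOfFormulas ι (dclRing ι K).subtype (dclMap ι M) fun ψ h => by
    have := forall_realize_dclMap ι (α := Empty) (ψ.relabel Sum.inl) M
      (fun b => by rw [Formula.realize_relabel]; exact h) Empty.elim
    rwa [Formula.realize_relabel] at this

theorem coe_dclHom : ⇑(dclHom ι (K := K) M) = dclMap ι M := rfl

theorem dclHom_self : dclHom ι (K := K) K = (dclRing ι K).subtype :=
  RingHom.ext fun a => dclMap_self ι a

variable {M}

theorem dclHom_injective : Function.Injective (dclHom ι (K := K) M) := by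
  intro a b h
  have h1 := (dclMap_unique ι a (dclMap ι M a)).2 rfl
  have h2 := (dclMap_unique ι b (dclMap ι M b)).2 rfl
  rw [← coe_dclHom, ← h, coe_dclHom] at h2
  obtain ⟨c, hc⟩ := (exists_iff_of_complete K M ((dclFormula ι a) ⊓ (dclFormula ι b))).1
    ⟨fun _ => dclMap ι M a, Formula.realize_inf.2 ⟨h1, h2⟩⟩
  rw [Formula.realize_inf, eq_const_fin_one c, dclFormula_spec ι a, dclFormula_spec ι b] at hc
  exact Subtype.ext (hc.1.symm.trans hc.2)

theorem charZero_of_model (K : Type w) [Field K] [CharZero K] [Ring.CompatibleRing K]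
    [L.Structure K] [ι.IsExpansionOn K] (M : Type x) [Field M] [Ring.CompatibleRing M]
    [L.Structure M] [ι.IsExpansionOn M] [M ⊨ L.completeTheory K] : CharZero M :=
  have : CharZero (dclRing ι K) :=
    ⟨fun a b h => Nat.cast_injective (R := K) (by simpa using congrArg Subtype.val h)⟩
  charZero_of_injective_ringHom (dclHom_injective ι (K := K) (M := M))

end DclHom

end Models

end NCDer

namespace NCDer

/-! ### Zariski density and algebraic boundedness in several variables -/

section Density

/-- A subset of `M ^ σ` is Zariski dense if no nonzero polynomial vanishes on it. -/
def IsZariskiDense {M : Type*} [Field M] {σ : Type*} (X : Set (σ → M)) : Prop :=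
  ∀ p : MvPolynomial σ M, (∀ z ∈ X, MvPolynomial.eval z p = 0) → p = 0

variable {R M α σ : Type*} [CommRing R] [Field M]

/-- The polynomial `p(b, z)` in the variables `z`. -/
noncomputable def specialize {M : Type*} [CommRing M] (e : R →+* M) (b : α → M) :
    MvPolynomial (α ⊕ σ) R →+* MvPolynomial σ M :=
  MvPolynomial.eval₂Hom (MvPolynomial.C.comp e) (Sum.elim (MvPolynomial.C ∘ b) MvPolynomial.X)

theorem eval_specialize (e : R →+* M) (b : α → M) (z : σ → M) (p : MvPolynomial (α ⊕ σ) R) :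
    MvPolynomial.eval z (specialize e b p) = MvPolynomial.eval₂ e (Sum.elim b z) p := by
  rw [← MvPolynomial.coe_eval₂Hom, ← RingHom.comp_apply]
  congr 1
  refine MvPolynomial.ringHom_ext (fun r => ?_) fun i => ?_
  · simp [specialize]
  · rcases i with i | i <;> simp [specialize]

/-- The polynomial `p(b, z)` in `z` is nonzero and vanishes on `X`. -/
def Bounds (e : R →+* M) (b : α → M) (X : Set (σ → M)) (p : MvPolynomial (α ⊕ σ) R) : Prop :=
  (∃ z : σ → M, MvPolynomial.eval₂ e (Sum.elim b z) p ≠ 0) ∧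
    ∀ z ∈ X, MvPolynomial.eval₂ e (Sum.elim b z) p = 0

theorem specialize_ne_zero_iff [Infinite M] (e : R →+* M) (b : α → M)
    (p : MvPolynomial (α ⊕ σ) R) : specialize e b p ≠ 0 ↔
      ∃ z : σ → M, MvPolynomial.eval₂ e (Sum.elim b z) p ≠ 0 := by
  rw [← not_iff_not, not_not, not_exists]
  simp only [not_not, ← eval_specialize]
  exact ⟨fun h z => by rw [h, map_zero], fun h => MvPolynomial.funext fun z => by
    rw [h, map_zero]⟩

theorem Bounds.not_isZariskiDense {e : R →+* M} {b : α → M} {X : Set (σ → M)}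
    {p : MvPolynomial (α ⊕ σ) R} (h : Bounds e b X p) : ¬ IsZariskiDense X := fun hX => by
  obtain ⟨⟨z, hz⟩, h2⟩ := h
  have := hX (specialize e b p) fun z hz => by rw [eval_specialize, h2 z hz]
  rw [← eval_specialize, this, map_zero] at hz
  exact hz rfl

theorem IsZariskiDense.mono {X Y : Set (σ → M)} (hX : IsZariskiDense X) (h : X ⊆ Y) :
    IsZariskiDense Y := fun p hp => hX p fun z hz => hp z (h hz)

theorem IsZariskiDense.nonempty {X : Set (σ → M)} (hX : IsZariskiDense X) : X.Nonempty := by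
  by_contra h
  rw [Set.not_nonempty_iff_eq_empty] at h
  exact one_ne_zero (hX 1 (by simp [h]))

theorem isZariskiDense_of_isEmpty [IsEmpty σ] {X : Set (σ → M)} (hX : X.Nonempty) :
    IsZariskiDense X := by
  obtain ⟨z, hz⟩ := hX
  intro p hp
  have h := hp z hz
  rw [MvPolynomial.eq_C_of_isEmpty p] at h ⊢
  simpa using h

theorem isZariskiDense_comp_equiv {τ : Type*} (ε : τ ≃ σ) {X : Set (σ → M)}
    (hX : IsZariskiDense {z : τ → M | z ∘ ε.symm ∈ X}) : IsZariskiDense X := by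
  intro p hp
  have := hX (MvPolynomial.rename ε.symm p) fun z hz => by
    rw [MvPolynomial.eval_rename]
    exact hp _ hz
  exact (map_eq_zero_iff _ (MvPolynomial.rename_injective _ ε.symm.injective)).1 this

/-- A set with infinitely many Zariski dense fibres over the first coordinate is Zariski dense. -/
theorem isZariskiDense_of_infinite_fibres {n : ℕ} {X : Set (Fin (n + 1) → M)}
    (h : {t : M | IsZariskiDense {z : Fin n → M | Fin.cons t z ∈ X}}.Infinite) :
    IsZariskiDense X := by
  intro p hp
  by_contra hne
  have hne' : MvPolynomial.finSuccEquiv M n p ≠ 0 := by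
    simpa using hne
  refine h (((Polynomial.finite_setOfPred_isRoot hne').preimage
    (MvPolynomial.C_injective (Fin n) M).injOn).subset fun t ht => ?_)
  refine ht _ fun z hz => ?_
  have := hp _ hz
  rw [MvPolynomial.eval_eq_eval_mv_eval'] at this
  rw [← this, Polynomial.eval_map, ← Polynomial.eval₂_id, Polynomial.hom_eval₂]
  simp

end Density

section AlgebraicallyBounded

variable {L : FirstOrder.Language.{u, v}} (ι : FirstOrder.Language.ring →ᴸ L)
  {K : Type w} [Field K] [Ring.CompatibleRing K] [L.Structure K] [ι.IsExpansionOn K]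

section Formulas

variable {α σ : Type*} [Finite σ]

/-- The formula expressing `Bounds`. -/
noncomputable def boundsFormula (φ : L.Formula (α ⊕ σ))
    (p : MvPolynomial (α ⊕ σ) (dclRing ι K)) : L.Formula (dclRing ι K ⊕ α) :=
  Formula.iExs σ (∼((polyZero ι p).relabel (Equiv.sumAssoc (dclRing ι K) α σ).symm)) ⊓
    Formula.iAlls σ ((φ.relabel (Sum.map Sum.inr id)).imp
      ((polyZero ι p).relabel (Equiv.sumAssoc (dclRing ι K) α σ).symm))

variable {M : Type x} [Field M] [Ring.CompatibleRing M] [L.Structure M] [ι.IsExpansionOn M]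
  [M ⊨ L.completeTheory K]

theorem realize_boundsFormula (φ : L.Formula (α ⊕ σ))
    (p : MvPolynomial (α ⊕ σ) (dclRing ι K)) (b : α → M) :
    (boundsFormula ι φ p).Realize (Sum.elim (dclMap ι M) b) ↔
      Bounds (dclHom ι M) b {z | φ.Realize (Sum.elim b z)} p := by
  have h1 : ∀ z : σ → M, Sum.elim (Sum.elim (dclMap ι M) b) z ∘
      (Equiv.sumAssoc (dclRing ι K) α σ).symm =
        Sum.elim (dclHom ι M : dclRing ι K → M) (Sum.elim b z) := by
    intro z
    funext i
    rcases i with i | i | i <;> rfl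
  have h2 : ∀ z : σ → M, Sum.elim (Sum.elim (dclMap ι M : dclRing ι K → M) b) z ∘ Sum.map Sum.inr id =
      Sum.elim b z := by
    intro z
    funext i
    rcases i with i | i <;> rfl
  simp only [boundsFormula, Formula.realize_inf, Formula.realize_iExs, Formula.realize_iAlls,
    Formula.realize_not, Formula.realize_imp, Formula.realize_relabel, h1, h2, realize_polyZero]
  rfl

/-- The formula saying that none of the polynomials in `P` bounds the set defined by `φ`. -/
noncomputable def unboundedFormula (φ : L.Formula (α ⊕ σ))
    (P : Finset (MvPolynomial (α ⊕ σ) (dclRing ι K))) : L.Formula α :=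
  elimF ι (Formula.iInf fun p : P => ∼(boundsFormula ι φ p.1))

theorem realize_unboundedFormula (φ : L.Formula (α ⊕ σ))
    (P : Finset (MvPolynomial (α ⊕ σ) (dclRing ι K))) (b : α → M) :
    (unboundedFormula ι φ P).Realize b ↔
      ¬ ∃ p ∈ P, Bounds (dclHom ι M) b {z | φ.Realize (Sum.elim b z)} p := by
  simp only [unboundedFormula, realize_elimF, Formula.realize_iInf, Formula.realize_not,
    realize_boundsFormula]
  simp

end Formulas

/-- Algebraic boundedness in one variable, for polynomials in the parameters and the variable. -/
theorem exists_bounds_of_finite (hK : AlgebraicallyBoundedOver L (dclRing ι K)) [Infinite K]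
    {α : Type} [Finite α] (φ : L.Formula (α ⊕ Fin 1)) :
    ∃ P : Finset (MvPolynomial (α ⊕ Fin 1) (dclRing ι K)), ∀ b : α → K,
      {t : K | φ.Realize (Sum.elim b fun _ => t)}.Finite →
        ∃ p ∈ P, Bounds (dclHom ι K) b {z | φ.Realize (Sum.elim b z)} p := by
  classical
  obtain ⟨m, ⟨ε⟩⟩ := Finite.exists_equiv_fin α
  obtain ⟨P, hP⟩ := hK m (φ.relabel (Sum.map ε id))
  let g : Polynomial (MvPolynomial (Fin m) (dclRing ι K)) →
      MvPolynomial (α ⊕ Fin 1) (dclRing ι K) := fun p =>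
    p.eval₂ (MvPolynomial.rename (Sum.inl ∘ ε.symm)).toRingHom (MvPolynomial.X (Sum.inr 0))
  have hg : ∀ (p) (b : α → K) (t : K), MvPolynomial.eval₂ (dclHom ι K)
      (Sum.elim b fun _ => t) (g p) = (p.map (MvPolynomial.eval₂Hom (dclRing ι K).subtype
        (b ∘ ε.symm))).eval t := by
    intro p b t
    rw [Polynomial.eval_map, ← MvPolynomial.coe_eval₂Hom, Polynomial.hom_eval₂]
    congr 1
    · refine MvPolynomial.ringHom_ext (fun r => ?_) fun i => ?_
      · simp [dclHom_self]
      · simp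
    · simp
  have hφ : ∀ (b : α → K) (t : K), (φ.relabel (Sum.map ε id)).Realize
      (Sum.elim (b ∘ ε.symm) fun _ => t) ↔ φ.Realize (Sum.elim b fun _ => t) := by
    intro b t
    rw [Formula.realize_relabel]
    congr!
    funext i
    rcases i with i | i <;> simp
  refine ⟨P.image g, fun b hb => ?_⟩
  obtain ⟨p, hp, hne, hvan⟩ := hP (b ∘ ε.symm) (by simpa only [hφ] using hb)
  refine ⟨g p, Finset.mem_image_of_mem g hp, ?_, fun z hz => ?_⟩
  · by_contra hcon
    push Not at hcon
    exact hne (Polynomial.funext fun t => by rw [← hg, hcon, Polynomial.eval_zero])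
  · rw [eq_const_fin_one z] at hz ⊢
    rw [hg]
    exact hvan _ ((hφ _ _).2 hz)

/-- Algebraic boundedness in several variables: uniformly in the parameters, a definable set
which is not Zariski dense lies in the zero set of one of finitely many polynomials over `F`.
By induction on the number of variables: if only finitely many fibres over the first coordinate
are dense, a product of one polynomial for the exceptional fibres and of the polynomials which
bound the other fibres works. -/
theorem exists_bounds_fin (hK : AlgebraicallyBoundedOver L (dclRing ι K)) [Infinite K] (n : ℕ) :
    ∀ {α : Type} [Finite α] (φ : L.Formula (α ⊕ Fin n)),
    ∃ P : Finset (MvPolynomial (α ⊕ Fin n) (dclRing ι K)), ∀ b : α → K,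
      IsZariskiDense {z | φ.Realize (Sum.elim b z)} ∨
        ∃ p ∈ P, Bounds (dclHom ι K) b {z | φ.Realize (Sum.elim b z)} p := by
  classical
  induction n with
  | zero =>
    intro α _ φ
    refine ⟨{1}, fun b => ?_⟩
    by_cases h : {z : Fin 0 → K | φ.Realize (Sum.elim b z)}.Nonempty
    · exact Or.inl (isZariskiDense_of_isEmpty h)
    · rw [Set.not_nonempty_iff_eq_empty] at h
      refine Or.inr ⟨1, by simp, ⟨Fin.elim0, by simp⟩, fun z hz => ?_⟩
      rw [h] at hz
      exact hz.elim
  | succ n ih =>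
    intro α _ φ
    let split : α ⊕ Fin (n + 1) → (α ⊕ Fin 1) ⊕ Fin n :=
      Sum.elim (fun a => Sum.inl (Sum.inl a)) (Fin.cons (Sum.inl (Sum.inr 0)) Sum.inr)
    let join : (α ⊕ Fin 1) ⊕ Fin n → α ⊕ Fin (n + 1) :=
      Sum.elim (Sum.elim Sum.inl fun _ => Sum.inr 0) fun i => Sum.inr i.succ
    have hsplit : ∀ (b : α → K) (t : K) (z : Fin n → K),
        Sum.elim (Sum.elim b fun _ => t) z ∘ split = Sum.elim b (Fin.cons t z) := by
      intro b t z
      funext i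
      rcases i with i | i
      · rfl
      · refine Fin.cases ?_ (fun i => ?_) i <;> simp [split]
    have hjoin : ∀ (b : α → K) (t : K) (z : Fin n → K),
        Sum.elim b (Fin.cons t z : Fin (n + 1) → K) ∘ join =
          Sum.elim (Sum.elim b fun _ => t) z := by
      intro b t z
      funext i
      rcases i with (i | i) | i <;> simp [join]
    obtain ⟨P, hP⟩ := ih (φ.relabel split)
    have hφ : ∀ (b : α → K) (t : K) (z : Fin n → K), (φ.relabel split).Realize
        (Sum.elim (Sum.elim b fun _ => t) z) ↔ φ.Realize (Sum.elim b (Fin.cons t z)) := by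
      intro b t z
      rw [Formula.realize_relabel, hsplit]
    have hlam : ∀ (b : α → K) (t : K), (unboundedFormula ι (φ.relabel split) P).Realize
        (Sum.elim b fun _ => t) ↔
          IsZariskiDense {z : Fin n → K | φ.Realize (Sum.elim b (Fin.cons t z))} := by
      intro b t
      rw [realize_unboundedFormula]
      simp only [← hφ]
      rcases hP (Sum.elim b fun _ => t) with h | h
      · refine iff_of_true ?_ h
        rintro ⟨p, -, hp⟩
        exact hp.not_isZariskiDense h
      · obtain ⟨p, hp, hb⟩ := h
        exact iff_of_false (not_not.2 ⟨p, hp, hb⟩) hb.not_isZariskiDense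
    obtain ⟨Q, hQ⟩ := exists_bounds_of_finite ι hK (unboundedFormula ι (φ.relabel split) P)
    let fst : α ⊕ Fin 1 → α ⊕ Fin (n + 1) := Sum.map id fun _ => 0
    refine ⟨(Q ×ˢ P.powerset).image fun q => MvPolynomial.rename fst q.1 *
      ∏ p ∈ q.2, MvPolynomial.rename join p, fun b => ?_⟩
    by_cases hinf : {t : K | IsZariskiDense
        {z : Fin n → K | φ.Realize (Sum.elim b (Fin.cons t z))}}.Infinite
    · exact Or.inl (isZariskiDense_of_infinite_fibres hinf)
    right
    rw [Set.not_infinite] at hinf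
    obtain ⟨q, hq, hqne, hqv⟩ := hQ b (by simpa only [hlam] using hinf)
    -- only the polynomials which do not vanish identically at `b` enter the product
    let S := P.filter fun p => specialize (dclHom ι K) b (MvPolynomial.rename join p) ≠ 0
    refine ⟨_, Finset.mem_image.2 ⟨(q, S), Finset.mem_product.2
      ⟨hq, Finset.mem_powerset.2 (Finset.filter_subset _ _)⟩, rfl⟩, ?_, fun z hz => ?_⟩
    · rw [← specialize_ne_zero_iff, map_mul, map_prod]
      refine mul_ne_zero ?_ (Finset.prod_ne_zero_iff.2 fun p hp => (Finset.mem_filter.1 hp).2)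
      obtain ⟨t, ht⟩ := hqne
      rw [specialize_ne_zero_iff]
      refine ⟨fun _ => t 0, ?_⟩
      rw [MvPolynomial.eval₂_rename]
      convert ht using 2
      funext i
      rcases i with i | i
      · rfl
      · simp [fst, Subsingleton.elim i 0]
    · dsimp only
      rw [MvPolynomial.eval₂_mul]
      obtain ⟨t, z', rfl⟩ : ∃ (t : K) (z' : Fin n → K), z = Fin.cons t z' :=
        ⟨z 0, Fin.tail z, (Fin.cons_self_tail z).symm⟩
      by_cases ht : IsZariskiDense {z : Fin n → K | φ.Realize (Sum.elim b (Fin.cons t z))}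
      · convert zero_mul _
        rw [MvPolynomial.eval₂_rename]
        convert hqv (fun _ => t) ((hlam b t).2 ht) using 2
        funext i
        rcases i with i | i <;> simp [fst]
      · convert mul_zero _
        rcases hP (Sum.elim b fun _ => t) with h | ⟨p, hp, ⟨z0, hz0⟩, hpv⟩
        · simp only [hφ] at h
          exact (ht h).elim
        · rw [← MvPolynomial.coe_eval₂Hom, map_prod]
          refine Finset.prod_eq_zero (i := p) (Finset.mem_filter.2 ⟨hp, ?_⟩) ?_
          · rw [specialize_ne_zero_iff]
            refine ⟨Fin.cons t z0, ?_⟩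
            rwa [MvPolynomial.eval₂_rename, hjoin]
          · rw [MvPolynomial.coe_eval₂Hom, MvPolynomial.eval₂_rename, hjoin]
            exact hpv _ ((hφ _ _ _).2 hz)

end AlgebraicallyBounded

end NCDer

namespace NCDer

section Transfer

variable {L : FirstOrder.Language.{u, v}} (ι : FirstOrder.Language.ring →ᴸ L)
  {K : Type w} [Field K] [Ring.CompatibleRing K] [L.Structure K] [ι.IsExpansionOn K]

/-- The polynomial in the variables `σ` with exponents in `S` whose coefficients are variables. -/
noncomputable def genericPoly (R : Type*) [CommRing R] {σ : Type*} (S : Finset (σ →₀ ℕ)) :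
    MvPolynomial (S ⊕ σ) R :=
  ∑ s : S, MvPolynomial.X (Sum.inl s) *
    MvPolynomial.rename Sum.inr (MvPolynomial.monomial s.1 (1 : R))

theorem eval₂_genericPoly {R M σ : Type*} [CommRing R] [Field M] (e : R →+* M)
    (g : MvPolynomial σ M) (z : σ → M) :
    MvPolynomial.eval₂ e (Sum.elim (fun s : g.support => g.coeff s) z)
      (genericPoly R g.support) = MvPolynomial.eval z g := by
  rw [genericPoly, MvPolynomial.eval₂_sum]
  conv_rhs => rw [MvPolynomial.eval_eq]
  rw [← Finset.sum_coe_sort g.support]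
  refine Finset.sum_congr rfl fun s _ => ?_
  rw [MvPolynomial.eval₂_mul, MvPolynomial.eval₂_X, Sum.elim_inl, MvPolynomial.eval₂_rename,
    MvPolynomial.eval₂_monomial, map_one, one_mul]
  rfl

section

variable {α σ : Type*} [Finite σ]

/-- The formula in the variables `(b, c)` saying that, if no polynomial in `P` bounds the set
defined by `φ(b, z)`, then the polynomial with coefficients `c` and exponents in `S` vanishes
identically whenever it vanishes on this set. -/
noncomputable def transferFormula (φ : L.Formula (α ⊕ σ))
    (P : Finset (MvPolynomial (α ⊕ σ) (dclRing ι K))) (S : Finset (σ →₀ ℕ)) :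
    L.Formula (dclRing ι K ⊕ (α ⊕ S)) :=
  let χ : L.Formula ((dclRing ι K ⊕ (α ⊕ S)) ⊕ σ) :=
    (polyZero ι (genericPoly (dclRing ι K) S)).relabel (Sum.elim (fun a => Sum.inl (Sum.inl a))
      (Sum.elim (fun s => Sum.inl (Sum.inr (Sum.inr s))) Sum.inr))
  ((unboundedFormula ι φ P).relabel (fun a => Sum.inr (Sum.inl a))).imp
    ((Formula.iAlls σ ((φ.relabel (Sum.map (fun a => Sum.inr (Sum.inl a)) id)).imp χ)).imp
      (Formula.iAlls σ χ))

theorem realize_transferFormula (φ : L.Formula (α ⊕ σ))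
    (P : Finset (MvPolynomial (α ⊕ σ) (dclRing ι K))) (S : Finset (σ →₀ ℕ))
    (M : Type x) [Field M] [Ring.CompatibleRing M] [L.Structure M] [ι.IsExpansionOn M]
    [M ⊨ L.completeTheory K] (b : α → M) (c : S → M) :
    (transferFormula ι φ P S).Realize
      (Sum.elim (dclMap ι M : dclRing ι K → M) (Sum.elim b c)) ↔
      ((¬ ∃ p ∈ P, Bounds (dclHom ι M) b {z | φ.Realize (Sum.elim b z)} p) →
      (∀ z : σ → M, φ.Realize (Sum.elim b z) →
        MvPolynomial.eval₂ (dclHom ι M) (Sum.elim c z) (genericPoly (dclRing ι K) S) = 0) →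
      ∀ z : σ → M,
        MvPolynomial.eval₂ (dclHom ι M) (Sum.elim c z) (genericPoly (dclRing ι K) S) = 0) := by
  have h1 : ∀ z : σ → M, Sum.elim (Sum.elim (dclMap ι M : dclRing ι K → M) (Sum.elim b c)) z ∘
      (Sum.elim (fun a => Sum.inl (Sum.inl a))
      (Sum.elim (fun s => Sum.inl (Sum.inr (Sum.inr s))) Sum.inr)) =
        Sum.elim (dclHom ι M : dclRing ι K → M) (Sum.elim c z) := by
    intro z
    funext i
    rcases i with i | i | i <;> rfl
  have h2 : ∀ z : σ → M, Sum.elim (Sum.elim (dclMap ι M : dclRing ι K → M)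
      (Sum.elim b c)) z ∘ Sum.map (fun a => Sum.inr (Sum.inl a)) id = Sum.elim b z := by
    intro z
    funext i
    rcases i with i | i <;> rfl
  have h3 : Sum.elim (dclMap ι M : dclRing ι K → M) (Sum.elim b c) ∘
      (fun a => Sum.inr (Sum.inl a)) = b := rfl
  simp only [transferFormula, Formula.realize_imp, Formula.realize_iAlls,
    Formula.realize_relabel, h1, h2, h3, realize_unboundedFormula, realize_polyZero]

end

/-- A family of polynomials which bounds the non-dense members of a definable family in `K`
does so in every model of the theory of `K`. For polynomials with exponents in a fixed finite set,
this is a statement about `K` in the language `L`. -/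
theorem bounds_transfer [CharZero K] {α σ : Type*} [Finite α] [Finite σ] {φ : L.Formula (α ⊕ σ)}
    {P : Finset (MvPolynomial (α ⊕ σ) (dclRing ι K))}
    (hP : ∀ b : α → K, IsZariskiDense {z | φ.Realize (Sum.elim b z)} ∨
      ∃ p ∈ P, Bounds (dclHom ι K) b {z | φ.Realize (Sum.elim b z)} p)
    (M : Type x) [Field M] [Ring.CompatibleRing M] [L.Structure M] [ι.IsExpansionOn M]
    [M ⊨ L.completeTheory K] (b : α → M) :
    IsZariskiDense {z | φ.Realize (Sum.elim b z)} ∨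
      ∃ p ∈ P, Bounds (dclHom ι M) b {z | φ.Realize (Sum.elim b z)} p := by
  classical
  have : CharZero M := charZero_of_model ι K M
  have : Infinite M := CharZero.infinite M
  by_cases hb : ∃ p ∈ P, Bounds (dclHom ι M) b {z | φ.Realize (Sum.elim b z)} p
  · exact Or.inr hb
  refine Or.inl fun g hg => ?_
  have hK : ∀ b : α ⊕ g.support → K, (transferFormula ι φ P g.support).Realize
      (Sum.elim (fun a : dclRing ι K => (a : K)) b) := by
    intro b
    have h0 : (fun a : dclRing ι K => (a : K)) = dclMap ι K :=
      funext fun a => (dclMap_self ι a).symm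
    rw [← Sum.elim_comp_inl_inr b, h0, realize_transferFormula]
    intro h1 h2 z
    have h3 := (hP (b ∘ Sum.inl)).resolve_right h1 (specialize (dclHom ι K) (b ∘ Sum.inr)
      (genericPoly (dclRing ι K) g.support)) fun z hz => by
        rw [eval_specialize]
        exact h2 z hz
    rw [← eval_specialize, h3, map_zero]
  have hM := forall_realize_dclMap ι (transferFormula ι φ P g.support) M hK
    (Sum.elim b fun s => g.coeff s)
  rw [realize_transferFormula] at hM
  simp only [eval₂_genericPoly] at hM
  exact MvPolynomial.funext fun z => by rw [hM hb hg z, map_zero]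

/-- Uniform algebraic boundedness in several variables, in all models of the theory of `K`. -/
theorem exists_bounds [CharZero K] (hK : AlgebraicallyBoundedOver L (dclRing ι K))
    {α σ : Type*} [Finite σ] (φ : L.Formula (α ⊕ σ)) :
    ∃ P : Finset (MvPolynomial (α ⊕ σ) (dclRing ι K)),
      ∀ (M : Type x) [Field M] [Ring.CompatibleRing M] [L.Structure M] [ι.IsExpansionOn M]
        [M ⊨ L.completeTheory K] (b : α → M),
        IsZariskiDense {z | φ.Realize (Sum.elim b z)} ∨
          ∃ p ∈ P, Bounds (dclHom ι M) b {z | φ.Realize (Sum.elim b z)} p := by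
  classical
  have : Infinite K := CharZero.infinite K
  -- only the parameters which occur in `φ` matter
  let S : Set α := {a | Sum.inl a ∈ supp φ}
  have hS : S.Finite := (supp φ).finite_toSet.preimage Sum.inl_injective.injOn
  have : Finite S := hS
  obtain ⟨m, ⟨ε⟩⟩ := Finite.exists_equiv_fin S
  obtain ⟨n, ⟨τ⟩⟩ := Finite.exists_equiv_fin σ
  let φ' : L.Formula (Fin m ⊕ Fin n) := (core φ).relabel fun i => match i with
    | ⟨Sum.inl a, h⟩ => Sum.inl (ε ⟨a, h⟩)
    | ⟨Sum.inr s, _⟩ => Sum.inr (τ s)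
  obtain ⟨P, hP⟩ := exists_bounds_fin ι hK n φ'
  let j : Fin m → α := fun i => (ε.symm i : α)
  refine ⟨P.image (MvPolynomial.rename (Sum.map j τ.symm)), ?_⟩
  intro M _ _ _ _ _ b
  have hφ' : ∀ z : Fin n → M, φ'.Realize (Sum.elim (b ∘ j) z) ↔
      φ.Realize (Sum.elim b (z ∘ τ)) := by
    intro z
    rw [Formula.realize_relabel]
    refine realize_core φ ?_
    rintro ⟨i | i, hi⟩ <;> simp [j]
  rcases bounds_transfer ι hP M (b ∘ j) with h | ⟨p, hp, ⟨z, hz⟩, h2⟩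
  · refine Or.inl (isZariskiDense_comp_equiv τ.symm ?_)
    simp only [hφ'] at h
    exact h
  · have he : ∀ z : σ → M, Sum.elim b z ∘ Sum.map j τ.symm = Sum.elim (b ∘ j) (z ∘ τ.symm) := by
      intro z
      funext i
      rcases i with i | i <;> rfl
    refine Or.inr ⟨_, Finset.mem_image_of_mem _ hp, ⟨z ∘ τ, ?_⟩, fun z hz => ?_⟩
    · rw [MvPolynomial.eval₂_rename, he]
      simpa [Function.comp_assoc] using hz
    · rw [MvPolynomial.eval₂_rename, he]
      refine h2 _ ((hφ' _).2 ?_)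
      simpa [Function.comp_assoc] using hz

/-- Zariski density is definable in families. -/
theorem exists_denseFormula [CharZero K] (hK : AlgebraicallyBoundedOver L (dclRing ι K))
    {α σ : Type*} [Finite σ] (φ : L.Formula (α ⊕ σ)) :
    ∃ lam : L.Formula α,
      ∀ (M : Type x) [Field M] [Ring.CompatibleRing M] [L.Structure M] [ι.IsExpansionOn M]
        [M ⊨ L.completeTheory K] (b : α → M),
        lam.Realize b ↔ IsZariskiDense {z | φ.Realize (Sum.elim b z)} := by
  obtain ⟨P, hP⟩ := exists_bounds.{u, v, w, x} ι hK φ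
  refine ⟨unboundedFormula ι φ P, ?_⟩
  intro M _ _ _ _ _ b
  rw [realize_unboundedFormula]
  refine ⟨(hP M b).resolve_right, ?_⟩
  rintro h ⟨p, -, hp⟩
  exact hp.not_isZariskiDense h

/-- Zariski density is preserved by elementary extensions. -/
theorem isZariskiDense_elementary_iff [CharZero K]
    (hK : AlgebraicallyBoundedOver L (dclRing ι K)) {α σ : Type*} [Finite σ]
    (φ : L.Formula (α ⊕ σ)) {M N : Type x} [Field M] [Ring.CompatibleRing M] [L.Structure M]
    [ι.IsExpansionOn M] [M ⊨ L.completeTheory K] [Field N] [Ring.CompatibleRing N]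
    [L.Structure N] [ι.IsExpansionOn N] [N ⊨ L.completeTheory K] (f : M ↪ₑ[L] N) (b : α → M) :
    IsZariskiDense {z | φ.Realize (Sum.elim (f ∘ b) z)} ↔
      IsZariskiDense {z | φ.Realize (Sum.elim b z)} := by
  obtain ⟨lam, hlam⟩ := exists_denseFormula.{u, v, w, x} ι hK φ
  rw [← hlam, ← hlam, f.map_formula]

end Transfer

end NCDer

namespace NCDer

/-! ### Generic elementary extensions -/

section GenericExtension

variable {L : FirstOrder.Language.{u, v}} (ι : FirstOrder.Language.ring →ᴸ L)
  {K : Type w} [Field K] [Ring.CompatibleRing K] [L.Structure K] [ι.IsExpansionOn K]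

theorem model_of_elementary {M N : Type*} [L.Structure M] [L.Structure N] {T : L.Theory}
    [M ⊨ T] (f : M ↪ₑ[L] N) : N ⊨ T :=
  (f.theory_model_iff T).1 inferInstance

/-- A finitely satisfiable set of formulas over `M` is satisfied in an elementary extension by a
tuple whose coordinates `j` are algebraically independent over `M`, as soon as the finite parts
can be satisfied outside the zero set of any nonzero polynomial in these coordinates. -/
theorem exists_generic_extension {M : Type (max u v w)} [Field M] [Ring.CompatibleRing M]
    [L.Structure M] [ι.IsExpansionOn M] [M ⊨ L.completeTheory K]
    {α τ : Type (max u v w)} (j : τ → α) (Γ : Set (L.Formula (M ⊕ α)))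
    (h : ∀ Γ₀ : Finset (L.Formula (M ⊕ α)), (Γ₀ : Set (L.Formula (M ⊕ α))) ⊆ Γ →
      ∀ p : MvPolynomial τ M, p ≠ 0 →
        ∃ a : α → M, (∀ φ ∈ Γ₀, φ.Realize (Sum.elim id a)) ∧ MvPolynomial.eval (a ∘ j) p ≠ 0) :
    ∃ (N : Type (max u v w)) (_ : Field N) (_ : Ring.CompatibleRing N) (_ : L.Structure N)
      (_ : ι.IsExpansionOn N) (_ : N ⊨ L.completeTheory K) (f : M ↪ₑ[L] N) (a : α → N),
      (∀ φ ∈ Γ, φ.Realize (Sum.elim f a)) ∧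
        ∀ p : MvPolynomial τ M, MvPolynomial.eval₂ (embHom ι f) (a ∘ j) p = 0 → p = 0 := by
  classical
  let ne : MvPolynomial τ M → L.Formula (M ⊕ α) := fun p =>
    ∼((polyZero ι p).relabel (Sum.map id j))
  have hne : ∀ {N : Type (max u v w)} [Field N] [Ring.CompatibleRing N] [L.Structure N]
      [ι.IsExpansionOn N] (e : M →+* N) (a : α → N) (p : MvPolynomial τ M),
      (ne p).Realize (Sum.elim e a) ↔ MvPolynomial.eval₂ e (a ∘ j) p ≠ 0 := by
    intro N _ _ _ _ e a p
    rw [Formula.realize_not, Formula.realize_relabel, Sum.elim_comp_map, Function.comp_id,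
      realize_polyZero]
  obtain ⟨N, _, _, f, a, ha⟩ := exists_elementary_realize.{u, v, w} (M := M)
    (Γ ∪ ne '' {p | p ≠ 0}) (by
      intro Γ₀ hΓ₀
      obtain ⟨Γ₁, hΓ₁, Γ₂, hΓ₂⟩ : ∃ Γ₁ : Finset (L.Formula (M ⊕ α)),
          (Γ₁ : Set (L.Formula (M ⊕ α))) ⊆ Γ ∧ ∃ Γ₂ : Finset (MvPolynomial τ M),
            (∀ p ∈ Γ₂, p ≠ 0) ∧ ∀ φ ∈ Γ₀, φ ∈ Γ₁ ∨ ∃ p ∈ Γ₂, φ = ne p := by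
        have hfin : ∃ s : Finset (MvPolynomial τ M), (s : Set (MvPolynomial τ M)) ⊆ {p | p ≠ 0} ∧
            s.image ne = Γ₀.filter (· ∈ ne '' {p | p ≠ 0}) :=
          (Finset.subset_set_image_iff (f := ne)).1 fun φ hφ => (Finset.mem_filter.1 hφ).2
        obtain ⟨s, hs1, hs2⟩ := hfin
        refine ⟨Γ₀.filter (· ∈ Γ), fun φ hφ => (Finset.mem_filter.1 hφ).2, s,
          fun p hp => hs1 hp, fun φ hφ => ?_⟩
        rcases hΓ₀ hφ with h' | h'
        · exact Or.inl (Finset.mem_filter.2 ⟨hφ, h'⟩)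
        · have : φ ∈ s.image ne := by
            rw [hs2]
            exact Finset.mem_filter.2 ⟨hφ, h'⟩
          obtain ⟨p, hp, rfl⟩ := Finset.mem_image.1 this
          exact Or.inr ⟨p, hp, rfl⟩
      obtain ⟨hp0, hΓ₂⟩ := hΓ₂
      obtain ⟨a, ha1, ha2⟩ := h Γ₁ hΓ₁ (∏ p ∈ Γ₂, p) (Finset.prod_ne_zero_iff.2 hp0)
      refine ⟨a, fun φ hφ => ?_⟩
      rcases hΓ₂ φ hφ with h' | ⟨p, hp, rfl⟩
      · exact ha1 φ h'
      · refine (hne (RingHom.id M) a p).2 ?_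
        rw [map_prod] at ha2
        exact Finset.prod_ne_zero_iff.1 ha2 p hp)
  have hT : N ⊨ L.completeTheory K := model_of_elementary f
  obtain ⟨_, _, _⟩ := exists_field_of_model ι K N
  refine ⟨N, inferInstance, inferInstance, inferInstance, inferInstance, hT, f, a,
    fun φ hφ => ha φ (Or.inl hφ), fun p hp => ?_⟩
  by_contra hp0
  exact (hne (embHom ι f) a p).1 (ha _ (Or.inr ⟨p, hp0, rfl⟩)) hp

end GenericExtension

/-! ### Algebraic closure and large sets -/

theorem not_isZariskiDense_of_finite {M : Type*} [Field M] {X : Set (Fin 1 → M)} (hX : X.Finite) :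
    ¬ IsZariskiDense X := by
  classical
  intro h
  have := h (∏ z ∈ hX.toFinset, (MvPolynomial.X 0 - MvPolynomial.C (z 0))) fun z hz => by
    rw [map_prod]
    exact Finset.prod_eq_zero (hX.mem_toFinset.2 hz) (by simp)
  obtain ⟨z, -, hz⟩ := Finset.prod_eq_zero_iff.1 this
  have h1 := congrArg (MvPolynomial.eval fun _ => z 0 + 1) hz
  simp at h1

section Acl

variable {L : FirstOrder.Language.{u, v}} (ι : FirstOrder.Language.ring →ᴸ L)
  {K : Type w} [Field K] [CharZero K] [Ring.CompatibleRing K] [L.Structure K]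
  [ι.IsExpansionOn K]
  {M : Type x} [Field M] [Ring.CompatibleRing M] [L.Structure M] [ι.IsExpansionOn M]
  [M ⊨ L.completeTheory K]

omit [CharZero K] in
theorem finite_zeros {α : Type*} (b : α → M) (p : MvPolynomial (α ⊕ Fin 1) (dclRing ι K))
    (hp : ∃ z : Fin 1 → M, MvPolynomial.eval₂ (dclHom ι M) (Sum.elim b z) p ≠ 0) :
    {t : M | MvPolynomial.eval₂ (dclHom ι M) (Sum.elim b fun _ => t) p = 0}.Finite := by
  let q : Polynomial M := MvPolynomial.eval₂Hom (Polynomial.C.comp (dclHom ι M))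
    (Sum.elim (Polynomial.C ∘ b) fun _ => Polynomial.X) p
  have hq : ∀ t, q.eval t = MvPolynomial.eval₂ (dclHom ι M) (Sum.elim b fun _ => t) p := by
    intro t
    rw [← Polynomial.coe_evalRingHom, ← MvPolynomial.coe_eval₂Hom, ← RingHom.comp_apply]
    congr 1
    refine MvPolynomial.ringHom_ext (fun r => ?_) fun i => ?_
    · simp
    · rcases i with i | i <;> simp
  have hne : q ≠ 0 := by
    rintro h
    obtain ⟨z, hz⟩ := hp
    rw [eq_const_fin_one z, ← hq, h, Polynomial.eval_zero] at hz
    exact hz rfl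
  refine (Polynomial.finite_setOfPred_isRoot hne).subset fun t ht => ?_
  exact (hq t).trans ht

/-- In an algebraically bounded structure, `acl(C)` is the algebraic closure of the field
generated by `C` over `F`. -/
theorem mem_acl_iff (hK : AlgebraicallyBoundedOver L (dclRing ι K)) (C : Set M) (c : M) :
    c ∈ acl L C ↔ ∃ p : MvPolynomial (C ⊕ Fin 1) (dclRing ι K),
      (∃ z : Fin 1 → M, MvPolynomial.eval₂ (dclHom ι M) (Sum.elim (↑) z) p ≠ 0) ∧
        MvPolynomial.eval₂ (dclHom ι M) (Sum.elim (↑) fun _ => c) p = 0 := by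
  constructor
  · rintro ⟨s, hs, hfin, hc⟩
    obtain ⟨φ, hφ⟩ := Set.definable_iff_exists_formula_sum.1 hs
    have hφ' : ∀ z : Fin 1 → M, φ.Realize (Sum.elim (↑) z) ↔ z 0 ∈ s := fun z =>
      (Set.ext_iff.1 hφ z).symm
    obtain ⟨P, hP⟩ := exists_bounds.{u, v, w, x} ι hK φ
    rcases hP M (fun c : C => (c : M)) with h | ⟨p, -, h1, h2⟩
    · refine (not_isZariskiDense_of_finite ?_ h).elim
      refine (hfin.preimage (f := fun z : Fin 1 → M => z 0) ?_).subset fun z hz => (hφ' z).1 hz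
      intro z _ z' _ hzz'
      exact funext fun i => by rw [Subsingleton.elim i 0]; exact hzz'
    · exact ⟨p, h1, h2 _ ((hφ' _).2 hc)⟩
  · rintro ⟨p, h1, h2⟩
    refine ⟨{t | MvPolynomial.eval₂ (dclHom ι M) (Sum.elim (↑) fun _ => t) p = 0}, ?_,
      finite_zeros ι _ p h1, h2⟩
    refine Set.definable_iff_exists_formula_sum.2 ⟨elimF ι (polyZero ι p), ?_⟩
    ext z
    change _ = _ ↔ (elimF ι (polyZero ι p)).Realize (Sum.elim (fun c : C => (c : M)) z)
    rw [realize_elimF, ← coe_dclHom, realize_polyZero]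
    conv_rhs => rw [eq_const_fin_one z]

theorem isAlgebraic_of_algebraMap_mem {R N : Type*} [CommRing R] [Field N] [Algebra R N]
    (hinj : Function.Injective (algebraMap R N)) (A : Subring N)
    (h : ∀ r, algebraMap R N r ∈ A) {c : N} (hc : IsAlgebraic R c) : IsAlgebraic A c := by
  obtain ⟨p, hp, hpc⟩ := hc
  let g : R →+* A := (algebraMap R N).codRestrict A h
  have hg : Function.Injective g := fun a b hab => hinj (congrArg Subtype.val hab)
  refine ⟨p.map g, (Polynomial.map_ne_zero_iff hg).2 hp, ?_⟩
  rw [Polynomial.aeval_def, Polynomial.eval₂_map]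
  exact hpc

theorem isAlgebraic_of_mem_acl (hK : AlgebraicallyBoundedOver L (dclRing ι K)) {C : Set M}
    (A : Subring M) (hF : ∀ r, dclHom ι (K := K) M r ∈ A) (hC : C ⊆ A) {c : M}
    (hc : c ∈ acl L C) : IsAlgebraic A c := by
  obtain ⟨p, ⟨z, hz⟩, hp⟩ := (mem_acl_iff ι hK C c).1 hc
  let q : Polynomial A := MvPolynomial.eval₂Hom
    (Polynomial.C.comp ((dclHom ι (K := K) M).codRestrict A hF))
    (Sum.elim (fun c => Polynomial.C ⟨c.1, hC c.2⟩) fun _ => Polynomial.X) p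
  have hq : ∀ t : M, Polynomial.aeval t q =
      MvPolynomial.eval₂ (dclHom ι M) (Sum.elim (↑) fun _ => t) p := by
    intro t
    rw [← AlgHom.coe_toRingHom, ← MvPolynomial.coe_eval₂Hom, ← RingHom.comp_apply]
    congr 1
    refine MvPolynomial.ringHom_ext (fun r => ?_) fun i => ?_
    · simp
      rfl
    · rcases i with i | i <;> simp
      rfl
  refine ⟨q, ?_, (hq c).trans hp⟩
  intro h
  rw [eq_const_fin_one z, ← hq, h, map_zero] at hz
  exact hz rfl

theorem mem_acl_of_isAlgebraic (hK : AlgebraicallyBoundedOver L (dclRing ι K)) {C : Set M} {c : M}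
    (hc : IsAlgebraic (Subring.closure (Set.range (dclHom ι (K := K) M) ∪ C)) c) :
    c ∈ acl L C := by
  classical
  have : Infinite M := have := charZero_of_model ι K M; CharZero.infinite M
  obtain ⟨q, hq, hqc⟩ := hc
  have hlift : ∀ r : Subring.closure (Set.range (dclHom ι (K := K) M) ∪ C),
      ∃ P : MvPolynomial C (dclRing ι K),
        MvPolynomial.eval₂Hom (dclHom ι M) (fun c : C => (c : M)) P = r := by
    have : Subring.closure (Set.range (dclHom ι (K := K) M) ∪ C) ≤
        (MvPolynomial.eval₂Hom (dclHom ι (K := K) M) fun c : C => (c : M)).range := by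
      rw [Subring.closure_le]
      rintro _ (⟨r, rfl⟩ | hr)
      · exact ⟨MvPolynomial.C r, by simp⟩
      · exact ⟨MvPolynomial.X ⟨_, hr⟩, by simp⟩
    exact fun r => this r.2
  choose P hP using hlift
  let p : MvPolynomial (C ⊕ Fin 1) (dclRing ι K) := ∑ n ∈ q.support,
    MvPolynomial.rename Sum.inl (P (q.coeff n)) * MvPolynomial.X (Sum.inr 0) ^ n
  have hp : ∀ t : M, MvPolynomial.eval₂ (dclHom ι M) (Sum.elim (↑) fun _ => t) p =
      Polynomial.aeval t q := by
    intro t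
    rw [Polynomial.aeval_eq_sum_range, MvPolynomial.eval₂_sum, ← Polynomial.sum_over_range
      (f := fun n a => a • t ^ n) q (by simp), Polynomial.sum]
    refine Finset.sum_congr rfl fun n _ => ?_
    rw [MvPolynomial.eval₂_mul, MvPolynomial.eval₂_pow, MvPolynomial.eval₂_X,
      MvPolynomial.eval₂_rename]
    have := hP (q.coeff n)
    rw [MvPolynomial.coe_eval₂Hom] at this
    rw [Subring.smul_def, smul_eq_mul, ← this]
    rfl
  refine (mem_acl_iff ι hK C c).2 ⟨p, ?_, (hp c).trans hqc⟩
  by_contra hcon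
  push Not at hcon
  refine hq (Polynomial.map_injective (algebraMap _ M) Subtype.val_injective
    (Polynomial.funext fun t => ?_))
  rw [Polynomial.eval_map, ← Polynomial.aeval_def, ← hp, hcon, Polynomial.map_zero,
    Polynomial.eval_zero]

end Acl

end NCDer

namespace NCDer

section Large

theorem exists_eq_of_iSup_eq {J : Type*} {g : J → ℕ∞} [Nonempty J] {n : ℕ} (h : ⨆ i, g i = n) :
    ∃ i, g i = n := by
  by_contra hcon
  push Not at hcon
  have hlt : ∀ i, g i < n := fun i => lt_of_le_of_ne (h ▸ le_iSup g i) (hcon i)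
  rcases n with - | n
  · exact not_lt_bot (hlt (Classical.arbitrary J))
  · have hle : ∀ i, g i ≤ n := fun i => ENat.lt_natCast_add_one_iff.1 (by simpa using hlt i)
    have := iSup_le hle
    rw [h] at this
    exact absurd this (by exact_mod_cast Nat.not_succ_le_self n)

/-- A finite supremum, other than `⊥`, of elements other than `⊥` is attained. -/
theorem mem_of_sSup_eq {S : Set (WithBot ℕ∞)} (hS : ∀ r ∈ S, ∃ s : ℕ∞, r = s) {n : ℕ}
    (h : sSup S = ((n : ℕ∞) : WithBot ℕ∞)) : ((n : ℕ∞) : WithBot ℕ∞) ∈ S := by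
  by_contra hcon
  have hlt : ∀ s : ℕ∞, (s : WithBot ℕ∞) ∈ S → s < n := by
    intro s hs
    have : (s : WithBot ℕ∞) ≤ ((n : ℕ∞) : WithBot ℕ∞) := h ▸ le_sSup hs
    exact lt_of_le_of_ne (WithBot.coe_le_coe.1 this) fun heq => hcon (heq ▸ hs)
  rcases n with - | n
  · have : S = ∅ := by
      ext r
      refine iff_of_false (fun hr => ?_) id
      obtain ⟨s, rfl⟩ := hS r hr
      exact not_lt_bot (hlt s hr)
    rw [this, sSup_empty] at h
    exact absurd h (by simp)
  · have hle : sSup S ≤ ((n : ℕ∞) : WithBot ℕ∞) := by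
      refine sSup_le fun r hr => ?_
      obtain ⟨s, rfl⟩ := hS r hr
      exact WithBot.coe_le_coe.2 (ENat.lt_natCast_add_one_iff.1 (by simpa using hlt s hr))
    rw [h, WithBot.coe_le_coe] at hle
    exact absurd hle (by exact_mod_cast Nat.not_succ_le_self n)

variable {L : FirstOrder.Language.{u, v}}

theorem rk_le {M : Type x} [L.Structure M] {σ : Type*} [Finite σ] (a : σ → M) (B : Set M) :
    rk L (Set.range a) B ≤ ENat.card σ := by
  refine iSup_le fun S => (Set.encard_le_encard S.2.1).trans ?_
  rw [← Set.image_univ, ← Set.encard_univ]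
  exact Set.encard_image_le _ _

theorem rk_eq_iff {M : Type x} [L.Structure M] {σ : Type*} [Finite σ] (a : σ → M) (B : Set M) :
    rk L (Set.range a) B = ENat.card σ ↔
      Function.Injective a ∧ AclIndep L (Set.range a) B := by
  constructor
  · intro h
    have : Nonempty {S : Set M // S ⊆ Set.range a ∧ AclIndep L S B} :=
      ⟨⟨∅, Set.empty_subset _, fun x hx => hx.elim⟩⟩
    rw [rk, ENat.card_eq_coe_natCard] at h
    obtain ⟨⟨S, hSa, hS⟩, hcard⟩ := exists_eq_of_iSup_eq h
    dsimp only at hcard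
    have hle : (Set.range a).encard ≤ Nat.card σ := by
      rw [← Set.image_univ, ← ENat.card_eq_coe_natCard, ← Set.encard_univ]
      exact Set.encard_image_le _ _
    have hSeq : S = Set.range a :=
      Set.Finite.eq_of_subset_of_encard_le ((Set.finite_range a).subset hSa) hSa (hcard ▸ hle)
    subst hSeq
    refine ⟨?_, hS⟩
    rw [← Set.injOn_univ]
    refine Set.Finite.injOn_of_encard_image_eq Set.finite_univ ?_
    rw [Set.image_univ, hcard, Set.encard_univ, ENat.card_eq_coe_natCard]
  · rintro ⟨hinj, hS⟩
    refine le_antisymm (rk_le a B) ?_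
    rw [← Set.encard_univ, ← hinj.injOn.encard_image, Set.image_univ]
    exact le_iSup (fun S : {S : Set M // S ⊆ Set.range a ∧ AclIndep L S B} => S.1.encard)
      ⟨Set.range a, subset_rfl, hS⟩

/-- A definable set is large if and only if, for some definition of it, it has in an elementary
extension a point with distinct coordinates which are independent over the parameters. -/
theorem isLarge_iff {M : Type w} [L.Structure M] {σ : Type*} [Finite σ] (X : Set (σ → M)) :
    IsLarge L X ↔ ∃ (m : ℕ) (φ : L.Formula (Fin m ⊕ σ)) (b : Fin m → M), X = defSet φ b ∧
      ∃ (N : Type (max u v w)) (_ : L.Structure N) (f : M ↪ₑ[L] N) (a : σ → N),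
        a ∈ defSet φ (f ∘ b) ∧ Function.Injective a ∧
          AclIndep L (Set.range a) (Set.range (f ∘ b)) := by
  constructor
  · intro h
    rw [IsLarge, dim, ENat.card_eq_coe_natCard] at h
    obtain ⟨m, φ, b, hX, N, _, f, a, ha, hr⟩ := mem_of_sSup_eq (by
      rintro r ⟨m, φ, b, hX, N, _, f, a, ha, hr⟩
      exact ⟨_, hr⟩) h
    refine ⟨m, φ, b, hX, N, _, f, a, ha, (rk_eq_iff a _).1 ?_⟩
    rw [ENat.card_eq_coe_natCard]
    exact (WithBot.coe_inj.1 hr).symm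
  · rintro ⟨m, φ, b, hX, N, _, f, a, ha, hr⟩
    refine le_antisymm (sSup_le ?_) (le_sSup ⟨m, φ, b, hX, N, _, f, a, ha, ?_⟩)
    · rintro r ⟨m, φ, b, hX, N, _, f, a, ha, rfl⟩
      exact WithBot.coe_le_coe.2 (rk_le a _)
    · rw [(rk_eq_iff a _).2 hr]

end Large

section LargeDense

variable {L : FirstOrder.Language.{u, v}} (ι : FirstOrder.Language.ring →ᴸ L)
  {K : Type w} [Field K] [CharZero K] [Ring.CompatibleRing K] [L.Structure K]
  [ι.IsExpansionOn K]

/-- A tuple with distinct acl-independent coordinates is algebraically independent. -/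
theorem algebraicIndependent_of_aclIndep (hK : AlgebraicallyBoundedOver L (dclRing ι K))
    {M : Type x} [Field M] [Ring.CompatibleRing M] [L.Structure M] [ι.IsExpansionOn M]
    [M ⊨ L.completeTheory K] {σ : Type*} {a : σ → M} (ha : Function.Injective a) {B : Set M}
    (h : AclIndep L (Set.range a) B) :
    AlgebraicIndependent (Subring.closure (Set.range (dclHom ι (K := K) M) ∪ B)) a := by
  refine algebraicIndependent_of_finite_type' Subtype.val_injective fun t ht _ i hi hcon => ?_
  refine h (a i) ⟨i, rfl⟩ (mem_acl_of_isAlgebraic ι hK (isAlgebraic_of_algebraMap_mem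
    Subtype.val_injective _ (fun r => ?_) hcon))
  obtain ⟨r, hr⟩ := r
  change r ∈ _
  induction hr using Algebra.adjoin_induction with
  | mem x hx =>
    obtain ⟨j, hj, rfl⟩ := hx
    refine Subring.subset_closure (Or.inr (Or.inr ⟨⟨j, rfl⟩, fun hji => hi ?_⟩))
    rwa [← ha hji]
  | algebraMap r =>
    exact Subring.closure_mono (Set.union_subset_union_right _ Set.subset_union_left) r.2
  | add x y _ _ hx hy => exact add_mem hx hy
  | mul x y _ _ hx hy => exact mul_mem hx hy

omit [CharZero K] in
/-- A set which contains a point with coordinates algebraically independent over the parameters is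
not contained in the zero set of a nonzero polynomial over the parameters. -/
theorem not_bounds_of_algebraicIndependent {M : Type x} [Field M] [Ring.CompatibleRing M]
    [L.Structure M] [ι.IsExpansionOn M] [M ⊨ L.completeTheory K] {α σ : Type*} {a : σ → M}
    {b : α → M} {B : Set M} (hB : ∀ i, b i ∈ Subring.closure (Set.range (dclHom ι (K := K) M) ∪ B))
    (ha : AlgebraicIndependent (Subring.closure (Set.range (dclHom ι (K := K) M) ∪ B)) a)
    {X : Set (σ → M)} (haX : a ∈ X) (p : MvPolynomial (α ⊕ σ) (dclRing ι K)) :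
    ¬ Bounds (dclHom ι M) b X p := by
  rintro ⟨⟨z, hz⟩, hp⟩
  let A := Subring.closure (Set.range (dclHom ι (K := K) M) ∪ B)
  let e : dclRing ι K →+* A := (dclHom ι (K := K) M).codRestrict A
    fun r => Subring.subset_closure (Or.inl ⟨r, rfl⟩)
  let q : MvPolynomial σ A := specialize e (fun i => ⟨b i, hB i⟩) p
  have hq : ∀ z : σ → M, MvPolynomial.aeval z q =
      MvPolynomial.eval₂ (dclHom ι M) (Sum.elim b z) p := by
    intro z
    rw [← AlgHom.coe_toRingHom, ← MvPolynomial.coe_eval₂Hom, ← RingHom.comp_apply]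
    congr 1
    refine MvPolynomial.ringHom_ext (fun r => ?_) fun i => ?_
    · simp [specialize]
      rfl
    · rcases i with i | i <;> simp [specialize]
      rfl
  have h0 : q = 0 := ha (((hq a).trans (hp a haX)).trans (map_zero _).symm)
  rw [← hq, h0, map_zero] at hz
  exact hz rfl

/-- A definable set is large if and only if it is Zariski dense. A dense set has generic points in
elementary extensions; conversely, an acl-independent point cannot lie in the zero set of one of
the polynomials which bound the sets of the family that are not dense. -/
theorem isLarge_iff_isZariskiDense (hK : AlgebraicallyBoundedOver L (dclRing ι K))
    {M : Type (max u v w)} [Field M] [Ring.CompatibleRing M] [L.Structure M] [ι.IsExpansionOn M]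
    [M ⊨ L.completeTheory K] {σ : Type} [Finite σ] {m : ℕ} (φ : L.Formula (Fin m ⊕ σ))
    (b : Fin m → M) : IsLarge L (defSet φ b) ↔ IsZariskiDense (defSet φ b) := by
  rw [isLarge_iff]
  constructor
  · rintro ⟨m, φ, b, hX, N, _, f, a, ha, hinj, hindep⟩
    have : N ⊨ L.completeTheory K := model_of_elementary f
    have : Nonempty N := ⟨f 0⟩
    obtain ⟨_, _, _⟩ := exists_field_of_model ι K N
    rw [hX]
    obtain ⟨P, hP⟩ := exists_bounds.{u, v, w, max u v w} ι hK φ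
    rw [defSet, ← isZariskiDense_elementary_iff ι hK φ f]
    refine (hP N (f ∘ b)).resolve_right ?_
    rintro ⟨p, -, hp⟩
    exact not_bounds_of_algebraicIndependent ι (B := Set.range (f ∘ b))
      (fun i => Subring.subset_closure (Or.inr ⟨i, rfl⟩))
      (algebraicIndependent_of_aclIndep ι hK hinj hindep) ha p hp
  · intro hX
    refine ⟨m, φ, b, rfl, ?_⟩
    let j : ULift.{max u v w} σ → ULift.{max u v w} σ := id
    obtain ⟨N, _, _, _, _, _, f, a, ha, hindep⟩ := exists_generic_extension.{u, v, w} ι (K := K)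
      (M := M) j {φ.relabel (Sum.map b ULift.up)} (by
        intro Γ₀ hΓ₀ p hp
        obtain ⟨z, hz, hpz⟩ : ∃ z ∈ defSet φ b,
            MvPolynomial.eval z (MvPolynomial.rename ULift.down p) ≠ 0 := by
          by_contra hcon
          push Not at hcon
          exact hp ((map_eq_zero_iff _ (MvPolynomial.rename_injective _
            ULift.down_injective)).1 (hX _ hcon))
        refine ⟨z ∘ ULift.down, fun φ' hφ' => ?_, by rwa [MvPolynomial.eval_rename] at hpz⟩
        rw [hΓ₀ hφ', Formula.realize_relabel, Sum.elim_comp_map]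
        exact hz)
    have hφ := ha _ rfl
    rw [Formula.realize_relabel, Sum.elim_comp_map] at hφ
    let _ : Algebra M N := (embHom ι f).toAlgebra
    have hind : AlgebraicIndependent M (a ∘ ULift.up : σ → N) := by
      rw [algebraicIndependent_iff]
      intro p hp
      refine (map_eq_zero_iff _ (MvPolynomial.rename_injective _ ULift.up_injective)).1
        (hindep (MvPolynomial.rename ULift.up p) ?_)
      rw [MvPolynomial.eval₂_rename]
      exact hp
    refine ⟨N, inferInstance, f, a ∘ ULift.up, hφ, hind.injective, ?_⟩
    rintro _ ⟨i, rfl⟩ hi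
    refine hind.transcendental_adjoin (s := {i}ᶜ) (i := i) (by simp)
      (isAlgebraic_of_mem_acl ι hK (Algebra.adjoin M ((a ∘ ULift.up : σ → N) '' {i}ᶜ)).toSubring
        (fun r => ?_) ?_ hi)
    · have : dclHom ι N r = algebraMap M N (dclMap ι M r) := (map_dclMap ι f r).symm
      rw [this]
      exact Subalgebra.algebraMap_mem _ _
    · rintro _ (⟨j, rfl⟩ | ⟨⟨j, rfl⟩, hj⟩)
      · exact Subalgebra.algebraMap_mem _ (b j)
      · exact Algebra.subset_adjoin ⟨j, fun h => hj (by rw [h]; rfl), rfl⟩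

end LargeDense

end NCDer

namespace NCDer

/-! ### Structures with derivations and the two schemes -/

section Semantics

variable {L : FirstOrder.Language.{u, v}} {k : ℕ} {M : Type x}

/-- The interpretation of the new function symbols by the maps `D i`. -/
@[reducible] def derStructure (D : Fin k → M → M) : (derLang k).Structure M where
  funMap := fun {_} f z => match f, z with
    | DerFunc.der i, z => D i (z 0)
  RelMap := fun r => r.elim

/-- The expansion of an `L`-structure by maps `D i`. -/
@[reducible] def ncStructure [L.Structure M] (D : Fin k → M → M) : (ncLang L k).Structure M :=
  letI := derStructure D
  Language.sumStructure L (derLang k) M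

instance isExpansionOn_ncStructure [L.Structure M] (D : Fin k → M → M) :
    letI : (ncLang L k).Structure M := ncStructure D
    (LHom.sumInl : L →ᴸ ncLang L k).IsExpansionOn M :=
  letI := derStructure D
  LHom.sumInl_isExpansionOn (L := L) (L' := derLang k) M

variable [(ncLang L k).Structure M]

theorem realize_derTerm {α : Type w'} (i : Fin k) (t : (ncLang L k).Term α) (z : α → M) :
    (derTerm i t).realize z = derMap L M i (t.realize z) :=
  Term.realize_functions_apply₁

theorem realize_wordAct_derTerm {α : Type w'} (γ : FreeMonoid (Fin k)) (t : (ncLang L k).Term α)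
    (z : α → M) : (wordAct derTerm γ t).realize z = wordAct (derMap L M) γ (t.realize z) := by
  unfold wordAct
  induction γ.toList with
  | nil => rfl
  | cons i l ih => rw [List.foldr_cons, realize_derTerm, ih, List.foldr_cons]

theorem realize_univClosure {β : Type} [Finite β] (φ : (ncLang L k).Formula β) :
    M ⊨ univClosure φ ↔ ∀ z : β → M, φ.Realize z :=
  realize_iAlls_sentence φ M

variable [L.Structure M] [(LHom.sumInl : L →ᴸ ncLang L k).IsExpansionOn M]

theorem realize_toNC {α : Type w'} (φ : L.Formula α) (z : α → M) :
    (toNC k φ).Realize z ↔ φ.Realize z :=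
  LHom.realize_onFormula _ φ

theorem realize_subst_toNC {α β : Type*} (φ : L.Formula α) (t : α → (ncLang L k).Term β)
    (z : β → M) : Formula.Realize (BoundedFormula.subst (toNC k φ) t) z ↔
      φ.Realize fun a => (t a).realize z := by
  rw [Formula.Realize, BoundedFormula.realize_subst]
  exact realize_toNC φ _

theorem realize_atJets {n : ℕ} (β : L.Formula (Fin n × FreeMonoid (Fin k))) (c : Fin n → M) :
    (atJets β).Realize c ↔ β.Realize fun p => wordAct (derMap L M) p.2 (c p.1) := by
  rw [atJets, realize_subst_toNC]
  simp only [realize_wordAct_derTerm, Term.realize_var]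

theorem realize_deepAxiom {m : ℕ} (V : Set (FreeMonoid (Fin k))) (φ : L.Formula (Fin m ⊕ V))
    (lam : L.Formula (Fin m)) : M ⊨ deepAxiom V φ lam ↔ ∀ b : Fin m → M, lam.Realize b →
      ∃ c : M, (fun γ : V => wordAct (derMap L M) γ.1 c) ∈ defSet φ b := by
  rw [deepAxiom, realize_univClosure]
  refine forall_congr' fun b => ?_
  rw [Formula.realize_imp, realize_toNC, Formula.realize_iExs]
  have h : ∀ c : Fin 1 → M, Formula.Realize (BoundedFormula.subst (toNC k φ)
      (Sum.elim (fun j => Term.var (Sum.inl j))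
        (fun γ => wordAct derTerm γ.1 (Term.var (Sum.inr 0))))) (Sum.elim b c) ↔
        (fun γ : V => wordAct (derMap L M) γ.1 (c 0)) ∈ defSet φ b := by
    intro c
    rw [realize_subst_toNC, defSet, Set.mem_ofPred_eq]
    refine iff_of_eq (congrArg φ.Realize ?_)
    funext i
    rcases i with i | i
    · rfl
    · simp only [Sum.elim_inr, realize_wordAct_derTerm, Term.realize_var]
  simp only [h]
  exact imp_congr_right fun _ => ⟨fun ⟨c, hc⟩ => ⟨c 0, hc⟩, fun ⟨c, hc⟩ => ⟨fun _ => c, hc⟩⟩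

theorem realize_wideAxiom {m n : ℕ} (φ : L.Formula (Fin m ⊕ (Fin n ⊕ Fin k × Fin n)))
    (lam : L.Formula (Fin m)) : M ⊨ wideAxiom φ lam ↔ ∀ b : Fin m → M, lam.Realize b →
      ∃ c : Fin n → M, Sum.elim c (fun p => derMap L M p.1 (c p.2)) ∈ defSet φ b := by
  rw [wideAxiom, realize_univClosure]
  refine forall_congr' fun b => ?_
  rw [Formula.realize_imp, realize_toNC, Formula.realize_iExs]
  refine imp_congr_right fun _ => exists_congr fun c => ?_
  rw [realize_subst_toNC, defSet, Set.mem_ofPred_eq]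
  refine iff_of_eq (congrArg φ.Realize ?_)
  funext i
  rcases i with i | i | i
  · rfl
  · rfl
  · simp only [Sum.elim_inr, realize_derTerm, Term.realize_var]

end Semantics

section Definable

variable {L : FirstOrder.Language.{u, v}}

/-- The sets definable with parameters are those defined by formulas with finitely many
parameters. -/
theorem definable_univ_iff {M : Type x} [L.Structure M] {σ : Type*} {X : Set (σ → M)} :
    (Set.univ : Set M).Definable L X ↔
      ∃ (m : ℕ) (φ : L.Formula (Fin m ⊕ σ)) (b : Fin m → M), X = defSet φ b := by
  classical
  constructor
  · intro h
    obtain ⟨A, -, hA⟩ := Set.definable_iff_finitely_definable.1 h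
    obtain ⟨φ, rfl⟩ := Set.definable_iff_exists_formula_sum.1 hA
    let e := Fintype.equivFin A
    refine ⟨_, φ.relabel (Sum.map e id), fun i => e.symm i, ?_⟩
    ext z
    rw [defSet, Set.mem_ofPred_eq, Set.mem_ofPred_eq, Formula.realize_relabel]
    refine iff_of_eq (congrArg φ.Realize ?_)
    funext i
    rcases i with i | i
    · simp
    · rfl
  · rintro ⟨m, φ, b, rfl⟩
    refine Set.definable_iff_exists_formula_sum.2
      ⟨φ.relabel (Sum.map (fun i => ⟨b i, trivial⟩) id), ?_⟩
    ext z
    rw [defSet, Set.mem_ofPred_eq, Set.mem_ofPred_eq, Formula.realize_relabel]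
    refine iff_of_eq (congrArg φ.Realize ?_)
    funext i
    rcases i with i | i <;> rfl

theorem definable_setOf_realize {M : Type x} [L.Structure M] {σ : Type*} (φ : L.Formula (M ⊕ σ)) :
    (Set.univ : Set M).Definable L {z | φ.Realize (Sum.elim id z)} := by
  refine Set.definable_iff_exists_formula_sum.2
    ⟨φ.relabel (Sum.map (fun i => ⟨i, trivial⟩) id), ?_⟩
  ext z
  rw [Set.mem_ofPred_eq, Set.mem_ofPred_eq, Formula.realize_relabel]
  refine iff_of_eq (congrArg φ.Realize ?_)
  funext i
  rcases i with i | i <;> rfl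

theorem exists_formula_of_definable {M : Type x} [L.Structure M] {σ : Type*} {X : Set (σ → M)}
    (h : (Set.univ : Set M).Definable L X) :
    ∃ φ : L.Formula (M ⊕ σ), X = {z | φ.Realize (Sum.elim id z)} := by
  obtain ⟨φ, rfl⟩ := Set.definable_iff_exists_formula_sum.1 h
  refine ⟨φ.relabel (Sum.map Subtype.val id), ?_⟩
  ext z
  rw [Set.mem_ofPred_eq, Set.mem_ofPred_eq, Formula.realize_relabel, Sum.elim_comp_map]
  rfl

theorem image_comp_defSet {M : Type x} [L.Structure M] [Nonempty M] {σ τ : Type*} [Finite σ] {m : ℕ}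
    {j : σ → τ} (hj : Function.Injective j) (φ : L.Formula (Fin m ⊕ τ)) (b : Fin m → M) :
    (fun z : τ → M => z ∘ j) '' defSet φ b = defSet (exProj j φ) b := by
  ext z
  simp only [defSet, Set.mem_image, Set.mem_ofPred_eq, realize_exProj hj]
  exact exists_congr fun _ => and_comm

end Definable

theorem model_completeTheory_of_ncTheory {L : FirstOrder.Language.{u, v}}
    (ι : FirstOrder.Language.ring →ᴸ L) {K : Type w} [Field K] [Ring.CompatibleRing K]
    [L.Structure K] [ι.IsExpansionOn K] {k : ℕ}
    {η : Fin k → Derivation ℤ (dclRing ι K) (dclRing ι K)} {M : Type x}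
    [(ncLang L k).Structure M] [L.Structure M] [(LHom.sumInl : L →ᴸ ncLang L k).IsExpansionOn M]
    (h : M ⊨ ncTheory ι K η) : M ⊨ L.completeTheory K :=
  ((LHom.sumInl : L →ᴸ ncLang L k).onTheory_model _).1 (h.mono fun _ hσ =>
    Or.inl (Or.inl (Or.inl hσ)))

section Schemes

variable {L : FirstOrder.Language.{u, v}} (ι : FirstOrder.Language.ring →ᴸ L)
  {K : Type w} [Field K] [CharZero K] [Ring.CompatibleRing K] [L.Structure K] [ι.IsExpansionOn K]

/-- Largeness of a coordinate projection is expressed by a formula in the parameters. -/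
theorem exists_expressesLarge (hK : AlgebraicallyBoundedOver L (dclRing ι K)) {m : ℕ}
    {β β' : Type} [Finite β'] {j : β' → β} (hj : Function.Injective j)
    (φ : L.Formula (Fin m ⊕ β)) :
    ∃ lam : L.Formula (Fin m), ExpressesLarge L K (fun _ z => z ∘ j) φ lam := by
  obtain ⟨lam, hlam⟩ := exists_denseFormula.{u, v, w, max u v w} ι hK (exProj j φ)
  refine ⟨lam, fun M b => ?_⟩
  obtain ⟨_, _, _⟩ := exists_field_of_model ι K M
  rw [hlam, image_comp_defSet hj, isLarge_iff_isZariskiDense ι hK]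
  rfl

theorem injective_projF {k : ℕ} (V : Set (FreeMonoid (Fin k))) : Function.Injective
    (fun γ => ⟨γ.1, γ.2.1⟩ : (V \ maxWords V : Set (FreeMonoid (Fin k))) → V) :=
  fun _ _ h => Subtype.ext (congrArg (fun z : V => z.1) h)

variable {k : ℕ} (η : Fin k → Derivation ℤ (dclRing ι K) (dclRing ι K))
  {M : Type (max u v w)} [(ncLang L k).Structure M] [L.Structure M]
  [(LHom.sumInl : L →ᴸ ncLang L k).IsExpansionOn M] [Nonempty M]

/-- The models of `ncDeepTheory` are the models of `ncTheory` with nc-Deep. -/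
theorem model_ncDeepTheory_iff (hK : AlgebraicallyBoundedOver L (dclRing ι K)) :
    M ⊨ ncDeepTheory ι K η ↔ M ⊨ ncTheory ι K η ∧ NCDeep L (derMap L (k := k) M) := by
  constructor
  · intro h
    have h0 : M ⊨ ncTheory ι K η := h.mono fun _ => Or.inl
    have : M ⊨ L.completeTheory K := model_completeTheory_of_ncTheory ι h0
    refine ⟨h0, ?_⟩
    intro V hV hi Z hZ hl
    obtain ⟨m, φ, b, rfl⟩ := definable_univ_iff.1 hZ
    have : Finite (V \ maxWords V : Set (FreeMonoid (Fin k))) := hV.subset Set.sdiff_subset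
    obtain ⟨lam, hlam⟩ := exists_expressesLarge.{u, v, w} ι hK (injective_projF V) φ
    have h1 := h.realize_of_mem _ (Or.inr ⟨V, m, φ, lam, hV, hi, hlam, rfl⟩)
    exact (realize_deepAxiom V φ lam).1 h1 b ((hlam (Theory.ModelType.of _ M) b).2 hl)
  · rintro ⟨h0, h⟩
    have : M ⊨ L.completeTheory K := model_completeTheory_of_ncTheory ι h0
    refine ⟨?_⟩
    rintro _ (hσ | ⟨V, m, φ, lam, hV, hi, hlam, rfl⟩)
    · exact h0.realize_of_mem _ hσ
    · exact (realize_deepAxiom V φ lam).2 fun b hb => h V hV hi _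
        (definable_univ_iff.2 ⟨m, φ, b, rfl⟩) ((hlam (Theory.ModelType.of _ M) b).1 hb)

/-- The models of `ncWideTheory` are the models of `ncTheory` with nc-Wide. -/
theorem model_ncWideTheory_iff (hK : AlgebraicallyBoundedOver L (dclRing ι K)) :
    M ⊨ ncWideTheory ι K η ↔ M ⊨ ncTheory ι K η ∧ NCWide L (derMap L (k := k) M) := by
  constructor
  · intro h
    have h0 : M ⊨ ncTheory ι K η := h.mono fun _ => Or.inl
    have : M ⊨ L.completeTheory K := model_completeTheory_of_ncTheory ι h0
    refine ⟨h0, ?_⟩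
    intro n W hW hl
    obtain ⟨m, φ, b, rfl⟩ := definable_univ_iff.1 hW
    obtain ⟨lam, hlam⟩ := exists_expressesLarge.{u, v, w} ι hK
      (Sum.inl_injective (α := Fin n) (β := Fin k × Fin n)) φ
    have h1 := h.realize_of_mem _ (Or.inr ⟨n, m, φ, lam, hlam, rfl⟩)
    exact (realize_wideAxiom φ lam).1 h1 b ((hlam (Theory.ModelType.of _ M) b).2 hl)
  · rintro ⟨h0, h⟩
    have : M ⊨ L.completeTheory K := model_completeTheory_of_ncTheory ι h0
    refine ⟨?_⟩
    rintro _ (hσ | ⟨n, m, φ, lam, hlam, rfl⟩)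
    · exact h0.realize_of_mem _ hσ
    · exact (realize_wideAxiom φ lam).2 fun b hb => h n _
        (definable_univ_iff.2 ⟨m, φ, b, rfl⟩) ((hlam (Theory.ModelType.of _ M) b).1 hb)

end Schemes

section Models

variable {L : FirstOrder.Language.{u, v}} (ι : FirstOrder.Language.ring →ᴸ L)
  {K : Type w} [Field K] [Ring.CompatibleRing K] [L.Structure K] [ι.IsExpansionOn K]
  {k : ℕ} (η : Fin k → Derivation ℤ (dclRing ι K) (dclRing ι K))
  {M : Type x} [(ncLang L k).Structure M] [L.Structure M]
  [(LHom.sumInl : L →ᴸ ncLang L k).IsExpansionOn M]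
  [Field M] [Ring.CompatibleRing M] [ι.IsExpansionOn M]

/-- The models of `ncTheory` are the models of the theory of `K` with derivations extending the
given ones. -/
theorem model_ncTheory_iff : M ⊨ ncTheory ι K η ↔ M ⊨ L.completeTheory K ∧
    ∃ D : Fin k → Derivation ℤ M M, (∀ i x, derMap L M i x = D i x) ∧
      ∀ i a, D i (dclMap ι M a) = dclMap ι M (η i a) := by
  have hadd : ∀ (s t : (ncLang L k).Term (Fin 2)) (z : Fin 2 → M),
      (addT ι s t).realize z = s.realize z + t.realize z := by
    intro s t z
    rw [addT, Term.realize_functions_apply₂, LHom.map_onFunction, LHom.map_onFunction,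
      Ring.CompatibleRing.funMap_add]
    rfl
  have hmul : ∀ (s t : (ncLang L k).Term (Fin 2)) (z : Fin 2 → M),
      (mulT ι s t).realize z = s.realize z * t.realize z := by
    intro s t z
    rw [mulT, Term.realize_functions_apply₂, LHom.map_onFunction, LHom.map_onFunction,
      Ring.CompatibleRing.funMap_mul]
    rfl
  have hA : ∀ i, M ⊨ (derAddAxiom ι i : (ncLang L k).Sentence) ↔ ∀ x y : M,
      derMap L M i (x + y) = derMap L M i x + derMap L M i y := by
    intro i
    rw [derAddAxiom, realize_univClosure]
    simp only [Formula.realize_equal, realize_derTerm, hadd, Term.realize_var]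
    exact ⟨fun h x y => h ![x, y], fun h z => h _ _⟩
  have hM : ∀ i, M ⊨ (derMulAxiom ι i : (ncLang L k).Sentence) ↔ ∀ x y : M,
      derMap L M i (x * y) = x * derMap L M i y + y * derMap L M i x := by
    intro i
    rw [derMulAxiom, realize_univClosure]
    simp only [Formula.realize_equal, realize_derTerm, hadd, hmul, Term.realize_var]
    exact ⟨fun h x y => h ![x, y], fun h z => h _ _⟩
  have hE : ∀ i (φ ψ : L.Formula (Fin 1)), M ⊨ (derExtAxiom i φ ψ : (ncLang L k).Sentence) ↔
      ∀ x y : M, φ.Realize (fun _ => x) → ψ.Realize (fun _ => y) → derMap L M i x = y := by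
    intro i φ ψ
    rw [derExtAxiom, realize_univClosure]
    simp only [Formula.realize_imp, Formula.realize_inf, Formula.realize_relabel, realize_toNC,
      Formula.realize_equal, realize_derTerm, Term.realize_var]
    exact ⟨fun h x y hx hy => h ![x, y] ⟨hx, hy⟩, fun h z hz => h _ _ hz.1 hz.2⟩
  constructor
  · intro h
    have h0 := model_completeTheory_of_ncTheory ι h
    refine ⟨h0, fun i => Derivation.mk' (AddMonoidHom.toIntLinearMap
      (AddMonoidHom.mk' (derMap L M i) ((hA i).1 (h.realize_of_mem _
        (Or.inl (Or.inl (Or.inr ⟨i, rfl⟩))))))) ((hM i).1 (h.realize_of_mem _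
        (Or.inl (Or.inr ⟨i, rfl⟩)))), fun _ _ => rfl, fun i a => ?_⟩
    exact (hE i _ _).1 (h.realize_of_mem _ (Or.inr ⟨i, a, _, _, dclFormula_spec ι a,
      dclFormula_spec ι (η i a), rfl⟩)) _ _ ((dclMap_unique ι a _).2 rfl)
      ((dclMap_unique ι _ _).2 rfl)
  · rintro ⟨h0, D, hD, hext⟩
    refine ⟨?_⟩
    rintro _ (((hσ | ⟨i, rfl⟩) | ⟨i, rfl⟩) | ⟨i, a, φ, ψ, hφ, hψ, rfl⟩)
    · exact (((LHom.sumInl : L →ᴸ ncLang L k).onTheory_model _).2 h0).realize_of_mem _ hσ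
    · rw [hA]
      intro x y
      rw [hD, hD, hD, map_add]
    · rw [hM]
      intro x y
      rw [hD, hD, hD, Derivation.leibniz, smul_eq_mul, smul_eq_mul]
    · rw [hE]
      intro x y hx hy
      rw [(dclMap_unique_of_definesElem ι hφ x).1 hx,
        (dclMap_unique_of_definesElem ι hψ y).1 hy, hD, hext]

end Models

end NCDer

namespace NCDer

/-! ### Solving the problems of nc-Wide in an extension -/

/-- Finitely many Zariski dense conditions on disjoint blocks of variables can be satisfied
outside the zero set of a nonzero polynomial. -/
theorem exists_mem_eval_ne_zero {M : Type*} [Field M] [Infinite M] {I : Type*} {n : I → Type*}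
    (X : ∀ i, Set (n i → M)) (S : Finset I) (hX : ∀ i ∈ S, IsZariskiDense (X i))
    {p : MvPolynomial (Σ i, n i) M} (hp : p ≠ 0) :
    ∃ a : (Σ i, n i) → M, (∀ i ∈ S, (fun s => a ⟨i, s⟩) ∈ X i) ∧ MvPolynomial.eval a p ≠ 0 := by
  classical
  induction S using Finset.induction_on with
  | empty =>
    by_contra hcon
    push Not at hcon
    exact hp (MvPolynomial.funext fun a => by simpa using hcon a (by simp))
  | insert i S hi ih =>
    obtain ⟨a, ha, hpa⟩ := ih fun j hj => hX j (Finset.mem_insert_of_mem hj)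
    -- all the blocks other than the block `i` are kept
    let upd : (n i → M) → (Σ i, n i) → M := fun z s =>
      if h : s.1 = i then z (h ▸ s.2) else a s
    let q : MvPolynomial (n i) M := MvPolynomial.eval₂Hom MvPolynomial.C
      (fun s : Σ i, n i => if h : s.1 = i then MvPolynomial.X (h ▸ s.2)
        else MvPolynomial.C (a s)) p
    have hq : ∀ z, MvPolynomial.eval z q = MvPolynomial.eval (upd z) p := by
      intro z
      rw [← RingHom.comp_apply]
      congr 1
      refine MvPolynomial.ringHom_ext (fun r => by simp) fun s => ?_
      by_cases h : s.1 = i <;> simp [upd, h]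
    have ha' : upd (fun s => a ⟨i, s⟩) = a := by
      funext ⟨j, s⟩
      by_cases h : j = i
      · subst h; simp [upd]
      · simp [upd, h]
    have hq0 : q ≠ 0 := by
      intro h
      have h' := hq fun s => a ⟨i, s⟩
      rw [ha', h, map_zero] at h'
      exact hpa h'.symm
    obtain ⟨z, hz, hqz⟩ : ∃ z ∈ X i, MvPolynomial.eval z q ≠ 0 := by
      by_contra hcon
      push Not at hcon
      exact hq0 (hX i (Finset.mem_insert_self i S) q hcon)
    refine ⟨upd z, fun j hj => ?_, by rwa [← hq]⟩
    rcases Finset.mem_insert.1 hj with rfl | hj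
    · simpa [upd] using hz
    · have hji : j ≠ i := fun h => hi (h ▸ hj)
      simpa [upd, hji] using ha j hj

section OneStep

variable {L : FirstOrder.Language.{u, v}} (ι : FirstOrder.Language.ring →ᴸ L)
  {K : Type w} [Field K] [CharZero K] [Ring.CompatibleRing K] [L.Structure K] [ι.IsExpansionOn K]
  {k : ℕ} {M : Type (max u v w)} [Field M] [Ring.CompatibleRing M] [L.Structure M]
  [ι.IsExpansionOn M] [M ⊨ L.completeTheory K]

omit [M ⊨ L.completeTheory K] in
/-- A derivation extends along an elementary extension, with prescribed values on a tuple
algebraically independent over the small model. -/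
theorem exists_derivation_elementary {N : Type (max u v w)} [Field N] [Ring.CompatibleRing N]
    [L.Structure N] [ι.IsExpansionOn N] [N ⊨ L.completeTheory K] (f : M ↪ₑ[L] N) {σ : Type*}
    {a : σ → N}
    (ha : ∀ p : MvPolynomial σ M, MvPolynomial.eval₂ (embHom ι f) a p = 0 → p = 0)
    (D : Derivation ℤ M M) (b : σ → N) :
    ∃ D' : Derivation ℤ N N, (∀ z, D' (f z) = f (D z)) ∧ ∀ s, D' (a s) = b s := by
  let _ : Algebra M N := (embHom ι f).toAlgebra
  have : CharZero N := charZero_of_model ι K N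
  have hind : AlgebraicIndependent M a := algebraicIndependent_iff.2 ha
  exact exists_derivation_extension hind ((Algebra.linearMap M N).compDer D) b

/-- All the problems of nc-Wide over a model with derivations can be solved in an extension
which is elementary in the language `L`. -/
theorem exists_wide_step (D : Fin k → Derivation ℤ M M) :
    ∃ (N : Type (max u v w)) (_ : Field N) (_ : Ring.CompatibleRing N) (_ : L.Structure N)
      (_ : ι.IsExpansionOn N) (_ : N ⊨ L.completeTheory K) (f : M ↪ₑ[L] N)
      (D' : Fin k → Derivation ℤ N N), (∀ l z, D' l (f z) = f (D l z)) ∧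
        ∀ (n : ℕ) (φ : L.Formula (M ⊕ (Fin n ⊕ Fin k × Fin n))),
          IsZariskiDense (projN '' {z | φ.Realize (Sum.elim id z)}) →
            ∃ c : Fin n → N, φ.Realize (Sum.elim f (Sum.elim c fun p => D' p.1 (c p.2))) := by
  classical
  have : CharZero M := charZero_of_model ι K M
  let I : Type (max u v w) := Σ n : ℕ, {φ : L.Formula (M ⊕ (Fin n ⊕ Fin k × Fin n)) //
    IsZariskiDense (projN '' {z | φ.Realize (Sum.elim id z)})}
  let α : Type (max u v w) := Σ i : I, Fin i.1 ⊕ Fin k × Fin i.1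
  let τ : Type (max u v w) := Σ i : I, Fin i.1
  let j : τ → α := fun s => ⟨s.1, Sum.inl s.2⟩
  let ψ : I → L.Formula (M ⊕ α) := fun i => i.2.1.relabel (Sum.map id fun s => ⟨i, s⟩)
  have hψ : ∀ (i : I) {N : Type (max u v w)} [L.Structure N] (g : M → N) (a : α → N),
      (ψ i).Realize (Sum.elim g a) ↔ i.2.1.Realize (Sum.elim g fun s => a ⟨i, s⟩) := by
    intro i N _ g a
    rw [Formula.realize_relabel, Sum.elim_comp_map]
    rfl
  -- solve all the problems at once, with the coordinates of the projections independent over `M`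
  obtain ⟨N, _, _, _, _, _, f, a, ha, hindep⟩ := exists_generic_extension.{u, v, w} ι (K := K)
    (M := M) j (Set.range ψ) (by
      intro Γ₀ hΓ₀ p hp
      rw [← Set.image_univ] at hΓ₀
      obtain ⟨S, -, rfl⟩ := Finset.subset_set_image_iff.1 hΓ₀
      obtain ⟨a, ha, hpa⟩ := exists_mem_eval_ne_zero
        (fun i : I => projN '' {z | i.2.1.Realize (Sum.elim id z)}) S
        (fun i _ => i.2.2) hp
      let good : I → Prop := fun i => ∃ z, i.2.1.Realize (Sum.elim id z) ∧
        projN z = fun s => a ⟨i, s⟩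
      let full : α → M := fun s =>
        if h : good s.1 then h.choose s.2 else Sum.elim (fun t => a ⟨s.1, t⟩) (fun _ => 0) s.2
      have hfull : full ∘ j = a := by
        funext ⟨i, s⟩
        by_cases h : good i
        · simp only [Function.comp_apply, full, j, h, dif_pos]
          exact congrFun h.choose_spec.2 s
        · simp only [Function.comp_apply, full, j, h, dif_neg, not_false_eq_true, Sum.elim_inl]
      refine ⟨full, fun φ hφ => ?_, by rwa [hfull]⟩
      obtain ⟨i, hi, rfl⟩ := Finset.mem_image.1 hφ
      rw [hψ]
      have h : good i := ha i hi
      have : (fun s => full ⟨i, s⟩) = h.choose := by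
        funext s
        simp only [full, h, dif_pos]
      rw [this]
      exact h.choose_spec.1)
  -- the derivations can then be prescribed on these coordinates
  have hD : ∀ l, ∃ D' : Derivation ℤ N N, (∀ z, D' (f z) = f (D l z)) ∧
      ∀ s : τ, D' (a (j s)) = a ⟨s.1, Sum.inr (l, s.2)⟩ := fun l =>
    exists_derivation_elementary ι (K := K) f hindep (D l) _
  choose D' hD1 hD2 using hD
  refine ⟨N, inferInstance, inferInstance, inferInstance, inferInstance, inferInstance, f, D', hD1,
    fun n φ hφ => ?_⟩
  let i : I := ⟨n, φ, hφ⟩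
  refine ⟨fun s => a ⟨i, Sum.inl s⟩, ?_⟩
  have h := (hψ i f a).1 (ha _ ⟨i, rfl⟩)
  refine (iff_of_eq (congrArg φ.Realize ?_)).1 h
  congr 1
  funext s
  rcases s with s | ⟨l, s⟩
  · rfl
  · exact (hD2 l ⟨i, s⟩).symm

end OneStep

end NCDer

namespace NCDer

/-! ### Elementary chains -/

section Chain

variable {L : FirstOrder.Language.{u, v}}

/-- The Tarski–Vaught theorem on elementary chains: the maps into the union are elementary. -/
theorem isElementary_of_chain {G : ℕ → Type x} [∀ i, L.Structure (G i)] {P : Type y}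
    [L.Structure P] (f : ∀ i j, i ≤ j → G i ↪ₑ[L] G j) (g : ∀ i, G i ↪[L] P)
    (hgf : ∀ i j h a, g j (f i j h a) = g i a) (hsurj : ∀ z, ∃ i a, g i a = z) (i : ℕ) :
    ∃ e : G i ↪ₑ[L] P, ⇑e = g i := by
  have key : ∀ {α : Type} {n : ℕ} (φ : L.BoundedFormula α n) (i : ℕ) (b : α → G i)
      (xs : Fin n → G i), φ.Realize (g i ∘ b) (g i ∘ xs) ↔ φ.Realize b xs := by
    intro α n φ
    induction φ with
    | falsum => exact fun _ _ _ => Iff.rfl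
    | equal t₁ t₂ =>
      intro i b xs
      simp only [BoundedFormula.Realize, ← Sum.comp_elim, HomClass.realize_term]
      exact (g i).injective.eq_iff
    | rel R ts =>
      intro i b xs
      simp only [BoundedFormula.Realize, ← Sum.comp_elim, HomClass.realize_term]
      exact (g i).map_rel R _
    | imp φ ψ ih1 ih2 =>
      intro i b xs
      simp only [BoundedFormula.realize_imp, ih1 i b xs, ih2 i b xs]
    | all φ ih =>
      intro i b xs
      simp only [BoundedFormula.realize_all]
      constructor
      · intro h a
        rw [← ih, Fin.comp_snoc]
        exact h (g i a)
      · intro h z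
        obtain ⟨j, a, rfl⟩ := hsurj z
        have hb : ∀ {β : Type} (c : β → G i),
            g i ∘ c = g (max i j) ∘ (f i (max i j) (le_max_left i j) ∘ c) := fun c =>
          funext fun s => (hgf _ _ _ _).symm
        have ha : g j a = g (max i j) (f j (max i j) (le_max_right i j) a) := (hgf _ _ _ _).symm
        rw [hb, hb, ha, ← Fin.comp_snoc, ih]
        have h' : φ.all.Realize (f i (max i j) (le_max_left i j) ∘ b)
            (f i (max i j) (le_max_left i j) ∘ xs) := by
          rw [(f i (max i j) (le_max_left i j)).map_boundedFormula]
          exact h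
        exact h' _
  refine ⟨⟨g i, fun n φ b => ?_⟩, rfl⟩
  rw [Formula.Realize, Formula.Realize, ← key φ i b default]
  exact iff_of_eq (congrArg _ (Subsingleton.elim _ _))

/-- An embedding of `L`-structures commuting with the maps `D i` is an embedding of structures
for the expanded language. -/
def ncEmbedding {k : ℕ} {M : Type x} {N : Type y} [L.Structure M] [L.Structure N]
    [(ncLang L k).Structure M] [(ncLang L k).Structure N]
    [(LHom.sumInl : L →ᴸ ncLang L k).IsExpansionOn M]
    [(LHom.sumInl : L →ᴸ ncLang L k).IsExpansionOn N] (f : M ↪[L] N)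
    (h : ∀ i z, f (derMap L M i z) = derMap L N (k := k) i (f z)) : M ↪[ncLang L k] N where
  toFun := f
  inj' := f.injective
  map_fun' := by
    rintro n (F | F) z
    · exact ((congrArg f (LHom.funMap_sumInl (L' := derLang k))).trans (f.map_fun F z)).trans
        (LHom.funMap_sumInl (L' := derLang k)).symm
    · obtain ⟨i⟩ := F
      have h1 : z = ![z 0] := funext fun s => by rw [Subsingleton.elim s 0]; rfl
      have h2 : f ∘ z = ![f (z 0)] := funext fun s => by rw [Subsingleton.elim s 0]; rfl
      have h' := h i (z 0)
      rw [derMap, derMap, ← h1, ← h2] at h'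
      exact h'
  map_rel' := by
    rintro n (R | R) z
    · exact (iff_of_eq ((LHom.sumInl : L →ᴸ ncLang L k).map_onRelation R _)).trans
        ((f.map_rel R z).trans
          (iff_of_eq ((LHom.sumInl : L →ᴸ ncLang L k).map_onRelation R _).symm))
    · exact R.elim

end Chain

section WideExtension

variable {L : FirstOrder.Language.{u, v}} (ι : FirstOrder.Language.ring →ᴸ L)
  (K : Type w) [Field K] [Ring.CompatibleRing K] [L.Structure K] [ι.IsExpansionOn K]

/-- A model of the theory of `K` with `k` derivations. -/
structure DerModel (k : ℕ) where
  carrier : Type (max u v w)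
  [field : Field carrier]
  [compatible : Ring.CompatibleRing carrier]
  [str : L.Structure carrier]
  [expansion : ι.IsExpansionOn carrier]
  [model : carrier ⊨ L.completeTheory K]
  der : Fin k → Derivation ℤ carrier carrier

attribute [instance] DerModel.field DerModel.compatible DerModel.str DerModel.expansion
  DerModel.model

variable {ι K} {k : ℕ}

/-- The structure for the expanded language. -/
instance DerModel.ncStr (S : DerModel ι K k) : (ncLang L k).Structure S.carrier :=
  ncStructure fun i => S.der i

/-- An elementary embedding for the language `L` which commutes with the derivations. -/
structure DerModel.Hom (S S' : DerModel ι K k) where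
  emb : S.carrier ↪ₑ[L] S'.carrier
  comm : ∀ i z, S'.der i (emb z) = emb (S.der i z)

/-- The composition of two homomorphisms. -/
def DerModel.Hom.comp {S S' S'' : DerModel ι K k} (g : S'.Hom S'') (f : S.Hom S') : S.Hom S'' :=
  ⟨g.emb.comp f.emb, fun i z => by
    rw [ElementaryEmbedding.comp_apply, g.comm, f.comm, ElementaryEmbedding.comp_apply]⟩

/-- The derivations extend the derivations `η i` of `dcl(∅)`. -/
def DerModel.Extends (S : DerModel ι K k)
    (η : Fin k → Derivation ℤ (dclRing ι K) (dclRing ι K)) : Prop :=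
  ∀ i a, S.der i (dclMap ι S.carrier a) = dclMap ι S.carrier (η i a)

theorem DerModel.Hom.extends {S S' : DerModel ι K k} (f : S.Hom S')
    {η : Fin k → Derivation ℤ (dclRing ι K) (dclRing ι K)} (h : S.Extends η) : S'.Extends η := by
  intro i a
  rw [← map_dclMap ι f.emb, f.comm, h, map_dclMap]

/-- The union of a chain. -/
theorem DerModel.exists_limit (G : ℕ → DerModel ι K k) (f : ∀ n, (G n).Hom (G (n + 1))) :
    ∃ (S : DerModel ι K k) (e : ∀ n, (G n).Hom S),
      (∀ n a, (e (n + 1)).emb ((f n).emb a) = (e n).emb a) ∧ ∀ z, ∃ n a, (e n).emb a = z := by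
  let g : ∀ n, (G n).carrier ↪[ncLang L k] (G (n + 1)).carrier := fun n =>
    ncEmbedding (f n).emb.toEmbedding fun i z => ((f n).comm i z).symm
  let P := Language.DirectLimit (fun n => (G n).carrier) (DirectedSystem.natLERec g)
  let _ : (ncLang L k).Structure P := DirectLimit.instStructureDirectLimit _ _
  let of : ∀ n, (G n).carrier ↪[ncLang L k] P := fun n =>
    DirectLimit.of (ncLang L k) ℕ (fun n => (G n).carrier) (DirectedSystem.natLERec g) n
  let _ : L.Structure P := (LHom.sumInl : L →ᴸ ncLang L k).reduct P
  have hsucc : ∀ n a, of (n + 1) ((f n).emb a) = of n a := by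
    intro n a
    have h1 : g n a = DirectedSystem.natLERec g n (n + 1) (Nat.le_succ n) a := by
      rw [DirectedSystem.natLERec, Nat.leRecOn_succ']
      rfl
    have h2 := DirectLimit.of_f (L := ncLang L k) (f := DirectedSystem.natLERec g)
      (hij := Nat.le_succ n) (x := a)
    rw [← h1] at h2
    exact h2
  have hle : ∀ i j (h : i ≤ j), ∃ F : (G i).Hom (G j), ∀ a, of j (F.emb a) = of i a := by
    intro i j h
    induction j, h using Nat.le_induction with
    | base => exact ⟨⟨ElementaryEmbedding.refl L _, fun _ _ => rfl⟩, fun _ => rfl⟩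
    | succ j h ih =>
      obtain ⟨F, hF⟩ := ih
      refine ⟨(f j).comp F, fun a => ?_⟩
      rw [← hF, ← hsucc j]
      rfl
  choose F hF using hle
  have hsurj : ∀ z : P, ∃ i a, of i a = z := DirectLimit.exists_of
  let ofL : ∀ n, (G n).carrier ↪[L] P := fun n =>
    { toFun := of n
      inj' := (of n).injective
      map_fun' := fun {m} F z => (of n).map_fun (Sum.inl F : (ncLang L k).Functions m) z
      map_rel' := fun {m} R z => (of n).map_rel (Sum.inl R : (ncLang L k).Relations m) z }
  have hel := isElementary_of_chain (fun i j h => (F i j h).emb) ofL hF hsurj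
  -- the field operations and the derivations of the union are those of the stages
  choose e he using hel
  have he' : ∀ n a, e n a = of n a := fun n a => congrFun (he n) a
  have : P ⊨ L.completeTheory K := model_of_elementary (e 0)
  have : Nonempty P := ⟨e 0 0⟩
  obtain ⟨_, _, _⟩ := exists_field_of_model ι K P
  have hcomm : ∀ n i z, derMap L P i (e n z) = e n ((G n).der i z) := by
    intro n i z
    rw [he', he']
    have h := (of n).map_fun (derFunc L i) ![z]
    refine Eq.trans ?_ h.symm
    rw [derMap]
    congr 1
    funext s
    rw [Subsingleton.elim s 0]
    rfl
  have hstage : ∀ x y : P, ∃ n a b, e n a = x ∧ e n b = y := by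
    intro x y
    obtain ⟨i, a, rfl⟩ := hsurj x
    obtain ⟨j, b, rfl⟩ := hsurj y
    exact ⟨max i j, (F i _ (le_max_left i j)).emb a, (F j _ (le_max_right i j)).emb b,
      by rw [he', hF], by rw [he', hF]⟩
  have hadd : ∀ (i : Fin k) (x y : P), derMap L P i (x + y) = derMap L P i x + derMap L P i y := by
    intro i x y
    obtain ⟨n, a, b, rfl, rfl⟩ := hstage x y
    have h := hcomm n i (a + b)
    rw [Derivation.map_add] at h
    simp only [← embHom_apply ι, map_add] at h ⊢
    simp only [embHom_apply] at h ⊢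
    rw [h, hcomm, hcomm]
  have hmul : ∀ (i : Fin k) (x y : P),
      derMap L P i (x * y) = x * derMap L P i y + y * derMap L P i x := by
    intro i x y
    obtain ⟨n, a, b, rfl, rfl⟩ := hstage x y
    have h := hcomm n i (a * b)
    rw [Derivation.leibniz, smul_eq_mul, smul_eq_mul] at h
    simp only [← embHom_apply ι, map_add, map_mul] at h ⊢
    simp only [embHom_apply] at h ⊢
    rw [h, hcomm, hcomm]
  let D : Fin k → Derivation ℤ P P := fun i => Derivation.mk' (AddMonoidHom.toIntLinearMap
    (AddMonoidHom.mk' (derMap L P i) (hadd i))) (hmul i)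
  exact ⟨⟨P, D⟩, fun n => ⟨e n, fun i z => hcomm n i z⟩, fun n a => by
    rw [he', he', hsucc], fun z => by
    obtain ⟨n, a, h⟩ := hsurj z
    exact ⟨n, a, by rw [he', h]⟩⟩

/-- Every model with derivations has an extension, elementary in the language `L`, which
satisfies nc-Wide: the union of a chain, each stage of which solves the problems over the previous
one. -/
theorem DerModel.exists_wide [CharZero K] (hK : AlgebraicallyBoundedOver L (dclRing ι K))
    (S : DerModel ι K k) :
    ∃ (S' : DerModel ι K k) (_ : S.Hom S'), NCWide L (fun i => ⇑(S'.der i)) := by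
  have hstep : ∀ S : DerModel ι K k, ∃ (S' : DerModel ι K k) (f : S.Hom S'),
      ∀ (n : ℕ) (φ : L.Formula (S.carrier ⊕ (Fin n ⊕ Fin k × Fin n))),
        IsZariskiDense (projN '' {z | φ.Realize (Sum.elim id z)}) →
          ∃ c : Fin n → S'.carrier,
            φ.Realize (Sum.elim f.emb (Sum.elim c fun p => S'.der p.1 (c p.2))) := by
    intro S
    obtain ⟨N, _, _, _, _, _, f, D', hD, h⟩ := exists_wide_step.{u, v, w} ι (K := K) S.der
    exact ⟨⟨N, D'⟩, ⟨f, hD⟩, h⟩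
  choose next hom hnext using hstep
  obtain ⟨G, hom, f0, hnext⟩ : ∃ (G : ℕ → DerModel ι K k) (f : ∀ n, (G n).Hom (G (n + 1)))
      (_ : S.Hom (G 0)), ∀ (r n : ℕ) (φ : L.Formula ((G r).carrier ⊕ (Fin n ⊕ Fin k × Fin n))),
        IsZariskiDense (projN '' {z | φ.Realize (Sum.elim id z)}) →
          ∃ c : Fin n → (G (r + 1)).carrier,
            φ.Realize (Sum.elim (f r).emb (Sum.elim c fun p => (G (r + 1)).der p.1 (c p.2))) :=
    ⟨fun n => Nat.rec S (fun _ => next) n, fun _ => hom _,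
      ⟨ElementaryEmbedding.refl L _, fun _ _ => rfl⟩, fun _ => hnext _⟩
  obtain ⟨P, e, he, hsurj⟩ := DerModel.exists_limit G hom
  refine ⟨P, (e 0).comp f0, ?_⟩
  intro n W hW hl
  obtain ⟨m, φ, b, rfl⟩ := definable_univ_iff.1 hW
  obtain ⟨r, b', rfl⟩ : ∃ (r : ℕ) (b' : Fin m → (G r).carrier), b = (e r).emb ∘ b' := by
    have hmono : ∀ i j, i ≤ j → ∀ a, ∃ a', (e j).emb a' = (e i).emb a := by
      intro i j h
      induction j, h using Nat.le_induction with
      | base => exact fun a => ⟨a, rfl⟩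
      | succ j h ih =>
        intro a
        obtain ⟨a', ha'⟩ := ih a
        exact ⟨(hom j).emb a', (he j a').trans ha'⟩
    choose i a ha using fun s => hsurj (b s)
    choose b' hb' using fun s => hmono (i s) _ (Finset.le_sup (f := i) (Finset.mem_univ s)) (a s)
    exact ⟨_, b', funext fun s => ((hb' s).trans (ha s)).symm⟩
  have hproj : ∀ {Q : Type (max u v w)} [L.Structure Q] [Nonempty Q] (b : Fin m → Q),
      projN '' defSet φ b = defSet (exProj Sum.inl φ) b := fun b =>
    image_comp_defSet Sum.inl_injective φ b
  rw [hproj, isLarge_iff_isZariskiDense ι hK, defSet, isZariskiDense_elementary_iff ι hK] at hl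
  obtain ⟨c, hc⟩ := hnext r n (φ.relabel (Sum.map b' id)) (by
    have h := hproj (Q := (G r).carrier) b'
    simp only [Formula.realize_relabel, Sum.elim_comp_map, Function.id_comp, Function.comp_id]
    rw [defSet, defSet] at h
    rw [h]
    exact hl)
  rw [Formula.realize_relabel, Sum.elim_comp_map, ← (e (r + 1)).emb.map_formula] at hc
  refine ⟨(e (r + 1)).emb ∘ c, ?_⟩
  rw [defSet, Set.mem_ofPred_eq]
  refine (iff_of_eq (congrArg φ.Realize ?_)).1 hc
  funext s
  rcases s with s | s | s
  · exact he r _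
  · rfl
  · exact ((e (r + 1)).comm s.1 (c s.2)).symm

variable (ι K) in
/-- There is a model with derivations extending the given ones. -/
theorem DerModel.exists_extends [CharZero K]
    (η : Fin k → Derivation ℤ (dclRing ι K) (dclRing ι K)) :
    ∃ S : DerModel ι K k, S.Extends η := by
  let M := (Theory.ModelType.of (L.completeTheory K) K).ulift
  obtain ⟨_, _, _⟩ := exists_field_of_model ι K M
  have : CharZero M := charZero_of_model ι K M
  let _ : Algebra (dclRing ι K) M := (dclHom ι M).toAlgebra
  have hind : AlgebraicIndependent (dclRing ι K) (Empty.elim : Empty → M) :=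
    algebraicIndependent_empty_type_iff.2 (dclHom_injective ι)
  choose D hD _ using fun i => exists_derivation_extension hind
    ((Algebra.linearMap (dclRing ι K) M).compDer (η i)) Empty.elim
  exact ⟨⟨M, D⟩, hD⟩

end WideExtension

end NCDer

namespace NCDer

/-! ### nc-Wide implies nc-Deep -/

section Words

variable {k : ℕ}

theorem wordAct_of_mul {X : Type*} (D : Fin k → X → X) (i : Fin k) (γ : FreeMonoid (Fin k))
    (c : X) : wordAct D (FreeMonoid.of i * γ) c = D i (wordAct D γ c) := rfl

theorem eq_one_or_exists_of_mul (γ : FreeMonoid (Fin k)) :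
    γ = 1 ∨ ∃ i μ, γ = FreeMonoid.of i * μ := by
  induction γ using FreeMonoid.inductionOn' with
  | one => exact Or.inl rfl
  | of_mul i μ => exact Or.inr ⟨i, μ, rfl⟩

theorem of_mul_ne (i : Fin k) (γ : FreeMonoid (Fin k)) : FreeMonoid.of i * γ ≠ γ := fun h => by
  simpa [FreeMonoid.length_mul] using congrArg FreeMonoid.length h

theorem of_mul_ne_one (i : Fin k) (γ : FreeMonoid (Fin k)) : FreeMonoid.of i * γ ≠ 1 := fun h => by
  simpa [FreeMonoid.length_mul] using congrArg FreeMonoid.length h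

theorem of_mul_inj {i j : Fin k} {γ μ : FreeMonoid (Fin k)}
    (h : FreeMonoid.of i * γ = FreeMonoid.of j * μ) : i = j ∧ γ = μ := by
  have := congrArg FreeMonoid.toList h
  simpa using this

theorem IsInitial.of_mul_mem {V : Set (FreeMonoid (Fin k))} (hV : IsInitial V) {i : Fin k}
    {γ : FreeMonoid (Fin k)} (h : FreeMonoid.of i * γ ∈ V) : γ ∈ V \ maxWords V :=
  ⟨hV γ _ h ⟨_, rfl⟩, fun hmax => of_mul_ne i γ (hmax.2 _ h ⟨_, rfl⟩)⟩

theorem IsInitial.one_mem {V : Set (FreeMonoid (Fin k))} (hV : IsInitial V) (h : V.Nonempty) :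
    1 ∈ V :=
  let ⟨γ, hγ⟩ := h
  hV 1 γ hγ ⟨γ, (mul_one γ).symm⟩

end Words

section WideDeep

variable {L : FirstOrder.Language.{u, v}} (ι : FirstOrder.Language.ring →ᴸ L)
  {K : Type w} [Field K] [CharZero K] [Ring.CompatibleRing K] [L.Structure K] [ι.IsExpansionOn K]
  {k : ℕ} {M : Type (max u v w)} [Field M] [Ring.CompatibleRing M] [L.Structure M]
  [ι.IsExpansionOn M] [M ⊨ L.completeTheory K]

theorem isLarge_iff_of_definable (hK : AlgebraicallyBoundedOver L (dclRing ι K)) {σ : Type}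
    [Finite σ] {X : Set (σ → M)} (hX : (Set.univ : Set M).Definable L X) :
    IsLarge L X ↔ IsZariskiDense X := by
  obtain ⟨m, φ, b, rfl⟩ := definable_univ_iff.1 hX
  exact isLarge_iff_isZariskiDense ι hK φ b

omit [M ⊨ L.completeTheory K] [Ring.CompatibleRing M] [ι.IsExpansionOn M] in
theorem definable_image_comp {σ τ : Type} [Finite σ] {j : σ → τ} (hj : Function.Injective j)
    {X : Set (τ → M)} (hX : (Set.univ : Set M).Definable L X) :
    (Set.univ : Set M).Definable L ((fun z : τ → M => z ∘ j) '' X) := by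
  obtain ⟨m, φ, b, rfl⟩ := definable_univ_iff.1 hX
  rw [image_comp_defSet hj]
  exact definable_univ_iff.2 ⟨m, _, b, rfl⟩

/-- A problem of nc-Deep is a problem of nc-Wide for the tuple of the non-maximal derivatives,
whose equations force this tuple to consist of the derivatives of its first entry. -/
theorem ncDeep_of_ncWide (hK : AlgebraicallyBoundedOver L (dclRing ι K)) {D : Fin k → M → M}
    (h : NCWide L D) : NCDeep L D := by
  classical
  intro V hV hi Z hZ hl
  have hfin : Finite (V \ maxWords V : Set (FreeMonoid (Fin k))) := hV.subset Set.sdiff_subset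
  have hdense : IsZariskiDense (projF V '' Z) :=
    (isLarge_iff_of_definable ι hK (definable_image_comp (injective_projF V) hZ)).1 hl
  obtain ⟨_, z₀, hz₀, -⟩ := hdense.nonempty
  by_cases h1 : (1 : FreeMonoid (Fin k)) ∈ V \ maxWords V
  · let n := Nat.card (V \ maxWords V : Set (FreeMonoid (Fin k)))
    let e : (V \ maxWords V : Set (FreeMonoid (Fin k))) ≃ Fin n := Finite.equivFin _
    -- the coordinate `s v` of `(c, D₁ c, …, Dₖ c)` is to be the derivative `v` of the entry `1`
    have hs : ∀ v : V, ∃ t : Fin n ⊕ Fin k × Fin n, (v.1 = 1 ∧ t = Sum.inl (e ⟨1, h1⟩)) ∨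
        ∃ i, ∃ γ : (V \ maxWords V : Set (FreeMonoid (Fin k))),
          v.1 = FreeMonoid.of i * γ.1 ∧ t = Sum.inr (i, e γ) := by
      rintro ⟨v, hv⟩
      rcases eq_one_or_exists_of_mul v with rfl | ⟨i, γ, rfl⟩
      · exact ⟨_, Or.inl ⟨rfl, rfl⟩⟩
      · exact ⟨_, Or.inr ⟨i, ⟨γ, hi.of_mul_mem hv⟩, rfl, rfl⟩⟩
    choose s hs using hs
    let inV : (V \ maxWords V : Set (FreeMonoid (Fin k))) → V := fun γ => ⟨γ.1, γ.2.1⟩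
    obtain ⟨φ, rfl⟩ := exists_formula_of_definable hZ
    let ψ : L.Formula (M ⊕ (Fin n ⊕ Fin k × Fin n)) := φ.relabel (Sum.map id s) ⊓
      Formula.iInf fun γ => Term.equal (Term.var (Sum.inr (Sum.inl (e γ))))
        (Term.var (Sum.inr (s (inV γ))))
    have hψ : ∀ z : Fin n ⊕ Fin k × Fin n → M, ψ.Realize (Sum.elim id z) ↔
        φ.Realize (Sum.elim id (z ∘ s)) ∧ ∀ γ, z (Sum.inl (e γ)) = z (s (inV γ)) := by
      intro z
      rw [Formula.realize_inf, Formula.realize_relabel, Sum.elim_comp_map, Formula.realize_iInf]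
      rfl
    have hW := definable_setOf_realize ψ
    obtain ⟨c, hc⟩ := h n _ hW (by
      refine (isLarge_iff_of_definable ι hK (definable_image_comp Sum.inl_injective hW)).2 ?_
      refine isZariskiDense_comp_equiv e (hdense.mono ?_)
      rintro _ ⟨z, hz, rfl⟩
      let full : Fin n ⊕ Fin k × Fin n → M := Sum.elim (fun t => z (inV (e.symm t))) fun p =>
        if hv : FreeMonoid.of p.1 * (e.symm p.2).1 ∈ V then z ⟨_, hv⟩ else 0
      have hfull : ∀ v, full (s v) = z v := by
        rintro ⟨v, hv⟩
        rcases hs ⟨v, hv⟩ with ⟨rfl, ht⟩ | ⟨i, γ, rfl, ht⟩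
        · rw [ht]
          simp [full, inV]
        · rw [ht]
          simp only [full, Sum.elim_inr, Equiv.symm_apply_apply, dif_pos hv]
      refine ⟨full, ?_, rfl⟩
      rw [Set.mem_ofPred_eq, hψ]
      refine ⟨?_, fun γ => ?_⟩
      · rw [show full ∘ s = z from funext hfull]
        exact hz
      · rw [hfull]
        simp [full])
    have hc := (hψ _).1 hc
    refine ⟨c (e ⟨1, h1⟩), ?_⟩
    have key : ∀ (v : FreeMonoid (Fin k)) (hv : v ∈ V), wordAct D v (c (e ⟨1, h1⟩)) =
        Sum.elim c (fun p => D p.1 (c p.2)) (s ⟨v, hv⟩) := by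
      intro v
      induction v using FreeMonoid.inductionOn' with
      | one =>
        intro hv
        rcases hs ⟨1, hv⟩ with ⟨-, ht⟩ | ⟨i, γ, hγ, -⟩
        · rw [ht]; rfl
        · exact absurd hγ.symm (of_mul_ne_one i γ.1)
      | of_mul i γ ih =>
        intro hv
        rcases hs ⟨_, hv⟩ with ⟨h', -⟩ | ⟨j, μ, hμ, ht⟩
        · exact absurd h' (of_mul_ne_one i γ)
        · obtain ⟨rfl, rfl⟩ := of_mul_inj hμ
          rw [ht, wordAct_of_mul, ih μ.2.1, ← hc.2 μ]
          rfl
    rw [Set.mem_ofPred_eq]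
    refine (iff_of_eq (congrArg φ.Realize ?_)).1 hc.1
    congr 1
    funext v
    exact (key v.1 v.2).symm
  · -- here `V` has at most the element `1`
    have hV1 : ∀ v ∈ V, v = 1 := by
      intro v hv
      rcases eq_one_or_exists_of_mul v with rfl | ⟨i, γ, rfl⟩
      · rfl
      · refine absurd ⟨hi.one_mem ⟨_, hv⟩, fun hmax => ?_⟩ h1
        exact of_mul_ne_one i γ (hmax.2 _ hv ⟨_, (mul_one _).symm⟩)
    by_cases hne : (1 : FreeMonoid (Fin k)) ∈ V
    · refine ⟨z₀ ⟨1, hne⟩, ?_⟩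
      convert hz₀ using 1
      funext ⟨v, hv⟩
      obtain rfl := hV1 v hv
      rfl
    · refine ⟨0, ?_⟩
      convert hz₀ using 1
      funext ⟨v, hv⟩
      exact absurd (hV1 v hv ▸ hv) hne

end WideDeep

end NCDer

namespace NCDer

/-! ### Total derivatives -/

section TotalDer

variable {k : ℕ} {N : Type*} [Field N]

/-- A derivation of a polynomial ring can be prescribed on the coefficients and on the variables:
it is a ring homomorphism to the dual numbers. -/
theorem exists_totalDer (D : Derivation ℤ N N) (i : Fin k) :
    ∃ T : Derivation ℤ (MvPolynomial (FreeMonoid (Fin k)) N) (MvPolynomial (FreeMonoid (Fin k)) N),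
      (∀ a, T (MvPolynomial.C a) = MvPolynomial.C (D a)) ∧
        ∀ γ, T (MvPolynomial.X γ) = MvPolynomial.X (FreeMonoid.of i * γ) := by
  let A := MvPolynomial (FreeMonoid (Fin k)) N
  let c : N →+* TrivSqZeroExt A A :=
    { toFun := fun r => TrivSqZeroExt.inl (MvPolynomial.C r) +
        TrivSqZeroExt.inr (MvPolynomial.C (D r))
      map_one' := by ext1 <;> simp
      map_zero' := by ext1 <;> simp
      map_mul' := by
        intro x y
        refine TrivSqZeroExt.ext (by simp) ?_
        simp only [map_mul, Derivation.leibniz, TrivSqZeroExt.snd_add, TrivSqZeroExt.snd_inl,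
          TrivSqZeroExt.snd_inr, TrivSqZeroExt.snd_mul, TrivSqZeroExt.fst_add,
          TrivSqZeroExt.fst_inl, TrivSqZeroExt.fst_inr, map_add, smul_eq_mul,
          MulOpposite.smul_eq_mul_unop, MulOpposite.unop_op]
        ring
      map_add' := by intro x y; ext1 <;> simp }
  let g : A →+* TrivSqZeroExt A A := MvPolynomial.eval₂Hom c fun γ =>
    TrivSqZeroExt.inl (MvPolynomial.X γ) + TrivSqZeroExt.inr (MvPolynomial.X (FreeMonoid.of i * γ))
  have hC : ∀ a, g (MvPolynomial.C a) = TrivSqZeroExt.inl (MvPolynomial.C a) +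
      TrivSqZeroExt.inr (MvPolynomial.C (D a)) := fun a => MvPolynomial.eval₂_C _ _ a
  have hX : ∀ γ, g (MvPolynomial.X γ) = TrivSqZeroExt.inl (MvPolynomial.X γ) +
      TrivSqZeroExt.inr (MvPolynomial.X (FreeMonoid.of i * γ)) := fun γ =>
    MvPolynomial.eval₂_X _ _ γ
  have hfst : ∀ p, (g p).fst = p := by
    intro p
    induction p using MvPolynomial.induction_on with
    | C r => rw [hC, TrivSqZeroExt.fst_add, TrivSqZeroExt.fst_inl, TrivSqZeroExt.fst_inr, add_zero]
    | add p q hp hq => rw [map_add, TrivSqZeroExt.fst_add, hp, hq]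
    | mul_X p i hp =>
      rw [map_mul, TrivSqZeroExt.fst_mul, hp, hX, TrivSqZeroExt.fst_add, TrivSqZeroExt.fst_inl,
        TrivSqZeroExt.fst_inr, add_zero]
  let d : A →+ A := { toFun := fun x => (g x).snd, map_zero' := by simp, map_add' := by simp }
  refine ⟨Derivation.mk' d.toIntLinearMap ?_, fun a => ?_, fun γ => ?_⟩
  · intro x y
    simp [d, hfst, mul_comm y]
  · change (g (MvPolynomial.C a)).snd = _
    rw [hC, TrivSqZeroExt.snd_add, TrivSqZeroExt.snd_inl, TrivSqZeroExt.snd_inr, zero_add]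
  · change (g (MvPolynomial.X γ)).snd = _
    rw [hX, TrivSqZeroExt.snd_add, TrivSqZeroExt.snd_inl, TrivSqZeroExt.snd_inr, zero_add]

/-- The derivation of `N[X_γ : γ ∈ Γ]` which extends `D` and maps `X_γ` to `X_{iγ}`. -/
noncomputable def totalDer (D : Derivation ℤ N N) (i : Fin k) :
    Derivation ℤ (MvPolynomial (FreeMonoid (Fin k)) N) (MvPolynomial (FreeMonoid (Fin k)) N) :=
  (exists_totalDer D i).choose

theorem totalDer_C (D : Derivation ℤ N N) (i : Fin k) (a : N) :
    totalDer D i (MvPolynomial.C a) = MvPolynomial.C (D a) :=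
  (exists_totalDer D i).choose_spec.1 a

theorem totalDer_X (D : Derivation ℤ N N) (i : Fin k) (γ : FreeMonoid (Fin k)) :
    totalDer D i (MvPolynomial.X γ) = MvPolynomial.X (FreeMonoid.of i * γ) :=
  (exists_totalDer D i).choose_spec.2 γ

/-- The chain rule for the derivatives of an element. -/
theorem eval₂_totalDer {N' : Type*} [Field N'] (e : N →+* N') (D : Fin k → Derivation ℤ N N)
    (D' : Fin k → Derivation ℤ N' N') (he : ∀ i a, D' i (e a) = e (D i a)) (i : Fin k) (c : N')
    (q : MvPolynomial (FreeMonoid (Fin k)) N) :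
    MvPolynomial.eval₂ e (fun γ => wordAct (fun i => D' i) γ c) (totalDer (D i) i q) =
      D' i (MvPolynomial.eval₂ e (fun γ => wordAct (fun i => D' i) γ c) q) := by
  induction q using MvPolynomial.induction_on with
  | C r => rw [totalDer_C, MvPolynomial.eval₂_C, MvPolynomial.eval₂_C, he]
  | add p q hp hq => rw [map_add, MvPolynomial.eval₂_add, hp, hq, MvPolynomial.eval₂_add, map_add]
  | mul_X p γ hp =>
    rw [Derivation.leibniz, totalDer_X, MvPolynomial.eval₂_add, smul_eq_mul, smul_eq_mul,
      MvPolynomial.eval₂_mul, MvPolynomial.eval₂_mul, hp, MvPolynomial.eval₂_mul,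
      Derivation.leibniz, MvPolynomial.eval₂_X, MvPolynomial.eval₂_X, smul_eq_mul, smul_eq_mul,
      wordAct_of_mul]

/-- The commutator of a partial derivative and a total derivative. -/
theorem pderiv_totalDer (D : Derivation ℤ N N) (i : Fin k) (γ : FreeMonoid (Fin k))
    (q : MvPolynomial (FreeMonoid (Fin k)) N) :
    MvPolynomial.pderiv (FreeMonoid.of i * γ) (totalDer D i q) =
      totalDer D i (MvPolynomial.pderiv (FreeMonoid.of i * γ) q) + MvPolynomial.pderiv γ q := by
  classical
  induction q using MvPolynomial.induction_on with
  | C r => simp [totalDer_C]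
  | add p q hp hq => simp only [map_add, hp, hq]; ring
  | mul_X p μ hp =>
    have h1 : totalDer D i (MvPolynomial.pderiv (FreeMonoid.of i * γ)
        (MvPolynomial.X μ : MvPolynomial (FreeMonoid (Fin k)) N)) = 0 := by
      rw [MvPolynomial.pderiv_X]
      by_cases h : FreeMonoid.of i * γ = μ
      · subst h; simp
      · rw [Pi.single_eq_of_ne (Ne.symm h), map_zero]
    have h2 : MvPolynomial.pderiv (FreeMonoid.of i * γ)
        (MvPolynomial.X (FreeMonoid.of i * μ) : MvPolynomial (FreeMonoid (Fin k)) N) =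
          MvPolynomial.pderiv γ (MvPolynomial.X μ) := by
      rw [MvPolynomial.pderiv_X, MvPolynomial.pderiv_X]
      by_cases h : μ = γ
      · subst h; simp
      · rw [Pi.single_eq_of_ne h, Pi.single_eq_of_ne fun h' => h (of_mul_inj h').2]
    simp only [Derivation.leibniz, map_add, totalDer_X, hp, h1, h2, smul_eq_mul, mul_zero]
    ring

end TotalDer

section Rank

variable {k : ℕ}

/-- An enumeration of the words, compatible with left multiplication by the generators. -/
def wordCode (γ : FreeMonoid (Fin k)) : ℕ :=
  γ.toList.foldr (fun i n => k * n + i + 1) 0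

theorem wordCode_one : wordCode (1 : FreeMonoid (Fin k)) = 0 := rfl

theorem wordCode_of_mul (i : Fin k) (γ : FreeMonoid (Fin k)) :
    wordCode (FreeMonoid.of i * γ) = k * wordCode γ + i + 1 := rfl

theorem wordCode_lt (i : Fin k) (γ : FreeMonoid (Fin k)) :
    wordCode γ < wordCode (FreeMonoid.of i * γ) := by
  rw [wordCode_of_mul]
  have := i.2
  nlinarith [Nat.zero_le (wordCode γ), Nat.one_le_iff_ne_zero.2 (by omega : k ≠ 0)]

theorem wordCode_mul_lt (i : Fin k) {γ μ : FreeMonoid (Fin k)} (h : wordCode γ < wordCode μ) :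
    wordCode (FreeMonoid.of i * γ) < wordCode (FreeMonoid.of i * μ) := by
  rw [wordCode_of_mul, wordCode_of_mul]
  have := i.2
  have := Nat.mul_lt_mul_of_pos_left h (by omega : 0 < k)
  omega

theorem wordCode_injective : Function.Injective (wordCode (k := k)) := by
  intro γ
  induction γ using FreeMonoid.inductionOn' with
  | one =>
    intro μ h
    rcases eq_one_or_exists_of_mul μ with rfl | ⟨j, μ, rfl⟩
    · rfl
    · rw [wordCode_one, wordCode_of_mul] at h; omega
  | of_mul i γ ih =>
    intro μ h
    rcases eq_one_or_exists_of_mul μ with rfl | ⟨j, μ, rfl⟩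
    · rw [wordCode_one, wordCode_of_mul] at h; omega
    · rw [wordCode_of_mul, wordCode_of_mul] at h
      have hi := i.2
      have hj := j.2
      have h' : (i + k * wordCode γ : ℕ) = j + k * wordCode μ := by omega
      have h1 := congrArg (· % k) h'
      simp only [Nat.add_mul_mod_self_left, Nat.mod_eq_of_lt hi, Nat.mod_eq_of_lt hj] at h1
      have h2 : k * wordCode γ = k * wordCode μ := by omega
      rw [Fin.ext h1, ih (Nat.eq_of_mul_eq_mul_left (by omega) h2)]

variable {N : Type*} [Field N]

/-- The polynomials in the variables `X_μ` with `wordCode μ < n`. -/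
noncomputable def polyBelow (k : ℕ) (N : Type*) [Field N] (n : ℕ) :
    Subalgebra N (MvPolynomial (FreeMonoid (Fin k)) N) :=
  MvPolynomial.supported N {μ | wordCode μ < n}

theorem polyBelow_mono {m n : ℕ} (h : m ≤ n) : polyBelow k N m ≤ polyBelow k N n :=
  MvPolynomial.supported_mono fun _ hμ => lt_of_lt_of_le hμ h

theorem X_mem_polyBelow {μ : FreeMonoid (Fin k)} {n : ℕ} (h : wordCode μ < n) :
    (MvPolynomial.X μ : MvPolynomial (FreeMonoid (Fin k)) N) ∈ polyBelow k N n :=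
  Algebra.subset_adjoin ⟨μ, h, rfl⟩

theorem eval_congr_of_mem_polyBelow {n : ℕ} {q : MvPolynomial (FreeMonoid (Fin k)) N}
    (hq : q ∈ polyBelow k N n) {z z' : FreeMonoid (Fin k) → N}
    (h : ∀ μ, wordCode μ < n → z μ = z' μ) : MvPolynomial.eval z q = MvPolynomial.eval z' q := by
  refine MvPolynomial.eval₂Hom_congr' rfl (fun i hi _ => h i ?_) rfl
  exact MvPolynomial.mem_supported.1 hq hi

theorem pderiv_eq_zero_of_mem_polyBelow {n : ℕ} {q : MvPolynomial (FreeMonoid (Fin k)) N}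
    (hq : q ∈ polyBelow k N n) {γ : FreeMonoid (Fin k)} (h : n ≤ wordCode γ) :
    MvPolynomial.pderiv γ q = 0 :=
  MvPolynomial.pderiv_eq_zero_of_notMem_vars fun hγ =>
    absurd (MvPolynomial.mem_supported.1 hq hγ : wordCode γ < n) (not_lt.2 h)

theorem pderiv_mem_polyBelow {n : ℕ} {q : MvPolynomial (FreeMonoid (Fin k)) N}
    (hq : q ∈ polyBelow k N n) (γ : FreeMonoid (Fin k)) :
    MvPolynomial.pderiv γ q ∈ polyBelow k N n := by
  classical
  refine Algebra.adjoin_induction (p := fun q _ => MvPolynomial.pderiv γ q ∈ polyBelow k N n)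
    ?_ ?_ ?_ ?_ hq
  · rintro _ ⟨μ, -, rfl⟩
    rw [MvPolynomial.pderiv_X]
    by_cases h : μ = γ
    · subst h; simp
    · rw [Pi.single_eq_of_ne h]; exact zero_mem _
  · intro r
    rw [Derivation.map_algebraMap]
    exact zero_mem _
  · intro p q _ _ hp hq
    rw [map_add]
    exact add_mem hp hq
  · intro p q hp' hq' hp hq
    rw [Derivation.leibniz]
    exact add_mem (mul_mem hp' hq) (mul_mem hq' hp)

/-- The total derivative of a polynomial of leading variable `X_μ` is of degree one in
`X_{iμ}`. -/
theorem totalDer_sub_mem_polyBelow (D : Derivation ℤ N N) (i : Fin k) {μ : FreeMonoid (Fin k)}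
    {q : MvPolynomial (FreeMonoid (Fin k)) N} (hq : q ∈ polyBelow k N (wordCode μ + 1)) :
    totalDer D i q - MvPolynomial.pderiv μ q * MvPolynomial.X (FreeMonoid.of i * μ) ∈
      polyBelow k N (wordCode (FreeMonoid.of i * μ)) := by
  classical
  have hle := polyBelow_mono (k := k) (N := N) (wordCode_lt i μ)
  refine Algebra.adjoin_induction (p := fun q _ => totalDer D i q - MvPolynomial.pderiv μ q *
    MvPolynomial.X (FreeMonoid.of i * μ) ∈ polyBelow k N (wordCode (FreeMonoid.of i * μ)))
    ?_ ?_ ?_ ?_ hq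
  · rintro _ ⟨ν, hν, rfl⟩
    rw [totalDer_X, MvPolynomial.pderiv_X]
    by_cases h : ν = μ
    · subst h; simp
    · rw [Pi.single_eq_of_ne h, zero_mul, sub_zero]
      refine X_mem_polyBelow (wordCode_mul_lt i ?_)
      exact lt_of_le_of_ne (Nat.lt_succ_iff.1 hν) fun h' => h (wordCode_injective h')
  · intro r
    rw [Derivation.map_algebraMap, zero_mul, sub_zero, MvPolynomial.algebraMap_eq, totalDer_C]
    exact Subalgebra.algebraMap_mem _ (D r)
  · intro p q _ _ hp hq
    have := add_mem hp hq
    convert this using 1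
    rw [map_add, map_add]
    ring
  · intro p q hp' hq' hp hq
    have := add_mem (mul_mem (hle hp') hq) (mul_mem (hle hq') hp)
    convert this using 1
    rw [Derivation.leibniz, Derivation.leibniz]
    simp only [smul_eq_mul]
    ring

theorem totalDer_mem_polyBelow (D : Derivation ℤ N N) (i : Fin k) {μ : FreeMonoid (Fin k)}
    {q : MvPolynomial (FreeMonoid (Fin k)) N} (hq : q ∈ polyBelow k N (wordCode μ + 1)) :
    totalDer D i q ∈ polyBelow k N (wordCode (FreeMonoid.of i * μ) + 1) := by
  have h := add_mem (polyBelow_mono (Nat.le_succ _) (totalDer_sub_mem_polyBelow D i hq))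
    (mul_mem (polyBelow_mono (wordCode_lt i μ |>.trans_le (Nat.le_succ _))
      (pderiv_mem_polyBelow hq μ)) (X_mem_polyBelow (Nat.lt_succ_self _)))
  rwa [sub_add_cancel] at h

end Rank

end NCDer

namespace NCDer

/-! ### Reflecting the derivatives of an element of an extension -/

section Generic

variable {L : FirstOrder.Language.{u, v}} (ι : FirstOrder.Language.ring →ᴸ L)
  {K : Type w} [Field K] [CharZero K] [Ring.CompatibleRing K] [L.Structure K] [ι.IsExpansionOn K]

/-- A definable set is Zariski dense if it has, in an elementary extension, a point which is
algebraically independent over the small model. -/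
theorem isZariskiDense_of_generic (hK : AlgebraicallyBoundedOver L (dclRing ι K)) {α σ : Type*}
    [Finite σ] (φ : L.Formula (α ⊕ σ)) {M N : Type x} [Field M] [Ring.CompatibleRing M]
    [L.Structure M] [ι.IsExpansionOn M] [M ⊨ L.completeTheory K] [Field N] [Ring.CompatibleRing N]
    [L.Structure N] [ι.IsExpansionOn N] [N ⊨ L.completeTheory K] (f : M ↪ₑ[L] N) (b : α → M)
    {a : σ → N} (ha : ∀ p : MvPolynomial σ M, MvPolynomial.eval₂ (embHom ι f) a p = 0 → p = 0)
    (h : φ.Realize (Sum.elim (f ∘ b) a)) : IsZariskiDense {z | φ.Realize (Sum.elim b z)} := by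
  rw [← isZariskiDense_elementary_iff ι hK φ f]
  obtain ⟨P, hP⟩ := exists_bounds.{u, v, w, x} ι hK φ
  refine (hP N (f ∘ b)).resolve_right ?_
  rintro ⟨p, -, ⟨z, hz⟩, hp⟩
  have hq : ∀ z : σ → N, MvPolynomial.eval₂ (embHom ι f) z (specialize (dclHom ι M) b p) =
      MvPolynomial.eval₂ (dclHom ι N) (Sum.elim (f ∘ b) z) p := by
    intro z
    rw [← MvPolynomial.coe_eval₂Hom, ← MvPolynomial.coe_eval₂Hom, ← RingHom.comp_apply]
    congr 1
    refine MvPolynomial.ringHom_ext (fun r => ?_) fun i => ?_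
    · simp only [specialize, RingHom.comp_apply, MvPolynomial.eval₂Hom_C]
      exact map_dclMap ι f r
    · rcases i with i | i <;> simp [specialize]
  have h0 := ha _ ((hq a).trans (hp a h))
  apply hz
  rw [← hq, h0, MvPolynomial.eval₂_zero]

end Generic

section Jets

variable {k : ℕ} {N N' : Type*} [Field N] [CharZero N] [Field N']

theorem pderiv_ne_zero_of_mem_vars {σ : Type*} {p : MvPolynomial σ N} {i : σ} (hi : i ∈ p.vars) :
    MvPolynomial.pderiv i p ≠ 0 := by
  classical
  obtain ⟨d, hd, hid⟩ := (MvPolynomial.mem_vars_iff_mem_support i).1 hi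
  have hdi : d i ≠ 0 := Finsupp.mem_support_iff.1 hid
  intro h
  have h1 := MvPolynomial.coeff_pderiv (i := i) p (d - Finsupp.single i 1)
  have h2 : d - Finsupp.single i 1 + Finsupp.single i 1 = d :=
    tsub_add_cancel_of_le (Finsupp.single_le_iff.2 (Nat.one_le_iff_ne_zero.2 hdi))
  rw [h, h2, MvPolynomial.coeff_zero] at h1
  rcases mul_eq_zero.1 h1.symm with h1 | h1
  · exact MvPolynomial.mem_support_iff.1 hd h1
  · exact Nat.cast_add_one_ne_zero _ h1

omit [CharZero N] in
theorem totalDegree_pderiv_lt {σ : Type*} {p : MvPolynomial σ N} {i : σ}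
    (h : MvPolynomial.pderiv i p ≠ 0) :
    (MvPolynomial.pderiv i p).totalDegree < p.totalDegree := by
  classical
  have hle : ∀ d ∈ (MvPolynomial.pderiv i p).support, (d.sum fun _ e => e) < p.totalDegree := by
    intro d hd
    rw [MvPolynomial.mem_support_iff, MvPolynomial.coeff_pderiv] at hd
    have := MvPolynomial.le_totalDegree (MvPolynomial.mem_support_iff.2 (left_ne_zero_of_mul hd))
    rw [Finsupp.sum_add_index' (fun _ => rfl) (fun _ _ _ => rfl), Finsupp.sum_single_index rfl]
      at this
    omega
  rw [MvPolynomial.totalDegree, Finset.sup_lt_iff]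
  · exact hle
  · obtain ⟨d, hd⟩ := MvPolynomial.support_nonempty.2 h
    exact lt_of_le_of_lt (Nat.zero_le _) (hle d hd)

omit [CharZero N] in
theorem vars_pderiv_subset {σ : Type*} (i : σ) (p : MvPolynomial σ N) :
    (MvPolynomial.pderiv i p).vars ⊆ p.vars := by
  classical
  intro j hj
  obtain ⟨d, hd, hjd⟩ := (MvPolynomial.mem_vars_iff_mem_support j).1 hj
  rw [MvPolynomial.mem_support_iff, MvPolynomial.coeff_pderiv] at hd
  refine (MvPolynomial.mem_vars_iff_mem_support j).2
    ⟨_, MvPolynomial.mem_support_iff.2 (left_ne_zero_of_mul hd), ?_⟩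
  rw [Finsupp.mem_support_iff, Finsupp.add_apply] at *
  omega

/-- The coordinate `γ` of the tuple `J` is a simple root of a polynomial with coefficients in `N`
and in the earlier coordinates. -/
def IsDependent (e : N →+* N') (J : FreeMonoid (Fin k) → N') (γ : FreeMonoid (Fin k)) : Prop :=
  ∃ q ∈ polyBelow k N (wordCode γ + 1),
    MvPolynomial.eval₂ e J q = 0 ∧ MvPolynomial.eval₂ e J (MvPolynomial.pderiv γ q) ≠ 0

/-- The coordinates which are not dependent on the earlier ones are algebraically independent: in
a relation of minimal degree, the last coordinate is a simple root. -/
theorem eq_zero_of_eval₂_eq_zero (e : N →+* N') (J : FreeMonoid (Fin k) → N')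
    {p : MvPolynomial (FreeMonoid (Fin k)) N} (hp : ∀ γ ∈ p.vars, ¬ IsDependent e J γ)
    (h : MvPolynomial.eval₂ e J p = 0) : p = 0 := by
  classical
  induction hn : p.totalDegree using Nat.strong_induction_on generalizing p with
  | _ n ih =>
    rcases p.vars.eq_empty_or_nonempty with hv | hv
    · rw [MvPolynomial.vars_eq_empty_iff_eq_C] at hv
      rw [hv, MvPolynomial.eval₂_C] at h
      rw [hv, (map_eq_zero e).1 h, map_zero]
    · obtain ⟨γ, hγ, hmax⟩ := p.vars.exists_max_image wordCode hv
      have hmem : p ∈ polyBelow k N (wordCode γ + 1) :=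
        MvPolynomial.mem_supported.2 fun μ hμ => Nat.lt_succ_of_le (hmax μ hμ)
      have hne := pderiv_ne_zero_of_mem_vars hγ
      refine absurd (ih _ (hn ▸ totalDegree_pderiv_lt hne) (fun μ hμ => hp μ ?_) ?_ rfl) hne
      · exact vars_pderiv_subset γ p hμ
      · by_contra h'
        exact hp γ hγ ⟨p, hmem, h, h'⟩

omit [CharZero N] in
/-- The dependent coordinates of the derivatives of an element are closed under derivation. -/
theorem IsDependent.of_mul {e : N →+* N'} {D : Fin k → Derivation ℤ N N}
    {D' : Fin k → Derivation ℤ N' N'} (he : ∀ i a, D' i (e a) = e (D i a)) {d : N'}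
    {γ : FreeMonoid (Fin k)} (h : IsDependent e (fun γ => wordAct (fun i => D' i) γ d) γ)
    (i : Fin k) :
    IsDependent e (fun γ => wordAct (fun i => D' i) γ d) (FreeMonoid.of i * γ) := by
  obtain ⟨q, hq, h0, h1⟩ := h
  refine ⟨totalDer (D i) i q, totalDer_mem_polyBelow (D i) i hq, ?_, ?_⟩
  · rw [eval₂_totalDer e D D' he, h0, map_zero]
  · rw [pderiv_totalDer, pderiv_eq_zero_of_mem_polyBelow hq (wordCode_lt i γ), map_zero, zero_add]
    exact h1

end Jets

section Reflect

variable {L : FirstOrder.Language.{u, v}} (ι : FirstOrder.Language.ring →ᴸ L)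
  {K : Type w} [Field K] [CharZero K] [Ring.CompatibleRing K] [L.Structure K] [ι.IsExpansionOn K]
  {k : ℕ}

/-- In a model of nc-Deep, a formula satisfied by the derivatives of an element of an extension,
elementary in the language `L`, is satisfied by the derivatives of an element of the model.

The derivatives which do not depend on the earlier ones are free, so the problem can be stated in
terms of them and of their first derivatives; the other derivatives are then forced by the
equations expressing their dependence, and the total derivatives of these equations. -/
theorem DerModel.Hom.exists_of_ncDeep (hK : AlgebraicallyBoundedOver L (dclRing ι K))
    {S S' : DerModel ι K k} (f : S.Hom S') (hS : NCDeep L fun i => ⇑(S.der i))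
    (ψ : L.Formula (S.carrier ⊕ FreeMonoid (Fin k))) (d : S'.carrier)
    (hd : ψ.Realize (Sum.elim f.emb fun γ => wordAct (fun i => S'.der i) γ d)) :
    ∃ c : S.carrier, ψ.Realize (Sum.elim id fun γ => wordAct (fun i => S.der i) γ c) := by
  classical
  have : CharZero S.carrier := charZero_of_model ι K S.carrier
  let N := S.carrier
  let J : FreeMonoid (Fin k) → S'.carrier := fun γ => wordAct (fun i => S'.der i) γ d
  let e : S.carrier →+* S'.carrier := embHom ι f.emb
  have he : ∀ i a, S'.der i (e a) = e (S.der i a) := f.comm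
  obtain ⟨R, hR⟩ : ∃ R, ∀ γ ∈ varsR ψ, wordCode γ < R + 1 := by
    obtain ⟨R, hR⟩ := ((finite_varsR ψ).image wordCode).bddAbove
    exact ⟨R, fun γ hγ => Nat.lt_succ_of_le (hR ⟨γ, hγ, rfl⟩)⟩
  let V : Set (FreeMonoid (Fin k)) := {γ | wordCode γ < R + 1}
  have hVfin : V.Finite := (Set.finite_lt_nat (R + 1)).preimage wordCode_injective.injOn
  let Dep : Set (FreeMonoid (Fin k)) := {γ | γ ∈ V ∧ IsDependent e J γ}
  have hDepfin : Finite Dep := hVfin.subset fun _ h => h.1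
  choose q hq hq0 hq1 using fun γ : Dep => γ.2.2
  -- the equation `q γ` of a dependent derivative `γ` and its total derivatives are added to `ψ`
  let Ψ : L.Formula (S.carrier ⊕ FreeMonoid (Fin k)) := ψ ⊓ Formula.iInf fun γ : Dep =>
    (polyZero ι (q γ) ⊓ ∼(polyZero ι (MvPolynomial.pderiv γ.1 (q γ)))) ⊓
      Formula.iInf fun i : Fin k => polyZero ι (totalDer (S.der i) i (q γ))
  have hΨ : ∀ {Q : Type (max u v w)} [Field Q] [Ring.CompatibleRing Q] [L.Structure Q]
      [ι.IsExpansionOn Q] (g : S.carrier →+* Q) (z : FreeMonoid (Fin k) → Q),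
      Ψ.Realize (Sum.elim g z) ↔ ψ.Realize (Sum.elim g z) ∧ ∀ γ : Dep,
        (MvPolynomial.eval₂ g z (q γ) = 0 ∧
          MvPolynomial.eval₂ g z (MvPolynomial.pderiv γ.1 (q γ)) ≠ 0) ∧
        ∀ i, MvPolynomial.eval₂ g z (totalDer (S.der i) i (q γ)) = 0 := by
    intro Q _ _ _ _ g z
    simp only [Ψ, Formula.realize_inf, Formula.realize_iInf, Formula.realize_not, realize_polyZero]
  have hJ : Ψ.Realize (Sum.elim e J) := (hΨ e J).2 ⟨hd, fun γ => ⟨⟨hq0 γ, hq1 γ⟩, fun i => by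
    rw [eval₂_totalDer e S.der S'.der he]
    exact (congrArg _ (hq0 γ)).trans (map_zero _)⟩⟩
  -- the coordinates prescribed by the axiom: `1`, and the derivatives of the free coordinates
  let V₁ : Set (FreeMonoid (Fin k)) := {γ | γ ∈ V ∧ (γ = 1 ∨ ∃ i μ, γ = FreeMonoid.of i * μ ∧
    ¬ IsDependent e J μ)}
  have hstep : ∀ i γ, FreeMonoid.of i * γ ∈ V₁ → γ ∈ V₁ ∧ ¬ IsDependent e J γ := by
    rintro i γ ⟨hV, h | ⟨j, μ, h, hμ⟩⟩
    · exact absurd h (of_mul_ne_one i γ)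
    · obtain ⟨rfl, rfl⟩ := of_mul_inj h
      refine ⟨⟨(wordCode_lt i γ).trans hV, ?_⟩, hμ⟩
      rcases eq_one_or_exists_of_mul γ with rfl | ⟨j, ν, rfl⟩
      · exact Or.inl rfl
      · exact Or.inr ⟨j, ν, rfl, fun hν => hμ (hν.of_mul he j)⟩
  have hV₁ : IsInitial V₁ := by
    rintro β _ hγ ⟨α, rfl⟩
    induction α using FreeMonoid.inductionOn' with
    | one => rwa [one_mul] at hγ
    | of_mul i α ih => exact ih (hstep i _ (by rwa [mul_assoc] at hγ)).1
  have hV₁fin : V₁.Finite := hVfin.subset fun _ h => h.1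
  have : Finite V₁ := hV₁fin
  have hG : ∀ γ ∈ V₁ \ maxWords V₁, ¬ IsDependent e J γ := by
    rintro γ ⟨hγ, hmax⟩
    obtain ⟨_, hμ, ⟨α, rfl⟩, hne⟩ : ∃ μ ∈ V₁, WordLE γ μ ∧ μ ≠ γ := by
      by_contra hcon
      push Not at hcon
      exact hmax ⟨hγ, hcon⟩
    induction α using FreeMonoid.inductionOn' with
    | one => exact absurd (one_mul γ) hne
    | of_mul i α ih =>
      rw [mul_assoc] at hμ
      have := hstep i _ hμ
      by_cases h : α * γ = γ
      · rw [h] at this; exact this.2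
      · exact ih this.1 h
  have : Finite (V₁ \ maxWords V₁ : Set (FreeMonoid (Fin k))) := hV₁fin.subset Set.sdiff_subset
  let j₀ : (V₁ \ maxWords V₁ : Set (FreeMonoid (Fin k))) → FreeMonoid (Fin k) := Subtype.val
  have hdense : IsZariskiDense {x : (V₁ \ maxWords V₁ : Set (FreeMonoid (Fin k))) → S.carrier |
      (exProj j₀ Ψ).Realize (Sum.elim id x)} := by
    refine isZariskiDense_of_generic ι hK _ f.emb id (a := J ∘ j₀) (fun p hp => ?_)
      ((realize_exProj Subtype.val_injective Ψ).2 ⟨J, rfl, hJ⟩)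
    refine (map_eq_zero_iff _ (MvPolynomial.rename_injective j₀ Subtype.val_injective)).1
      (eq_zero_of_eval₂_eq_zero e J (fun γ hγ => ?_) (by rwa [MvPolynomial.eval₂_rename]))
    obtain ⟨μ, -, rfl⟩ := Finset.mem_image.1 (MvPolynomial.vars_rename j₀ p hγ)
    exact hG μ.1 μ.2
  let j₁ : V₁ → FreeMonoid (Fin k) := Subtype.val
  have hZ := definable_setOf_realize (L := L) (exProj j₁ Ψ)
  obtain ⟨c, hc⟩ := hS V₁ hV₁fin hV₁ _ hZ (by
    refine (isLarge_iff_of_definable ι hK (definable_image_comp (injective_projF V₁) hZ)).2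
      (hdense.mono fun x hx => ?_)
    obtain ⟨z, rfl, hz⟩ := (realize_exProj Subtype.val_injective Ψ).1 hx
    exact ⟨z ∘ j₁, (realize_exProj Subtype.val_injective Ψ).2 ⟨z, rfl, hz⟩, rfl⟩)
  obtain ⟨z, hzc, hz⟩ := (realize_exProj Subtype.val_injective Ψ).1 hc
  obtain ⟨hzψ, hzq⟩ := (hΨ (RingHom.id S.carrier) z).1 hz
  let Jc : FreeMonoid (Fin k) → S.carrier := fun γ => wordAct (fun i => S.der i) γ c
  have hzV₁ : ∀ γ ∈ V₁, z γ = Jc γ := fun γ hγ => congrFun hzc ⟨γ, hγ⟩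
  -- the remaining coordinates are forced
  have key : ∀ n γ, wordCode γ = n → γ ∈ V → z γ = Jc γ := by
    intro n
    induction n using Nat.strong_induction_on with
    | _ n ih =>
      rintro γ rfl hγ
      by_cases hγ₁ : γ ∈ V₁
      · exact hzV₁ γ hγ₁
      rcases eq_one_or_exists_of_mul γ with rfl | ⟨i, μ, rfl⟩
      · exact absurd ⟨hγ, Or.inl rfl⟩ hγ₁
      have hμ : IsDependent e J μ := by
        by_contra h
        exact hγ₁ ⟨hγ, Or.inr ⟨i, μ, rfl, h⟩⟩
      let μ' : Dep := ⟨μ, (wordCode_lt i μ).trans hγ, hμ⟩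
      have hagree : ∀ ν, wordCode ν < wordCode (FreeMonoid.of i * μ) → z ν = Jc ν := fun ν hν =>
        ih _ hν ν rfl (hν.trans hγ)
      obtain ⟨⟨h0, h1⟩, h2⟩ := hzq μ'
      change MvPolynomial.eval z _ = 0 at h0
      change MvPolynomial.eval z _ ≠ 0 at h1
      have h2 : MvPolynomial.eval z (totalDer (S.der i) i (q μ')) = 0 := h2 i
      have hmem := hq μ'
      have hle : wordCode μ + 1 ≤ wordCode (FreeMonoid.of i * μ) := wordCode_lt i μ
      have h0c : MvPolynomial.eval Jc (q μ') = 0 := by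
        rw [← eval_congr_of_mem_polyBelow (polyBelow_mono hle hmem) hagree]
        exact h0
      have h2c : MvPolynomial.eval Jc (totalDer (S.der i) i (q μ')) = 0 := by
        have := eval₂_totalDer (RingHom.id S.carrier) S.der S.der (fun _ _ => rfl) i c (q μ')
        exact this.trans ((congrArg _ h0c).trans (map_zero _))
      -- the total derivative of `q μ` determines `X_{iμ}`, as it is of degree one in it
      have h3 := eval_congr_of_mem_polyBelow (totalDer_sub_mem_polyBelow (S.der i) i hmem) hagree
      have h4 := eval_congr_of_mem_polyBelow
        (polyBelow_mono hle (pderiv_mem_polyBelow hmem μ)) hagree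
      simp only [map_sub, map_mul, MvPolynomial.eval_X] at h3
      rw [h2, h2c, ← h4, zero_sub, zero_sub, neg_inj] at h3
      exact mul_left_cancel₀ h1 h3
  refine ⟨c, (realize_congr ?_).1 hzψ⟩
  rintro (a | γ) h
  · rfl
  · exact key _ γ rfl (hR γ h)

end Reflect

end NCDer

namespace NCDer

/-! ### Amalgamation -/

section CommSubfield

variable {M N : Type*} [Field M] [Field N]

/-- The subfield of the elements at which a homomorphism commutes with given derivations. -/
def commSubfield (e : M →+* N) (D : Derivation ℤ M M) (D' : Derivation ℤ N N) : Subfield M where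
  carrier := {z | D' (e z) = e (D z)}
  mul_mem' {z t} hz ht := by
    rw [Set.mem_ofPred_eq] at hz ht ⊢
    rw [map_mul, Derivation.leibniz, Derivation.leibniz, hz, ht]
    simp only [smul_eq_mul, map_add, map_mul]
  one_mem' := by simp
  add_mem' {z t} hz ht := by
    rw [Set.mem_ofPred_eq] at hz ht ⊢
    rw [map_add, map_add, map_add, map_add, hz, ht]
  zero_mem' := by simp
  neg_mem' {z} hz := by
    rw [Set.mem_ofPred_eq] at hz ⊢
    rw [map_neg, map_neg, map_neg, map_neg, hz]
  inv_mem' z hz := by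
    rw [Set.mem_ofPred_eq] at hz ⊢
    rw [map_inv₀, Derivation.leibniz_inv, Derivation.leibniz_inv, hz]
    simp only [smul_eq_mul, map_mul, map_neg, map_pow, map_inv₀]

/-- The field `commSubfield` is algebraically closed in a field of characteristic zero. -/
theorem mem_commSubfield_of_isAlgebraic [CharZero M] {e : M →+* N} {D : Derivation ℤ M M}
    {D' : Derivation ℤ N N} {z : M} (hz : IsAlgebraic (commSubfield e D D') z) :
    z ∈ commSubfield e D D' := by
  let _ : Algebra M N := e.toAlgebra
  let d : M →ₗ[commSubfield e D D'] N :=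
    { toFun := fun z => D' (e z) - e (D z)
      map_add' := fun z t => by simp only [map_add]; ring
      map_smul' := fun c z => by
        have hc : D' (e c) = e (D c) := c.2
        change D' (e (c * z)) - e (D (c * z)) = e c * (D' (e z) - e (D z))
        rw [map_mul, Derivation.leibniz, Derivation.leibniz, hc]
        simp only [smul_eq_mul, map_add, map_mul]
        ring }
  let Δ : Derivation (commSubfield e D D') M N := Derivation.mk' d fun z t => by
    change D' (e (z * t)) - e (D (z * t)) =
      e z * (D' (e t) - e (D t)) + e t * (D' (e z) - e (D z))
    rw [map_mul, Derivation.leibniz, Derivation.leibniz]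
    simp only [smul_eq_mul, map_add, map_mul]
    ring
  exact sub_eq_zero.1 (derivation_eq_zero_of_isAlgebraic Δ hz)

end CommSubfield

section Amalgamation

variable {L : FirstOrder.Language.{u, v}} (ι : FirstOrder.Language.ring →ᴸ L)
  {K : Type w} [Field K] [CharZero K] [Ring.CompatibleRing K] [L.Structure K] [ι.IsExpansionOn K]
  {k : ℕ}

/-- Two models with derivations can be amalgamated over tuples closed under the derivations which
have the same type in the language `L`.

The first model is embedded in an elementary extension of the second one in such a way that a
transcendence basis over the field generated by the tuple is mapped to a family which is
algebraically independent over the second model; the derivations are then prescribed on this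
family. -/
theorem DerModel.exists_amalgam (hK : AlgebraicallyBoundedOver L (dclRing ι K))
    {η : Fin k → Derivation ℤ (dclRing ι K) (dclRing ι K)} {S S' : DerModel ι K k}
    (hS : S.Extends η) (hS' : S'.Extends η) {τ : Type y} (a : τ → S.carrier) (b : τ → S'.carrier)
    (hD : ∀ i t, ∃ t', S.der i (a t) = a t' ∧ S'.der i (b t) = b t')
    (htp : ∀ φ : L.Formula τ, φ.Realize a → φ.Realize b) :
    ∃ (S'' : DerModel ι K k) (f : S.Hom S'') (g : S'.Hom S''), ∀ t, f.emb (a t) = g.emb (b t) := by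
  classical
  have : CharZero S.carrier := charZero_of_model ι K S.carrier
  let A := Subring.closure (Set.range (dclHom ι (K := K) S.carrier) ∪ Set.range a)
  obtain ⟨B, hB⟩ := exists_isTranscendenceBasis A S.carrier
  let j : B → S.carrier := Subtype.val
  -- the type of the elements of `S` over the tuple `a`, transported to `b`
  let Γ : Set (L.Formula (S'.carrier ⊕ S.carrier)) :=
    {ψ | ∃ χ : L.Formula (τ ⊕ S.carrier), χ.Realize (Sum.elim a id) ∧
      ψ = χ.relabel (Sum.map b id)}
  have hχ : ∀ (χ : L.Formula (τ ⊕ S.carrier)) {N : Type (max u v w)} [L.Structure N]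
      (g : S'.carrier → N) (v : S.carrier → N), (χ.relabel (Sum.map b id)).Realize (Sum.elim g v) ↔
        χ.Realize (Sum.elim (g ∘ b) v) := by
    intro χ N _ g v
    rw [Formula.realize_relabel, Sum.elim_comp_map]
    rfl
  obtain ⟨N, _, _, _, _, _, g, v, hv, hindep⟩ := exists_generic_extension.{u, v, w} ι (K := K)
    (M := S'.carrier) j Γ (by
      intro Γ₀ hΓ₀ p hp
      have hsub : ∀ ψ : Γ₀, ∃ χ : L.Formula (τ ⊕ S.carrier), χ.Realize (Sum.elim a id) ∧
        ψ.1 = χ.relabel (Sum.map b id) := fun ψ => hΓ₀ ψ.2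
      choose χ hχ1 hχ2 using hsub
      obtain ⟨s, p₀, rfl⟩ := MvPolynomial.exists_finset_rename p
      let j₀ : s → S.carrier := fun i => j i.1
      have hj₀ : Function.Injective j₀ := Subtype.val_injective.comp Subtype.val_injective
      let φ := exProj j₀ (Formula.iInf χ)
      have hφ : φ.Realize (Sum.elim a j₀) :=
        (realize_exProj hj₀ _).2 ⟨id, rfl, Formula.realize_iInf.2 hχ1⟩
      -- the basis witnesses that `φ` defines a dense set, a property of the type of the tuple
      have hdense : IsZariskiDense {z | φ.Realize (Sum.elim a z)} := by
        obtain ⟨P, hP⟩ := exists_bounds.{u, v, w, max u v w} ι hK φ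
        refine (hP S.carrier a).resolve_right ?_
        rintro ⟨q, -, hq⟩
        exact not_bounds_of_algebraicIndependent ι (B := Set.range a)
          (fun t => Subring.subset_closure (Or.inr ⟨t, rfl⟩))
          (hB.1.comp _ Subtype.val_injective) hφ q hq
      obtain ⟨lam, hlam⟩ := exists_denseFormula.{u, v, w, max u v w} ι hK φ
      have hdense' := (hlam S'.carrier b).1 (htp _ ((hlam S.carrier a).2 hdense))
      obtain ⟨z, hz, hpz⟩ : ∃ z : s → S'.carrier, φ.Realize (Sum.elim b z) ∧
          MvPolynomial.eval z p₀ ≠ 0 := by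
        by_contra hcon
        push Not at hcon
        exact hp (by rw [hdense' p₀ hcon, map_zero])
      obtain ⟨v, hv, hvχ⟩ := (realize_exProj hj₀ _).1 hz
      refine ⟨v, fun ψ hψ => ?_, ?_⟩
      · have := (hχ (χ ⟨ψ, hψ⟩) id v).2 (Formula.realize_iInf.1 hvχ ⟨ψ, hψ⟩)
        rwa [← hχ2] at this
      · rw [MvPolynomial.eval_rename]
        rw [← hv] at hpz
        exact hpz)
  have hvform : ∀ ψ : L.Formula S.carrier, ψ.Realize id → ψ.Realize v := by
    intro ψ hψ
    have := hv _ ⟨ψ.relabel Sum.inr, by rw [Formula.realize_relabel]; exact hψ, rfl⟩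
    rwa [hχ, Formula.realize_relabel] at this
  have hvform' : ∀ ψ : L.Formula S.carrier, ψ.Realize v ↔ ψ.Realize id := by
    refine fun ψ => ⟨fun h => ?_, hvform ψ⟩
    by_contra hψ
    exact Formula.realize_not.1 (hvform (∼ψ) (Formula.realize_not.2 hψ)) h
  let f : S.carrier ↪ₑ[L] N := ⟨v, fun n φ z => by
    have := hvform' (φ.relabel z)
    rwa [Formula.realize_relabel, Formula.realize_relabel] at this⟩
  have hfg : ∀ t, f (a t) = g (b t) := by
    intro t
    have := hv _ ⟨Term.equal (Term.var (Sum.inl t)) (Term.var (Sum.inr (a t))), by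
      rw [Formula.realize_equal]; rfl, rfl⟩
    rw [hχ, Formula.realize_equal] at this
    exact this.symm
  choose D' hD1 hD2 using fun i => exists_derivation_elementary ι (K := K) g hindep (S'.der i)
    (fun s : B => f (S.der i s))
  have hcomm : ∀ i z, D' i (f z) = f (S.der i z) := by
    intro i z
    -- the derivations agree on the tuple and on the basis, over which `S` is algebraic
    let C := commSubfield (embHom ι f) (S.der i) (D' i)
    have hAC : A ≤ C.toSubring := by
      rw [Subring.closure_le]
      rintro _ (⟨r, rfl⟩ | ⟨t, rfl⟩)
      · change D' i (f (dclMap ι S.carrier r)) = f (S.der i (dclMap ι S.carrier r))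
        rw [hS, map_dclMap, map_dclMap, ← map_dclMap ι g, hD1, hS', map_dclMap]
      · obtain ⟨t', h1, h2⟩ := hD i t
        change D' i (f (a t)) = f (S.der i (a t))
        rw [hfg, hD1, h1, h2, hfg]
    refine mem_commSubfield_of_isAlgebraic (e := embHom ι f) ?_
    have : Algebra.IsAlgebraic (Algebra.adjoin A (Set.range j)) S.carrier := hB.isAlgebraic
    refine isAlgebraic_of_algebraMap_mem Subtype.val_injective C.toSubring (fun r => ?_)
      (Algebra.IsAlgebraic.isAlgebraic (R := Algebra.adjoin A (Set.range j)) z)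
    obtain ⟨r, hr⟩ := r
    change r ∈ C
    induction hr using Algebra.adjoin_induction with
    | mem x hx =>
      obtain ⟨s, rfl⟩ := hx
      exact hD2 i s
    | algebraMap r => exact hAC r.2
    | add x y _ _ hx hy => exact add_mem hx hy
    | mul x y _ _ hx hy => exact mul_mem hx hy
  exact ⟨⟨N, D'⟩, ⟨f, hcomm⟩, ⟨g, hD1⟩, hfg⟩

end Amalgamation

end NCDer

namespace NCDer

/-! ### Reduction of formulas to conditions on the derivatives -/

/-- A formula whose truth is preserved whenever the truth of the formulas `δ i` is preserved is
equivalent to one of the formulas `δ i`, provided that these are closed under finite conjunctions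
and disjunctions. -/
theorem exists_iff_of_preserved {L : FirstOrder.Language.{u, v}} {T : L.Theory} {V : Type x}
    {I : Type y} (φ : L.Formula V) (δ : I → L.Formula V)
    (hinf : ∀ s : Finset I, ∃ i, ∀ (M : Theory.ModelType.{u, v, max u v w x} T) (c : V → M),
      (δ i).Realize c ↔ ∀ j ∈ s, (δ j).Realize c)
    (hsup : ∀ s : Finset I, ∃ i, ∀ (M : Theory.ModelType.{u, v, max u v w x} T) (c : V → M),
      (δ i).Realize c ↔ ∃ j ∈ s, (δ j).Realize c)
    (h : ∀ (M M' : Theory.ModelType.{u, v, max u v w x} T) (c : V → M) (c' : V → M'),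
      (∀ i, (δ i).Realize c → (δ i).Realize c') → φ.Realize c → φ.Realize c') :
    ∃ i, ∀ (M : Theory.ModelType.{u, v, max u v w x} T) (c : V → M),
      φ.Realize c ↔ (δ i).Realize c := by
  classical
  let C : Set I := {i | ∀ (M : Theory.ModelType.{u, v, max u v w x} T) (c : V → M),
    φ.Realize c → (δ i).Realize c}
  -- the formulas `δ i` implied by `φ` imply `φ`
  have hC : ∀ (M : Theory.ModelType.{u, v, max u v w x} T) (c : V → M),
      (∀ i ∈ C, (δ i).Realize c) → φ.Realize c := by
    intro M' c' hc'
    let Γ : Set (L.Formula V) := insert φ {ψ | ∃ i, ¬ (δ i).Realize c' ∧ ψ = ∼(δ i)}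
    obtain ⟨M, c, hc⟩ := exists_realize_of_finitely.{u, v, w, x} (T := T) Γ (by
      intro Γ₀ hΓ₀
      have hsub : ∀ ψ : {ψ // ψ ∈ Γ₀ ∧ ψ ≠ φ}, ∃ i, ¬ (δ i).Realize c' ∧ ψ.1 = ∼(δ i) :=
        fun ψ => (hΓ₀ ψ.2.1).resolve_left ψ.2.2
      choose idx h1 h2 using hsub
      have : Finite {ψ // ψ ∈ Γ₀ ∧ ψ ≠ φ} := Γ₀.finite_toSet.subset fun _ hψ => hψ.1
      have := Fintype.ofFinite {ψ // ψ ∈ Γ₀ ∧ ψ ≠ φ}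
      obtain ⟨i, hi⟩ := hsup (Finset.univ.image idx)
      by_contra hcon
      push Not at hcon
      have hiC : i ∈ C := by
        intro M c hφ
        obtain ⟨ψ, hψ, hψc⟩ := hcon M c
        have hne : ψ ≠ φ := fun he => hψc (he ▸ hφ)
        have h2' := h2 ⟨ψ, hψ, hne⟩
        rw [hi]
        refine ⟨_, Finset.mem_image_of_mem idx (Finset.mem_univ ⟨ψ, hψ, hne⟩), ?_⟩
        by_contra hnot
        apply hψc
        change ψ = _ at h2'
        rw [h2']
        exact Formula.realize_not.2 hnot
      obtain ⟨j, hj, hjc⟩ := (hi M' c').1 (hc' i hiC)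
      obtain ⟨ψ, -, rfl⟩ := Finset.mem_image.1 hj
      exact h1 ψ hjc)
    refine h M M' c c' (fun i hi => ?_) (hc φ (Set.mem_insert _ _))
    by_contra hnot
    exact Formula.realize_not.1 (hc _ (Or.inr ⟨i, hnot, rfl⟩)) hi
  by_contra hcon
  push Not at hcon
  obtain ⟨M, c, hc⟩ := exists_realize_of_finitely.{u, v, w, x} (T := T)
    (insert (∼φ) {ψ | ∃ i ∈ C, ψ = δ i}) (by
      intro Γ₀ hΓ₀
      have hsub : ∀ ψ : {ψ // ψ ∈ Γ₀ ∧ ψ ≠ ∼φ}, ∃ i ∈ C, ψ.1 = δ i :=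
        fun ψ => (hΓ₀ ψ.2.1).resolve_left ψ.2.2
      choose idx h1 h2 using hsub
      have : Finite {ψ // ψ ∈ Γ₀ ∧ ψ ≠ ∼φ} := Γ₀.finite_toSet.subset fun _ hψ => hψ.1
      have := Fintype.ofFinite {ψ // ψ ∈ Γ₀ ∧ ψ ≠ ∼φ}
      obtain ⟨i, hi⟩ := hinf (Finset.univ.image idx)
      have hiC : i ∈ C := by
        intro M c hφ
        rw [hi]
        intro j hj
        obtain ⟨ψ, -, rfl⟩ := Finset.mem_image.1 hj
        exact h1 ψ M c hφ
      obtain ⟨M, c, hMc⟩ := hcon i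
      have hMc : ¬ φ.Realize c ∧ (δ i).Realize c := by
        rcases hMc with hMc | hMc
        · exact absurd (hiC M c hMc.1) hMc.2
        · exact hMc
      refine ⟨M, c, fun ψ hψ => ?_⟩
      by_cases hne : ψ = ∼φ
      · rw [hne]
        exact Formula.realize_not.2 hMc.1
      · have h2' := h2 ⟨ψ, hψ, hne⟩
        change ψ = _ at h2'
        rw [h2']
        exact (hi M c).1 hMc.2 _ (Finset.mem_image_of_mem idx (Finset.mem_univ _)))
  exact Formula.realize_not.1 (hc _ (Set.mem_insert _ _))
    (hC M c fun i hi => hc _ (Or.inr ⟨i, hi, rfl⟩))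

section Models

variable {L : FirstOrder.Language.{u, v}} {k : ℕ}

/-- The models of a theory in the expanded language, as `L`-structures. -/
instance modelReduct {T : (ncLang L k).Theory} (M : Theory.ModelType.{u, v, x} T) :
    L.Structure M :=
  (LHom.sumInl : L →ᴸ ncLang L k).reduct M

instance {T : (ncLang L k).Theory} (M : Theory.ModelType.{u, v, x} T) :
    (LHom.sumInl : L →ᴸ ncLang L k).IsExpansionOn M :=
  (LHom.sumInl : L →ᴸ ncLang L k).isExpansionOn_reduct M

variable {ι : FirstOrder.Language.ring →ᴸ L}
  {K : Type w} [Field K] [Ring.CompatibleRing K] [L.Structure K] [ι.IsExpansionOn K]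
  {η : Fin k → Derivation ℤ (dclRing ι K) (dclRing ι K)}

/-- A model of `ncTheory`, with its structure of field and its derivations. -/
theorem exists_derModel {M : Type (max u v w)} [(ncLang L k).Structure M] [L.Structure M]
    [(LHom.sumInl : L →ᴸ ncLang L k).IsExpansionOn M] [Nonempty M] (h : M ⊨ ncTheory ι K η) :
    ∃ (_ : Field M) (_ : Ring.CompatibleRing M) (_ : ι.IsExpansionOn M)
      (_ : M ⊨ L.completeTheory K) (D : Fin k → Derivation ℤ M M),
      (∀ i, derMap L M i = D i) ∧ (⟨M, D⟩ : DerModel ι K k).Extends η := by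
  have := model_completeTheory_of_ncTheory ι h
  obtain ⟨_, _, _⟩ := exists_field_of_model ι K M
  obtain ⟨h0, D, hD, hext⟩ := (model_ncTheory_iff ι η (M := M)).1 h
  exact ⟨inferInstance, inferInstance, inferInstance, h0, D, fun i => funext (hD i), hext⟩

omit [Field K] [Ring.CompatibleRing K] [ι.IsExpansionOn K] in
theorem DerModel.Hom.map_wordAct {S S' : DerModel ι K k} (f : S.Hom S')
    (γ : FreeMonoid (Fin k)) (z : S.carrier) :
    f.emb (wordAct (fun i => S.der i) γ z) = wordAct (fun i => S'.der i) γ (f.emb z) := by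
  induction γ using FreeMonoid.inductionOn' with
  | one => rfl
  | of_mul i γ ih => rw [wordAct_of_mul, wordAct_of_mul, ← ih, f.comm]

/-- The derivatives of a tuple. -/
def jets (L : FirstOrder.Language.{u, v}) {k : ℕ} {M : Type x} [(ncLang L k).Structure M]
    {V : Type*} (c : V → M) : V × FreeMonoid (Fin k) → M :=
  fun p => wordAct (derMap L M) p.2 (c p.1)

/-- In models of nc-Deep, the type in the language `L` of the derivatives of a tuple determines
the types of the derivatives of its extensions by one element. -/
theorem exists_realize_jets [CharZero K] (hK : AlgebraicallyBoundedOver L (dclRing ι K))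
    (M M' : Theory.ModelType.{u, v, max u v w} (ncDeepTheory ι K η)) {V : Type} (c : V → M)
    (c' : V → M') (htp : ∀ φ : L.Formula (V × FreeMonoid (Fin k)),
      φ.Realize (jets L c) → φ.Realize (jets L c'))
    (β : L.Formula ((V ⊕ Fin 1) × FreeMonoid (Fin k))) (d : M)
    (hβ : β.Realize (jets L (Sum.elim c fun _ => d))) :
    ∃ d' : M', β.Realize (jets L (Sum.elim c' fun _ => d')) := by
  obtain ⟨hM, -⟩ := (model_ncDeepTheory_iff ι η hK (M := M)).1 M.is_model
  obtain ⟨hM', hdeep⟩ := (model_ncDeepTheory_iff ι η hK (M := M')).1 M'.is_model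
  obtain ⟨_, _, _, _, D, hD, hS⟩ := exists_derModel hM
  obtain ⟨_, _, _, _, D', hD', hS'⟩ := exists_derModel hM'
  have hD : derMap L M = fun i => ⇑(D i) := funext hD
  have hD' : derMap L M' = fun i => ⇑(D' i) := funext hD'
  obtain ⟨S'', f, g, hfg⟩ := DerModel.exists_amalgam ι hK hS hS' (jets L c) (jets L c')
    (fun i p => ⟨(p.1, FreeMonoid.of i * p.2), by
      simp only [jets, hD, wordAct_of_mul], by simp only [jets, hD', wordAct_of_mul]⟩) htp
  have hdeep' : NCDeep L fun i => ⇑(D' i) := hD' ▸ hdeep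
  let r : (V ⊕ Fin 1) × FreeMonoid (Fin k) → M' ⊕ FreeMonoid (Fin k) := fun p =>
    Sum.elim (fun s => Sum.inl (jets L c' (s, p.2))) (fun _ => Sum.inr p.2) p.1
  obtain ⟨d', hd'⟩ := g.exists_of_ncDeep ι hK hdeep' (β.relabel r) (f.emb d) (by
    rw [Formula.realize_relabel]
    rw [← f.emb.map_formula] at hβ
    refine (iff_of_eq (congrArg β.Realize ?_)).1 hβ
    funext ⟨s, γ⟩
    rcases s with s | s
    · exact hfg (s, γ)
    · refine (congrArg f.emb ?_).trans (f.map_wordAct γ d)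
      simp only [jets, hD]
      rfl)
  refine ⟨d', ?_⟩
  rw [Formula.realize_relabel] at hd'
  refine (iff_of_eq (congrArg β.Realize ?_)).1 hd'
  funext ⟨s, γ⟩
  rcases s with s | s
  · rfl
  · simp only [jets, hD']
    rfl

end Models

section JetDef

variable {L : FirstOrder.Language.{u, v}} {ι : FirstOrder.Language.ring →ᴸ L}
  {K : Type w} [Field K] [Ring.CompatibleRing K] [L.Structure K] [ι.IsExpansionOn K]
  {k : ℕ} {η : Fin k → Derivation ℤ (dclRing ι K) (dclRing ι K)}

/-- A property of tuples in models of nc-Deep is expressed by an `L`-formula in their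
derivatives. -/
def JetDef (η : Fin k → Derivation ℤ (dclRing ι K) (dclRing ι K)) {V : Type}
    (P : ∀ M : Theory.ModelType.{u, v, max u v w} (ncDeepTheory ι K η), (V → M) → Prop) : Prop :=
  ∃ β : L.Formula (V × FreeMonoid (Fin k)), ∀ M c, P M c ↔ β.Realize (jets L c)

variable {V W : Type}
  {P Q : ∀ M : Theory.ModelType.{u, v, max u v w} (ncDeepTheory ι K η), (V → M) → Prop}

theorem JetDef.imp (hP : JetDef η P) (hQ : JetDef η Q) : JetDef η fun M c => P M c → Q M c := by
  obtain ⟨β, hβ⟩ := hP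
  obtain ⟨γ, hγ⟩ := hQ
  exact ⟨β.imp γ, fun M c => by beta_reduce; rw [Formula.realize_imp, hβ, hγ]⟩

theorem JetDef.not (hP : JetDef η P) : JetDef η fun M c => ¬ P M c := by
  obtain ⟨β, hβ⟩ := hP
  exact ⟨∼β, fun M c => by beta_reduce; rw [Formula.realize_not, hβ]⟩

theorem JetDef.and (hP : JetDef η P) (hQ : JetDef η Q) : JetDef η fun M c => P M c ∧ Q M c := by
  obtain ⟨β, hβ⟩ := hP
  obtain ⟨γ, hγ⟩ := hQ
  exact ⟨β ⊓ γ, fun M c => by beta_reduce; rw [Formula.realize_inf, hβ, hγ]⟩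

theorem JetDef.forall_finite {I : Type} [Finite I]
    {P : I → ∀ M : Theory.ModelType.{u, v, max u v w} (ncDeepTheory ι K η), (V → M) → Prop}
    (hP : ∀ i, JetDef η (P i)) : JetDef η fun M c => ∀ i, P i M c := by
  choose β hβ using hP
  exact ⟨Formula.iInf β, fun M c => by simp only [Formula.realize_iInf, hβ]⟩

theorem JetDef.reindex (r : V → W) (hP : JetDef η P) :
    JetDef η fun M (c : W → M) => P M (c ∘ r) := by
  obtain ⟨β, hβ⟩ := hP
  exact ⟨β.relabel (Prod.map r id), fun M c => by beta_reduce; rw [Formula.realize_relabel, hβ]; rfl⟩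

theorem JetDef.congr (hP : JetDef η P) (h : ∀ M c, Q M c ↔ P M c) : JetDef η Q := by
  obtain ⟨β, hβ⟩ := hP
  exact ⟨β, fun M c => (h M c).trans (hβ M c)⟩

variable (η) in
theorem JetDef.of_formula (φ : L.Formula V) :
    JetDef η fun M (c : V → M) => φ.Realize c :=
  ⟨φ.relabel fun s => (s, 1), fun M c => by rw [Formula.realize_relabel]; rfl⟩

variable (η) in
theorem JetDef.der_eq (i : Fin k) (s t : V) :
    JetDef η fun M (c : V → M) => derMap L M i (c s) = c t :=
  ⟨Term.equal (Term.var (s, FreeMonoid.of i)) (Term.var (t, 1)), fun M c => by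
    rw [Formula.realize_equal]; rfl⟩

/-- The properties expressed by the derivatives are closed under existential quantification. -/
theorem JetDef.exists_one [CharZero K] (hK : AlgebraicallyBoundedOver L (dclRing ι K))
    {P : ∀ M : Theory.ModelType.{u, v, max u v w} (ncDeepTheory ι K η), (V ⊕ Fin 1 → M) → Prop}
    (hP : JetDef η P) : JetDef η fun M c => ∃ d : M, P M (Sum.elim c fun _ => d) := by
  classical
  obtain ⟨β, hβ⟩ := hP
  let t : ∀ {W : Type}, L.Formula (W × FreeMonoid (Fin k)) → (ncLang L k).Formula W := fun γ =>
    BoundedFormula.subst (toNC k γ) fun p => wordAct derTerm p.2 (Term.var p.1)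
  have ht : ∀ {W : Type} (γ : L.Formula (W × FreeMonoid (Fin k)))
      (M : Theory.ModelType.{u, v, max u v w} (ncDeepTheory ι K η)) (c : W → M),
      (t γ).Realize c ↔ γ.Realize (jets L c) := by
    intro W γ M c
    rw [realize_subst_toNC]
    simp only [realize_wordAct_derTerm, Term.realize_var]
    rfl
  have hex : ∀ (M : Theory.ModelType.{u, v, max u v w} (ncDeepTheory ι K η)) (c : V → M),
      (Formula.iExs (Fin 1) (t β)).Realize c ↔ ∃ d : M, P M (Sum.elim c fun _ => d) := by
    intro M c
    rw [Formula.realize_iExs]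
    simp only [ht, hβ]
    constructor
    · rintro ⟨d, hd⟩
      rw [eq_const_fin_one d] at hd
      exact ⟨d 0, hd⟩
    · rintro ⟨d, hd⟩
      exact ⟨fun _ => d, hd⟩
  obtain ⟨γ, hγ⟩ := exists_iff_of_preserved.{u, v, w, 0} (T := ncDeepTheory ι K η)
    (Formula.iExs (Fin 1) (t β)) (t (W := V))
    (fun s => ⟨Formula.iInf fun γ : s => γ.1, fun M c => by
      simp only [ht, Formula.realize_iInf, Subtype.forall]⟩)
    (fun s => ⟨Formula.iSup fun γ : s => γ.1, fun M c => by
      simp only [ht, Formula.realize_iSup, Subtype.exists, exists_prop]⟩)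
    (fun M M' c c' htp h => by
      rw [hex] at h ⊢
      obtain ⟨d, hd⟩ := h
      obtain ⟨d', hd'⟩ := exists_realize_jets hK M M' c c'
        (fun φ => by rw [← ht, ← ht]; exact htp φ) β d ((hβ _ _).1 hd)
      exact ⟨d', (hβ _ _).2 hd'⟩)
  exact ⟨γ, fun M c => by beta_reduce; rw [← hex, hγ, ht]⟩

theorem JetDef.exists_tuple [CharZero K] (hK : AlgebraicallyBoundedOver L (dclRing ι K)) (n : ℕ)
    {P : ∀ M : Theory.ModelType.{u, v, max u v w} (ncDeepTheory ι K η), (V ⊕ Fin n → M) → Prop}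
    (hP : JetDef η P) : JetDef η fun M c => ∃ d : Fin n → M, P M (Sum.elim c d) := by
  induction n with
  | zero =>
    refine (hP.reindex (Sum.elim id Fin.elim0)).congr fun M c => ?_
    have : ∀ d : Fin 0 → M, c ∘ Sum.elim id Fin.elim0 = Sum.elim c d := fun d => by
      funext s
      rcases s with s | s
      · rfl
      · exact s.elim0
    exact ⟨fun ⟨d, hd⟩ => by rwa [this d], fun h => ⟨Fin.elim0, by rwa [← this]⟩⟩
  | succ n ih =>
    have h := ih ((hP.reindex (W := (V ⊕ Fin n) ⊕ Fin 1) (Sum.elim (fun s => Sum.inl (Sum.inl s))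
      (Fin.lastCases (Sum.inr 0) fun j => Sum.inl (Sum.inr j)))).exists_one hK)
    refine h.congr fun M c => ?_
    have : ∀ (d : Fin n → M) (z : M), Sum.elim (Sum.elim c d) (fun _ : Fin 1 => z) ∘
        Sum.elim (fun s => Sum.inl (Sum.inl s))
          (Fin.lastCases (Sum.inr 0) fun j => Sum.inl (Sum.inr j)) =
            Sum.elim c (Fin.snoc d z : Fin (n + 1) → M) := by
      intro d z
      funext s
      rcases s with s | s
      · rfl
      · induction s using Fin.lastCases with
        | last => simp
        | cast j => simp
    simp only [this]
    exact ⟨fun ⟨d, hd⟩ => ⟨Fin.init d, d (Fin.last n), by rwa [Fin.snoc_init_self]⟩,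
      fun ⟨d, z, h⟩ => ⟨_, h⟩⟩

/-- The graph of a term. -/
theorem JetDef.term_eq [CharZero K] (hK : AlgebraicallyBoundedOver L (dclRing ι K))
    (t : (ncLang L k).Term V) :
    JetDef η fun M (c : V ⊕ Fin 1 → M) => t.realize (c ∘ Sum.inl) = c (Sum.inr 0) := by
  induction t with
  | var s =>
    refine (JetDef.of_formula η
      (Term.equal (Term.var (Sum.inl s)) (Term.var (Sum.inr (0 : Fin 1))))).congr fun M c => ?_
    rw [Formula.realize_equal]
    rfl
  | @func n F ts ih =>
    -- the values of the subterms are quantified existentially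
    have hargs : JetDef η fun M (c : (V ⊕ Fin 1) ⊕ Fin n → M) =>
        ∀ i, (ts i).realize (c ∘ Sum.inl ∘ Sum.inl) = c (Sum.inr i) :=
      JetDef.forall_finite fun i => (ih i).reindex (W := (V ⊕ Fin 1) ⊕ Fin n)
        (Sum.elim (fun s => Sum.inl (Sum.inl s)) fun _ => Sum.inr i)
    have hF : JetDef η fun M (c : (V ⊕ Fin 1) ⊕ Fin n → M) =>
        (Structure.funMap F fun i => c (Sum.inr i)) = c (Sum.inl (Sum.inr 0)) := by
      rcases F with F | F
      · refine (JetDef.of_formula η (V := (V ⊕ Fin 1) ⊕ Fin n)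
          (Term.equal (Term.func F fun i => Term.var (Sum.inr i))
            (Term.var (Sum.inl (Sum.inr 0))))).congr fun M c => ?_
        rw [Formula.realize_equal]
        rfl
      · obtain ⟨i⟩ := F
        refine (JetDef.der_eq η i (Sum.inr 0) (Sum.inl (Sum.inr 0))).congr fun M c => ?_
        rw [derMap]
        refine iff_of_eq (congrArg (· = _) (congrArg (Structure.funMap (derFunc L i)) ?_))
        funext s
        rw [Subsingleton.elim s 0]
        rfl
    refine ((hargs.and hF).exists_tuple hK).congr fun M c => ?_
    rw [Term.realize]
    constructor
    · intro h
      exact ⟨fun i => (ts i).realize (c ∘ Sum.inl), fun i => rfl, h⟩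
    · rintro ⟨d, hd, h⟩
      rw [show (fun i => (ts i).realize (c ∘ Sum.inl)) = d from funext hd]
      exact h

/-- Every formula of the expanded language is equivalent, in the models of nc-Deep, to an
`L`-formula in the derivatives. -/
theorem JetDef.of_boundedFormula [CharZero K] (hK : AlgebraicallyBoundedOver L (dclRing ι K))
    {n : ℕ} (φ : (ncLang L k).BoundedFormula V n) :
    JetDef η fun M (c : V ⊕ Fin n → M) => φ.Realize (c ∘ Sum.inl) (c ∘ Sum.inr) := by
  have hargs : ∀ {l m : ℕ} (ts : Fin m → (ncLang L k).Term (V ⊕ Fin l)),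
      JetDef η fun M (c : (V ⊕ Fin l) ⊕ Fin m → M) =>
        ∀ i, (ts i).realize (c ∘ Sum.inl) = c (Sum.inr i) := fun ts =>
    JetDef.forall_finite fun i => (JetDef.term_eq hK (ts i)).reindex
      (Sum.elim Sum.inl fun _ => Sum.inr i)
  have hc : ∀ {l : ℕ} {M : Type (max u v w)} (c : V ⊕ Fin l → M),
      Sum.elim (c ∘ Sum.inl) (c ∘ Sum.inr) = c := fun c => Sum.elim_comp_inl_inr c
  induction φ with
  | falsum => exact (JetDef.of_formula η ⊥).congr fun M c => Iff.rfl
  | @equal l t₁ t₂ =>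
    refine (((hargs ![t₁, t₂]).and (JetDef.of_formula η (Term.equal (Term.var (Sum.inr 0))
      (Term.var (Sum.inr 1))))).exists_tuple hK).congr fun M c => ?_
    simp only [BoundedFormula.Realize, hc, Formula.realize_equal, Term.realize_var,
      Fin.forall_fin_two]
    constructor
    · intro h
      exact ⟨![t₁.realize c, t₂.realize c], ⟨rfl, rfl⟩, h⟩
    · rintro ⟨d, ⟨h1, h2⟩, h⟩
      exact h1.trans (h.trans h2.symm)
  | @rel l m R ts =>
    rcases R with R | R
    · refine (((hargs ts).and (JetDef.of_formula η (V := (V ⊕ Fin l) ⊕ Fin m)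
        (R.formula fun i => Term.var (Sum.inr i)))).exists_tuple hK).congr fun M c => ?_
      simp only [BoundedFormula.Realize, hc, Formula.realize_rel, Term.realize_var]
      constructor
      · intro h
        exact ⟨fun i => (ts i).realize c, fun i => rfl, h⟩
      · rintro ⟨d, hd, h⟩
        rw [show (fun i => (ts i).realize c) = d from funext hd]
        exact h
    · exact R.elim
  | imp φ ψ ih1 ih2 => exact (ih1.imp ih2).congr fun M c => Iff.rfl
  | @all l φ ih =>
    have h := ((ih.not.reindex (W := (V ⊕ Fin l) ⊕ Fin 1)
      (Sum.elim (fun s => Sum.inl (Sum.inl s))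
        (Fin.lastCases (Sum.inr 0) fun j => Sum.inl (Sum.inr j)))).exists_one hK).not
    refine h.congr fun M c => ?_
    rw [BoundedFormula.realize_all]
    push Not
    refine forall_congr' fun z => iff_of_eq ?_
    congr 1
    funext s
    induction s using Fin.lastCases with
    | last => simp
    | cast j => simp

theorem exists_iff_jets [CharZero K] (hK : AlgebraicallyBoundedOver L (dclRing ι K))
    (η : Fin k → Derivation ℤ (dclRing ι K) (dclRing ι K)) (φ : (ncLang L k).Formula V) :
    ∃ β : L.Formula (V × FreeMonoid (Fin k)),
      ∀ (M : Theory.ModelType.{u, v, max u v w} (ncDeepTheory ι K η)) (c : V → M),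
        φ.Realize c ↔ β.Realize (jets L c) := by
  refine ((JetDef.of_boundedFormula (η := η) hK φ).reindex (Sum.elim id Fin.elim0)).congr
    fun M c => ?_
  rw [Formula.Realize]
  refine iff_of_eq ?_
  congr 1
  exact Subsingleton.elim _ _

end JetDef

end NCDer

namespace NCDer

/-! ### The model completion -/

/-- A formula which holds in all models in some larger universe follows from the theory. -/
theorem models_of_forall {L : FirstOrder.Language.{u, v}} {T : L.Theory} {V : Type}
    {φ : L.Formula V}
    (h : ∀ (M : Theory.ModelType.{u, v, max u v w} T) (c : V → M), φ.Realize c) : T ⊨ᵇ φ := by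
  refine Theory.models_formula_iff.2 fun M c => ?_
  have hM : φ.Realize (M := Theory.ModelType.ulift.{u, v, max u v, w} M)
    (Equiv.ulift.{w, max u v}.symm ∘ c) := h (Theory.ModelType.ulift.{u, v, max u v, w} M) _
  let e : M ≃[L] Theory.ModelType.ulift.{u, v, max u v, w} M :=
    Equiv.inducedStructureEquiv Equiv.ulift.{w, max u v}.symm
  exact (StrongHomClass.realize_formula e φ).1 hM

theorem iff_of_forall {L : FirstOrder.Language.{u, v}} {T : L.Theory} {V : Type}
    {φ ψ : L.Formula V} (h : ∀ (M : Theory.ModelType.{u, v, max u v w} T) (c : V → M),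
      φ.Realize c ↔ ψ.Realize c) : T.Iff φ ψ :=
  models_of_forall.{u, v, w} (φ := φ.iff ψ) fun M c => Formula.realize_iff.2 (h M c)

section QuantifierFree

variable {L : FirstOrder.Language.{u, v}}

theorem isQF_onFormula {L' : FirstOrder.Language.{u, v}} {V : Type x} (ι : L →ᴸ L')
    {n : ℕ} {φ : L.BoundedFormula V n} (h : φ.IsQF) : (ι.onBoundedFormula φ).IsQF := by
  induction h with
  | falsum => exact BoundedFormula.IsQF.falsum
  | of_isAtomic h =>
    cases h with
    | equal t₁ t₂ => exact (BoundedFormula.IsAtomic.equal _ _).isQF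
    | rel R ts => exact (BoundedFormula.IsAtomic.rel _ _).isQF
  | imp _ _ h1 h2 => exact h1.imp h2

theorem isQF_subst {V : Type x} {W : Type y} (t : V → L.Term W) {n : ℕ}
    {φ : L.BoundedFormula V n} (h : φ.IsQF) : (φ.subst t).IsQF := by
  induction h with
  | falsum => exact BoundedFormula.IsQF.falsum
  | of_isAtomic h =>
    cases h with
    | equal t₁ t₂ => exact (BoundedFormula.IsAtomic.equal _ _).isQF
    | rel R ts => exact (BoundedFormula.IsAtomic.rel _ _).isQF
  | imp _ _ h1 h2 => exact h1.imp h2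

end QuantifierFree

section Completion

variable {L : FirstOrder.Language.{u, v}} {ι : FirstOrder.Language.ring →ᴸ L}
  {K : Type w} [Field K] [CharZero K] [Ring.CompatibleRing K] [L.Structure K] [ι.IsExpansionOn K]
  {k : ℕ} {η : Fin k → Derivation ℤ (dclRing ι K) (dclRing ι K)}

theorem model_ncDeepTheory_of_ncWideTheory (hK : AlgebraicallyBoundedOver L (dclRing ι K))
    {M : Type (max u v w)} [(ncLang L k).Structure M] [Nonempty M]
    (h : M ⊨ ncWideTheory ι K η) : M ⊨ ncDeepTheory ι K η := by
  let _ : L.Structure M := (LHom.sumInl : L →ᴸ ncLang L k).reduct M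
  have := (LHom.sumInl : L →ᴸ ncLang L k).isExpansionOn_reduct M
  obtain ⟨h0, h1⟩ := (model_ncWideTheory_iff ι η hK).1 h
  obtain ⟨_, _, _, _, -⟩ := exists_derModel h0
  exact (model_ncDeepTheory_iff ι η hK).2 ⟨h0, ncDeep_of_ncWide ι hK h1⟩

/-- A model with derivations which extend the given ones and which satisfies nc-Wide. -/
theorem DerModel.model_ncWideTheory (hK : AlgebraicallyBoundedOver L (dclRing ι K))
    {S : DerModel ι K k} (h : S.Extends η) (hw : NCWide L fun i => ⇑(S.der i)) :
    S.carrier ⊨ ncWideTheory ι K η :=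
  (model_ncWideTheory_iff ι η hK).2
    ⟨(model_ncTheory_iff ι η).2 ⟨S.model, S.der, fun _ _ => rfl, h⟩, hw⟩

variable (η) in
theorem isSatisfiable_ncTheories (hK : AlgebraicallyBoundedOver L (dclRing ι K)) :
    (ncDeepTheory ι K η).IsSatisfiable ∧ (ncWideTheory ι K η).IsSatisfiable := by
  obtain ⟨S, hS⟩ := DerModel.exists_extends ι K η
  obtain ⟨S', f, hw⟩ := S.exists_wide hK
  have hwide := DerModel.model_ncWideTheory hK (f.extends hS) hw
  have hdeep := model_ncDeepTheory_of_ncWideTheory hK hwide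
  exact ⟨Theory.Model.isSatisfiable S'.carrier, Theory.Model.isSatisfiable S'.carrier⟩

/-- Every model of `ncTheory` has an extension, elementary in the language `L`, to a model of
nc-Wide. -/
theorem exists_extension_ncWideTheory (hK : AlgebraicallyBoundedOver L (dclRing ι K))
    {M : Type (max u v w)} [(ncLang L k).Structure M] [L.Structure M]
    [(LHom.sumInl : L →ᴸ ncLang L k).IsExpansionOn M] [Nonempty M] (h : M ⊨ ncTheory ι K η) :
    ∃ (N : Type (max u v w)) (_ : L.Structure N) (_ : (ncLang L k).Structure N)
      (_ : (LHom.sumInl : L →ᴸ ncLang L k).IsExpansionOn N) (_ : N ⊨ ncWideTheory ι K η)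
      (f : M ↪ₑ[L] N), ∀ i z, f (derMap L M i z) = derMap L N (k := k) i (f z) := by
  obtain ⟨_, _, _, _, D, hD, hS⟩ := exists_derModel h
  obtain ⟨S', f, hw⟩ := DerModel.exists_wide hK (⟨M, D⟩ : DerModel ι K k)
  refine ⟨S'.carrier, S'.str, S'.ncStr, isExpansionOn_ncStructure _,
    DerModel.model_ncWideTheory hK (f.extends hS) hw, f.emb, fun i z => ?_⟩
  rw [hD]
  exact (f.comm i z).symm

/-- The reduction of formulas to `L`-formulas in the derivatives, for models with an arbitrary
reduct to `L`. -/
theorem exists_formula_jets (hK : AlgebraicallyBoundedOver L (dclRing ι K))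
    (η : Fin k → Derivation ℤ (dclRing ι K) (dclRing ι K)) {V : Type}
    (φ : (ncLang L k).Formula V) :
    ∃ β : L.Formula (V × FreeMonoid (Fin k)),
      ∀ (M : Type (max u v w)) [(ncLang L k).Structure M] [L.Structure M]
        [(LHom.sumInl : L →ᴸ ncLang L k).IsExpansionOn M] [Nonempty M],
        M ⊨ ncDeepTheory ι K η → ∀ c : V → M, φ.Realize c ↔ β.Realize (jets L c) := by
  obtain ⟨β, hβ⟩ := exists_iff_jets hK η φ
  refine ⟨β, fun M _ _ _ _ hM c => ?_⟩
  rw [← realize_toNC (k := k) β]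
  let M' := Theory.ModelType.of (ncDeepTheory ι K η) M
  exact (hβ M' c).trans (realize_toNC (k := k) (M := M') β _).symm

theorem comp_jets {M N : Type x} [(ncLang L k).Structure M] [(ncLang L k).Structure N] {V : Type}
    {f : M → N} (hf : ∀ i z, f (derMap L M (k := k) i z) = derMap L N (k := k) i (f z)) (c : V → M) :
    f ∘ jets L (k := k) c = jets L (f ∘ c) := by
  have h : ∀ γ z, f (wordAct (derMap L M) γ z) = wordAct (derMap L N (k := k)) γ (f z) := by
    intro γ z
    induction γ using FreeMonoid.inductionOn' with
    | one => rfl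
    | of_mul i γ ih => rw [wordAct_of_mul, wordAct_of_mul, ← ih, hf]
  exact funext fun p => h p.2 (c p.1)

/-- A model of nc-Deep satisfies nc-Wide: it has an extension satisfying nc-Wide, which is
elementary in the expanded language as formulas are equivalent to `L`-formulas in the derivatives. -/
theorem model_ncWideTheory_of_ncDeepTheory (hK : AlgebraicallyBoundedOver L (dclRing ι K))
    {M : Type (max u v w)} [(ncLang L k).Structure M] [Nonempty M]
    (h : M ⊨ ncDeepTheory ι K η) : M ⊨ ncWideTheory ι K η := by
  let _ : L.Structure M := (LHom.sumInl : L →ᴸ ncLang L k).reduct M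
  have := (LHom.sumInl : L →ᴸ ncLang L k).isExpansionOn_reduct M
  have h0 := ((model_ncDeepTheory_iff ι η hK).1 h).1
  obtain ⟨N, _, _, _, hN, f, hf⟩ := exists_extension_ncWideTheory hK h0
  have : Nonempty N := (inferInstance : Nonempty M).map f
  have hN' := model_ncDeepTheory_of_ncWideTheory hK hN
  have hel : ∀ σ : (ncLang L k).Sentence, N ⊨ σ → M ⊨ σ := by
    intro σ hσ
    obtain ⟨β, hβ⟩ := exists_formula_jets hK η σ
    rw [Sentence.Realize, hβ N hN', ← Subsingleton.elim (f ∘ (default : Empty → M)) default,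
      ← comp_jets hf, f.map_formula] at hσ
    exact (hβ M h _).2 hσ
  exact ⟨fun σ hσ => hel σ (hN.realize_of_mem σ hσ)⟩

theorem model_ncDeepTheory_iff_ncWideTheory (hK : AlgebraicallyBoundedOver L (dclRing ι K))
    {M : Type (max u v w)} [(ncLang L k).Structure M] [Nonempty M] :
    M ⊨ ncDeepTheory ι K η ↔ M ⊨ ncWideTheory ι K η :=
  ⟨model_ncWideTheory_of_ncDeepTheory hK, model_ncDeepTheory_of_ncWideTheory hK⟩

variable {U : (ncLang L k).Theory}

/-- Over a common substructure which is a model of `ncTheory`, formulas reduce to `L`-formulas in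
the derivatives of the parameters, whose truth is preserved by embeddings between models of a
model complete theory. -/
theorem isModelCompletion_ncTheory (hK : AlgebraicallyBoundedOver L (dclRing ι K))
    (hT : IsModelComplete.{u, v, max u v w} (L.completeTheory K))
    (hU : ∀ (M : Type (max u v w)) [(ncLang L k).Structure M] [Nonempty M],
      M ⊨ U ↔ M ⊨ ncDeepTheory ι K η) :
    IsModelCompletion.{u, v, max u v w} (ncTheory ι K η) U where
  model_of_model A := ((model_ncDeepTheory_iff ι η hK).1 ((hU A).1 A.is_model)).1
  exists_embedding A := by
    obtain ⟨N, _, _, _, hN, f, hf⟩ := exists_extension_ncWideTheory hK A.is_model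
    have : Nonempty N := A.nonempty'.map f
    have : N ⊨ U := (hU N).2 (model_ncDeepTheory_of_ncWideTheory hK hN)
    let F : A ↪[ncLang L k] N := ncEmbedding f.toEmbedding hf
    exact ⟨Theory.ModelType.of U N, ⟨F⟩⟩
  elementarily_equivalent A B C f g n φ a := by
    obtain ⟨β, hβ⟩ := exists_formula_jets hK η φ
    -- the formula `β` is in the language `L`, in which embeddings are elementary
    have key : ∀ (B : Theory.ModelType.{u, v, max u v w} U) (f : A ↪[ncLang L k] B),
        φ.Realize (f ∘ a) ↔ β.Realize (jets L a) := by
      intro B f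
      have hB := (hU B).1 B.is_model
      have hB0 := ((model_ncDeepTheory_iff ι η hK).1 hB).1
      have : A ⊨ L.completeTheory K := model_completeTheory_of_ncTheory ι A.is_model
      have : B ⊨ L.completeTheory K := model_completeTheory_of_ncTheory ι hB0
      let fL : A ↪[L] B :=
        { toFun := f
          inj' := f.injective
          map_fun' := fun {m} F z => f.map_fun (Sum.inl F : (ncLang L k).Functions m) z
          map_rel' := fun {m} R z => f.map_rel (Sum.inl R : (ncLang L k).Relations m) z }
      let fE : A ↪ₑ[L] B := ⟨fL, fun m ψ b => hT (Theory.ModelType.of (L.completeTheory K) A)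
        (Theory.ModelType.of (L.completeTheory K) B) fL m ψ b⟩
      have hf : ∀ i z, f (derMap L A i z) = derMap L B (k := k) i (f z) := by
        intro i z
        refine (f.map_fun (derFunc L i) ![z]).trans (congrArg _ ?_)
        funext s
        rw [Subsingleton.elim s 0]
        rfl
      rw [hβ B hB, ← comp_jets hf]
      exact fE.map_formula β _
    rw [key B f, key C g]

/-- In the reduction of formulas to `L`-formulas in the derivatives, the latter can be chosen
quantifier-free. -/
theorem hasQE_of_models (hK : AlgebraicallyBoundedOver L (dclRing ι K))
    (hT : HasQE (L.completeTheory K))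
    (hU : ∀ (M : Type (max u v w)) [(ncLang L k).Structure M] [Nonempty M],
      M ⊨ U ↔ M ⊨ ncDeepTheory ι K η) : HasQE U := by
  intro n φ
  obtain ⟨β, hβ⟩ := exists_formula_jets hK η φ
  let e := (supp β).equivFin
  obtain ⟨ψ, hψ, hiff⟩ := hT _ ((core β).relabel e)
  refine ⟨BoundedFormula.subst (toNC k ψ) fun i =>
    wordAct derTerm (e.symm i).1.2 (Term.var (e.symm i).1.1),
    isQF_subst _ (isQF_onFormula _ hψ), iff_of_forall.{u, v, w} fun M c => ?_⟩
  have hM := (hU M).1 M.is_model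
  have : M ⊨ L.completeTheory K :=
    model_completeTheory_of_ncTheory ι ((model_ncDeepTheory_iff ι η hK).1 hM).1
  have h := Formula.realize_iff.1 (hiff.realize_formula M (v := fun i => jets L c (e.symm i).1))
  rw [Formula.realize_relabel] at h
  rw [hβ M hM, realize_subst_toNC]
  simp only [realize_wordAct_derTerm, Term.realize_var]
  refine (realize_core β fun i => ?_).symm.trans h
  simp only [Function.comp_apply, Equiv.symm_apply_apply]

end Completion

end NCDer
theorem mainTheorem3 {L : FirstOrder.Language.{u, v}} (ι : FirstOrder.Language.ring →ᴸ L) (K : Type w) [Field K]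
    [CharZero K] [Ring.CompatibleRing K] [L.Structure K] [ι.IsExpansionOn K]
    (hK : NCDer.AlgebraicallyBoundedOver L (NCDer.dclRing ι K))
    (k : ℕ) (η : Fin k → Derivation ℤ (NCDer.dclRing ι K) (NCDer.dclRing ι K)) :
    -- the models of the two theories are the models of `ncTheory` satisfying the schemes
    (∀ (M : Type (max u v w)) [(NCDer.ncLang L k).Structure M] [Nonempty M],
      letI : L.Structure M := (LHom.sumInl : L →ᴸ NCDer.ncLang L k).reduct M
      (M ⊨ NCDer.ncDeepTheory ι K η ↔
        M ⊨ NCDer.ncTheory ι K η ∧ NCDer.NCDeep L (NCDer.derMap L (k := k) M)) ∧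
      (M ⊨ NCDer.ncWideTheory ι K η ↔
        M ⊨ NCDer.ncTheory ι K η ∧ NCDer.NCWide L (NCDer.derMap L (k := k) M))) ∧
    -- the two theories are consistent and equivalent
    ((NCDer.ncDeepTheory ι K η).IsSatisfiable ∧ (NCDer.ncWideTheory ι K η).IsSatisfiable ∧
      NCDer.TheoryEquiv (NCDer.ncDeepTheory ι K η) (NCDer.ncWideTheory ι K η)) ∧
    -- model completion
    (NCDer.IsModelComplete.{u, v, max u v w} (L.completeTheory K) →
      NCDer.IsModelCompletion.{u, v, max u v w}
        (NCDer.ncTheory ι K η) (NCDer.ncDeepTheory ι K η) ∧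
      NCDer.IsModelCompletion.{u, v, max u v w}
        (NCDer.ncTheory ι K η) (NCDer.ncWideTheory ι K η)) ∧
    -- quantifier elimination
    (NCDer.HasQE (L.completeTheory K) →
      NCDer.HasQE (NCDer.ncDeepTheory ι K η) ∧ NCDer.HasQE (NCDer.ncWideTheory ι K η)) ∧
    -- reduction of formulas to `L`-formulas in the derivatives
    (∀ (n : ℕ) (α : (NCDer.ncLang L k).Formula (Fin n)),
      ∃ β : L.Formula (Fin n × FreeMonoid (Fin k)),
        (NCDer.ncDeepTheory ι K η).Iff α (NCDer.atJets β) ∧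
        (NCDer.ncWideTheory ι K η).Iff α (NCDer.atJets β)) := by
  have hiff : ∀ (M : Type (max u v w)) [(NCDer.ncLang L k).Structure M] [Nonempty M],
      M ⊨ NCDer.ncWideTheory ι K η ↔ M ⊨ NCDer.ncDeepTheory ι K η := fun _ _ _ =>
    (NCDer.model_ncDeepTheory_iff_ncWideTheory hK).symm
  refine ⟨fun M _ _ => ?_, ⟨(NCDer.isSatisfiable_ncTheories η hK).1,
    (NCDer.isSatisfiable_ncTheories η hK).2, ?_, ?_⟩, fun hT => ⟨?_, ?_⟩,
    fun hT => ⟨?_, ?_⟩, fun n α => ?_⟩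
  · let _ : L.Structure M := (LHom.sumInl : L →ᴸ NCDer.ncLang L k).reduct M
    have := (LHom.sumInl : L →ᴸ NCDer.ncLang L k).isExpansionOn_reduct M
    exact ⟨NCDer.model_ncDeepTheory_iff ι η hK, NCDer.model_ncWideTheory_iff ι η hK⟩
  · refine fun σ hσ => NCDer.models_of_forall.{u, v, w} (φ := σ) fun M c => ?_
    rw [Subsingleton.elim c default]
    exact ((hiff M).2 M.is_model).realize_of_mem σ hσ
  · refine fun σ hσ => NCDer.models_of_forall.{u, v, w} (φ := σ) fun M c => ?_
    rw [Subsingleton.elim c default]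
    exact ((hiff M).1 M.is_model).realize_of_mem σ hσ
  · exact NCDer.isModelCompletion_ncTheory hK hT fun _ _ _ => Iff.rfl
  · exact NCDer.isModelCompletion_ncTheory hK hT hiff
  · exact NCDer.hasQE_of_models hK hT fun _ _ _ => Iff.rfl
  · exact NCDer.hasQE_of_models hK hT hiff
  · obtain ⟨β, hβ⟩ := NCDer.exists_formula_jets hK η α
    have h : ∀ (M : Type (max u v w)) [(NCDer.ncLang L k).Structure M] [Nonempty M],
        M ⊨ NCDer.ncDeepTheory ι K η → ∀ c : Fin n → M,
          α.Realize c ↔ (NCDer.atJets β).Realize c := by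
      intro M _ _ hM c
      let _ : L.Structure M := (LHom.sumInl : L →ᴸ NCDer.ncLang L k).reduct M
      have := (LHom.sumInl : L →ᴸ NCDer.ncLang L k).isExpansionOn_reduct M
      rw [NCDer.realize_atJets]
      exact hβ M hM c
    exact ⟨β, NCDer.iff_of_forall.{u, v, w} fun M c => h M M.is_model c,
      NCDer.iff_of_forall.{u, v, w} fun M c => h M ((hiff M).1 M.is_model) c⟩
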